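/- Let $V=[n]$ be a set of $n\ge 1$ voters and $C=[m]$ a set of candidates. A profile $\mathcal P=(\succ_v)_{v\in V}$ consists of a strict linear order $\succ_v$ on $C$ for each voter. For a permutation $\sigma$ of $V$, $\mathcal P$ is two-crossing with respect to $\sigma$ if for all distinct $c,c'\in C$ there are at most two indices $i\in[n-1]$ for which exactly one of $\sigma_i,\sigma_{i+1}$ prefers $c$ to $c'$; it is two-crossing if this holds for some $\sigma$. Let $\rho:V\times C\to\mathbb Q$ be any misrepresentation function consistent with $\mathcal P$, i.e. $c\succ_v c'$ implies $\rho(v,c)\le\rho(v,c')$, and let $1\le k\le m$. A $k$-assignment is a map $w:V\to C$ with $|w(V)|\le k$; its total dissatisfaction is $\sum_{v\in V}\rho(v,w(v))$. The optimal dissatisfaction is the minimum of this quantity over all $k$-assignments, and the winning committees of the Chamberlin–Courant rule are the sets $w(V)$ for the $k$-assignments $w$ attaining the minimum. Time is measured on a uniform-cost random access machine on which natural numbers can be added, subtracted and compared, and the rational values of $\rho$ and their sums can be copied, added and compared, in unit time each. (1) There is an algorithm which, given $(\mathcal P,\rho,k)$ with $\mathcal P$ two-crossing and $\rho$ consistent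 with $\mathcal P$, computes the optimal dissatisfaction and some winning committee in time polynomial in $n$ and $m$. (2) There is an algorithm which, given $(\mathcal P,\rho,k)$ as in (1) together with a permutation $\sigma$ with respect to which $\mathcal P$ is two-crossing, computes the optimal dissatisfaction and some winning committee in time $O(n^3k^2m)$, with an absolute constant. -/

import Mathlib

/-! # Elections -/

/-- A preference profile of `n` voters over `m` candidates: every voter `v` has a strict linear
order on the candidates, and `P.prefers v c c'` means that `v` prefers `c` to `c'`. -/
structure Profile (n m : ℕ) where
  prefers : Fin n → Fin m → Fin m → Prop
  irrefl : ∀ v c, ¬ prefers v c c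
  trans : ∀ v a b c, prefers v a b → prefers v b c → prefers v a c
  total : ∀ v c c', c ≠ c' → prefers v c c' ∨ prefers v c' c

namespace Profile

variable {n m : ℕ}

/-- The number of candidates that voter `v` prefers to `c` (0 for the top choice). -/
noncomputable def rank (P : Profile n m) (v : Fin n) (c : Fin m) : ℕ :=
  {c' : Fin m | P.prefers v c' c}.ncard

/-- The places `i`, `i + 1` between which the pair `c`, `c'` crosses, when the voters are listed
in the order `σ 0, σ 1, …, σ (n - 1)`. -/
def crossings (P : Profile n m) (σ : Equiv.Perm (Fin n)) (c c' : Fin m) : Set (Fin n) :=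
  {i | ∃ h : i.val + 1 < n,
    ¬ (P.prefers (σ i) c c' ↔ P.prefers (σ ⟨i.val + 1, h⟩) c c')}

/-- `P` is `q`-crossing with respect to `σ`. -/
def IsCrossingWrt (P : Profile n m) (q : ℕ) (σ : Equiv.Perm (Fin n)) : Prop :=
  ∀ c c' : Fin m, c ≠ c' → (P.crossings σ c c').ncard ≤ q

/-- `P` is `q`-crossing. -/
def IsCrossing (P : Profile n m) (q : ℕ) : Prop :=
  ∃ σ : Equiv.Perm (Fin n), P.IsCrossingWrt q σ

/-- The misrepresentation function `ρ` is consistent with `P`. -/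
def Consistent (P : Profile n m) (ρ : Fin n → Fin m → ℚ) : Prop :=
  ∀ v c c', P.prefers v c c' → ρ v c ≤ ρ v c'

end Profile

/-! # The Chamberlin–Courant rule -/

namespace ChamberlinCourant

variable {n m : ℕ}

/-- `w` is a `k`-assignment: it uses at most `k` candidates. -/
def IsAssignment (k : ℕ) (w : Fin n → Fin m) : Prop :=
  (Set.range w).ncard ≤ k

/-- The total dissatisfaction of the voters under `w`. -/
def dissatisfaction (ρ : Fin n → Fin m → ℚ) (w : Fin n → Fin m) : ℚ :=
  ∑ v, ρ v (w v)

/-- `w` is an optimal `k`-assignment. -/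
def IsOptimal (ρ : Fin n → Fin m → ℚ) (k : ℕ) (w : Fin n → Fin m) : Prop :=
  IsAssignment k w ∧ ∀ w' : Fin n → Fin m, IsAssignment k w' →
    dissatisfaction ρ w ≤ dissatisfaction ρ w'

/-- `W` is a winning committee. -/
def IsWinningCommittee (ρ : Fin n → Fin m → ℚ) (k : ℕ) (W : Set (Fin m)) : Prop :=
  ∃ w : Fin n → Fin m, IsOptimal ρ k w ∧ W = Set.range w

/-- `x` is the least total dissatisfaction of a `k`-assignment. -/
def IsOptimalDissatisfaction (ρ : Fin n → Fin m → ℚ) (k : ℕ) (x : ℚ) : Prop :=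
  IsLeast {y | ∃ w : Fin n → Fin m, IsAssignment k w ∧ y = dissatisfaction ρ w} x

end ChamberlinCourant

/-! # A uniform-cost random access machine

The machine has variables and arrays, both numbered by literals of the program. There are two
sorts of them: natural numbers, which can be added, subtracted (truncated at 0), compared and used
as array indices, and rational numbers, which can only be copied, added and compared. Each of these
operations and each memory access costs one step; there is no multiplication and no conversion
between the two sorts. Programs are structured (`while` programs). -/

namespace RAM

/-- The memory of the machine. -/
structure Store where
  /-- variables for natural numbers -/
  nvar : ℕ → ℕ
  /-- arrays of natural numbers: `narr a i` is entry `i` of array `a` -/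
  narr : ℕ → ℕ → ℕ
  /-- variables for rational numbers -/
  qvar : ℕ → ℚ
  /-- arrays of rational numbers -/
  qarr : ℕ → ℕ → ℚ

/-- Expressions with a natural number as value. -/
inductive NExpr where
  | const (c : ℕ)
  | var (x : ℕ)
  | get (a : ℕ) (i : NExpr)
  | add (e f : NExpr)
  | sub (e f : NExpr)

/-- The value of an expression. -/
def NExpr.eval (s : Store) : NExpr → ℕ
  | const c => c
  | var x => s.nvar x
  | get a i => s.narr a (i.eval s)
  | add e f => e.eval s + f.eval s
  | sub e f => e.eval s - f.eval s

/-- The number of steps that an evaluation takes. -/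
def NExpr.cost : NExpr → ℕ
  | const _ => 1
  | var _ => 1
  | get _ i => 1 + i.cost
  | add e f => 1 + e.cost + f.cost
  | sub e f => 1 + e.cost + f.cost

/-- Expressions with a rational number as value. -/
inductive QExpr where
  | zero
  | var (x : ℕ)
  | get (a : ℕ) (i : NExpr)
  | add (e f : QExpr)

/-- The value of an expression. -/
def QExpr.eval (s : Store) : QExpr → ℚ
  | zero => 0
  | var x => s.qvar x
  | get a i => s.qarr a (i.eval s)
  | add e f => e.eval s + f.eval s

/-- The number of steps that an evaluation takes. -/
def QExpr.cost : QExpr → ℕ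
  | zero => 1
  | var _ => 1
  | get _ i => 1 + i.cost
  | add e f => 1 + e.cost + f.cost

/-- Tests: `e ≤ f` for natural or for rational numbers. -/
inductive Test where
  | nle (e f : NExpr)
  | qle (e f : QExpr)

/-- The test `b` succeeds. -/
def Test.Holds (s : Store) : Test → Prop
  | nle e f => e.eval s ≤ f.eval s
  | qle e f => e.eval s ≤ f.eval s

/-- The number of steps that a test takes. -/
def Test.cost : Test → ℕ
  | nle e f => 1 + e.cost + f.cost
  | qle e f => 1 + e.cost + f.cost

/-- Programs. -/
inductive Program where
  /-- do nothing -/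
  | skip
  /-- variable `x` becomes `e` -/
  | nset (x : ℕ) (e : NExpr)
  /-- entry `i` of array `a` becomes `e` -/
  | nput (a : ℕ) (i : NExpr) (e : NExpr)
  /-- rational variable `x` becomes `e` -/
  | qset (x : ℕ) (e : QExpr)
  /-- entry `i` of rational array `a` becomes `e` -/
  | qput (a : ℕ) (i : NExpr) (e : QExpr)
  /-- first `p`, then `q` -/
  | seq (p q : Program)
  /-- `p` if the test succeeds, otherwise `q` -/
  | ite (b : Test) (p q : Program)
  /-- repeat `p` while the test succeeds -/
  | loop (b : Test) (p : Program)

open Function in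
/-- `Runs p s t s'`: the program `p`, started on the memory `s`, halts after exactly `t` steps with
the memory `s'`. -/
inductive Runs : Program → Store → ℕ → Store → Prop where
  | skip (s) : Runs .skip s 1 s
  | nset (x e s) :
      Runs (.nset x e) s (1 + e.cost) { s with nvar := update s.nvar x (e.eval s) }
  | nput (a i e s) :
      Runs (.nput a i e) s (1 + i.cost + e.cost)
        { s with narr := update s.narr a (update (s.narr a) (i.eval s) (e.eval s)) }
  | qset (x e s) :
      Runs (.qset x e) s (1 + e.cost) { s with qvar := update s.qvar x (e.eval s) }
  | qput (a i e s) :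
      Runs (.qput a i e) s (1 + i.cost + e.cost)
        { s with qarr := update s.qarr a (update (s.qarr a) (i.eval s) (e.eval s)) }
  | seq {p q s s₁ s₂ t₁ t₂} (hp : Runs p s t₁ s₁) (hq : Runs q s₁ t₂ s₂) :
      Runs (.seq p q) s (t₁ + t₂) s₂
  | ite_true {b p q s s' t} (hb : b.Holds s) (hp : Runs p s t s') :
      Runs (.ite b p q) s (b.cost + t) s'
  | ite_false {b p q s s' t} (hb : ¬ b.Holds s) (hq : Runs q s t s') :
      Runs (.ite b p q) s (b.cost + t) s'
  | loop_true {b p s s₁ s₂ t₁ t₂} (hb : b.Holds s) (hp : Runs p s t₁ s₁)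
      (hl : Runs (.loop b p) s₁ t₂ s₂) : Runs (.loop b p) s (b.cost + t₁ + t₂) s₂
  | loop_false {b p s} (hb : ¬ b.Holds s) : Runs (.loop b p) s b.cost s

/-- The machine is deterministic. -/
theorem Runs.unique {p : Program} {s s₁ s₂ : Store} {t₁ t₂ : ℕ}
    (h₁ : Runs p s t₁ s₁) (h₂ : Runs p s t₂ s₂) : t₁ = t₂ ∧ s₁ = s₂ := by
  induction h₁ generalizing t₂ s₂ with
  | skip | nset | nput | qset | qput => cases h₂; exact ⟨rfl, rfl⟩
  | seq _ _ ihp ihq =>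
    cases h₂ with
    | seq hp hq =>
      obtain ⟨rfl, rfl⟩ := ihp hp
      obtain ⟨rfl, rfl⟩ := ihq hq
      exact ⟨rfl, rfl⟩
  | ite_true hb _ ih =>
    cases h₂ with
    | ite_true _ hp => obtain ⟨rfl, rfl⟩ := ih hp; exact ⟨rfl, rfl⟩
    | ite_false hb' _ => exact absurd hb hb'
  | ite_false hb _ ih =>
    cases h₂ with
    | ite_true hb' _ => exact absurd hb' hb
    | ite_false _ hp => obtain ⟨rfl, rfl⟩ := ih hp; exact ⟨rfl, rfl⟩
  | loop_true hb _ _ ihp ihl =>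
    cases h₂ with
    | loop_true _ hp hl =>
      obtain ⟨rfl, rfl⟩ := ihp hp
      obtain ⟨rfl, rfl⟩ := ihl hl
      exact ⟨rfl, rfl⟩
    | loop_false hb' => exact absurd hb hb'
  | loop_false hb =>
    cases h₂ with
    | loop_true hb' _ _ => exact absurd hb' hb
    | loop_false _ => exact ⟨rfl, rfl⟩

end RAM

/-! # Input and output -/

namespace ChamberlinCourant

variable {n m : ℕ}

/-- An `n × m` table stored row by row: entry `v * m + c` is `f v c`, the other entries are 0. -/
def table {α : Type} [Zero α] (f : Fin n → Fin m → α) (i : ℕ) : α :=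
  if h : i < n * m then f (Fin.divNat ⟨i, h⟩) (Fin.modNat ⟨i, h⟩) else 0

/-- The initial memory for the instance `(P, ρ, k)`: the variables 0, 1, 2 hold `n`, `m`, `k`,
array 0 holds the rank of each candidate in the preferences of each voter, rational array 0 holds
the values of `ρ`, and everything else is 0. -/
noncomputable def input (P : Profile n m) (ρ : Fin n → Fin m → ℚ) (k : ℕ) : RAM.Store where
  nvar
    | 0 => n
    | 1 => m
    | 2 => k
    | _ => 0
  narr
    | 0 => table P.rank
    | _ => fun _ => 0
  qvar _ := 0
  qarr
    | 0 => table ρ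
    | _ => fun _ => 0

/-- The initial memory for the instance `(P, ρ, k)` and an ordering `σ` of the voters, which is
stored in array 1. -/
noncomputable def inputWithOrder (P : Profile n m) (ρ : Fin n → Fin m → ℚ) (k : ℕ)
    (σ : Equiv.Perm (Fin n)) : RAM.Store :=
  { input P ρ k with
    narr := Function.update (input P ρ k).narr 1
      (fun i => if h : i < n then (σ ⟨i, h⟩).val else 0) }

/-- The final memory holds the optimal total dissatisfaction (in rational variable 0) and a winning
committee (array 2 holds 1 exactly at its members, among the indices below `m`). -/
def Solved (ρ : Fin n → Fin m → ℚ) (k : ℕ) (s : RAM.Store) : Prop :=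
  IsOptimalDissatisfaction ρ k (s.qvar 0) ∧
    IsWinningCommittee ρ k {c : Fin m | s.narr 2 c.val = 1}

end ChamberlinCourant

/-! # Reasoning about programs -/

namespace RAM

open Function

/-! List the voters in a two-crossing order. Three changes of preference need three crossings, so no
four voters alternate between two candidates (`NoAlternation`). Replacing each voter's candidate by
the voter's favourite within the same committee does not increase the dissatisfaction, and the
resulting assignment is non-crossing: the pattern `c, d, c, d` with `c ≠ d` would be an alternation.
The optimum is therefore bounded below by the optimum over non-crossing assignments.

Such assignments are nested, which gives a recursion over intervals. `gapCost i j l c` serves `[i,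
j)` with a candidate `c` that is already paid for and `l` further ones. Either `c` serves `i`, or
the positions up to the next use of `c` form a gap `[i, t)` with candidates of its own; the
candidates of the gap do not return after `t`, so the two counts add up. `gapCost_le_sum` is the
resulting lower bound. Conversely, following the recorded choices with a stack yields an assignment
with at most `k` candidates and exactly the computed cost (`within_readOff`), so both are optimal.
There are about `n²km` entries with about `nk` options each, whence `n³k²m`.

If no order is given, one is computed. Absence of alternation is invariant under rotation of the
order, so the circle of voters may be cut at voter 0. The sets of voters who disagree with voter 0
on a pair of candidates then become intervals, and it suffices to find a linear order in which all
these sets are consecutive. The search keeps a ranking with ties that is `Stable`: no element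
outside a set lies between, or level with, two differently ranked elements of the set. Breaking the
ties of a stable ranking by any solution gives a solution again (`Stable.isOrder_lex`), so a stable
ranking is never a dead end and no backtracking is needed. The search separates one element from its
ties, carries out all splits that this forces, and keeps the result if it is stable. Some choice of
the element succeeds as long as ties remain, namely the element that a solution places first in its
tie (`IsFirst.compatible`, `within_tryElement`).

Running times are proved in a small program logic: `Within` for total correctness with a time bound,
and `Agree` as frame rule. -/

/-- `p` assigns to the natural variable `x` somewhere. -/
def Program.setsN : Program → ℕ → Bool
  | nset x _, y => x == y
  | seq p q, y => p.setsN y || q.setsN y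
  | ite _ p q, y => p.setsN y || q.setsN y
  | loop _ p, y => p.setsN y
  | _, _ => false

/-- `p` assigns to an entry of the natural array `a` somewhere. -/
def Program.putsN : Program → ℕ → Bool
  | nput a _ _, y => a == y
  | seq p q, y => p.putsN y || q.putsN y
  | ite _ p q, y => p.putsN y || q.putsN y
  | loop _ p, y => p.putsN y
  | _, _ => false

/-- `p` assigns to the rational variable `x` somewhere. -/
def Program.setsQ : Program → ℕ → Bool
  | qset x _, y => x == y
  | seq p q, y => p.setsQ y || q.setsQ y
  | ite _ p q, y => p.setsQ y || q.setsQ y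
  | loop _ p, y => p.setsQ y
  | _, _ => false

/-- `p` assigns to an entry of the rational array `a` somewhere. -/
def Program.putsQ : Program → ℕ → Bool
  | qput a _ _, y => a == y
  | seq p q, y => p.putsQ y || q.putsQ y
  | ite _ p q, y => p.putsQ y || q.putsQ y
  | loop _ p, y => p.putsQ y
  | _, _ => false

/-- The stores `s` and `s'` agree on everything to which `p` does not assign. -/
structure Agree (p : Program) (s s' : Store) : Prop where
  nvar : ∀ x, p.setsN x = false → s'.nvar x = s.nvar x
  narr : ∀ a, p.putsN a = false → s'.narr a = s.narr a
  qvar : ∀ x, p.setsQ x = false → s'.qvar x = s.qvar x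
  qarr : ∀ a, p.putsQ a = false → s'.qarr a = s.qarr a

theorem Agree.refl (p : Program) (s : Store) : Agree p s s :=
  ⟨fun _ _ => rfl, fun _ _ => rfl, fun _ _ => rfl, fun _ _ => rfl⟩

theorem Agree.trans {p : Program} {s₁ s₂ s₃ : Store} (h : Agree p s₁ s₂) (h' : Agree p s₂ s₃) :
    Agree p s₁ s₃ :=
  ⟨fun x hx => (h'.nvar x hx).trans (h.nvar x hx), fun x hx => (h'.narr x hx).trans (h.narr x hx),
    fun x hx => (h'.qvar x hx).trans (h.qvar x hx), fun x hx => (h'.qarr x hx).trans (h.qarr x hx)⟩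

/-- Assignments of `p` are among those of `q`. -/
def Program.Sub (p q : Program) : Prop :=
  (∀ x, q.setsN x = false → p.setsN x = false) ∧ (∀ x, q.putsN x = false → p.putsN x = false) ∧
    (∀ x, q.setsQ x = false → p.setsQ x = false) ∧ (∀ x, q.putsQ x = false → p.putsQ x = false)

theorem Program.Sub.trans {p q u : Program} (h : p.Sub q) (h' : q.Sub u) : p.Sub u :=
  ⟨fun x hx => h.1 x (h'.1 x hx), fun x hx => h.2.1 x (h'.2.1 x hx),
    fun x hx => h.2.2.1 x (h'.2.2.1 x hx), fun x hx => h.2.2.2 x (h'.2.2.2 x hx)⟩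

theorem Agree.mono {p q : Program} {s s' : Store} (h : Agree p s s') (hpq : p.Sub q) :
    Agree q s s' :=
  ⟨fun x hx => h.nvar x (hpq.1 x hx), fun x hx => h.narr x (hpq.2.1 x hx),
    fun x hx => h.qvar x (hpq.2.2.1 x hx), fun x hx => h.qarr x (hpq.2.2.2 x hx)⟩

theorem Program.sub_seq_left (p q : Program) : p.Sub (seq p q) := by
  refine ⟨?_, ?_, ?_, ?_⟩ <;> intro x hx <;>
    simp only [setsN, putsN, setsQ, putsQ, Bool.or_eq_false_iff] at hx <;> exact hx.1

theorem Program.sub_seq_right (p q : Program) : q.Sub (seq p q) := by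
  refine ⟨?_, ?_, ?_, ?_⟩ <;> intro x hx <;>
    simp only [setsN, putsN, setsQ, putsQ, Bool.or_eq_false_iff] at hx <;> exact hx.2

theorem Program.sub_ite_left (b : Test) (p q : Program) : p.Sub (ite b p q) := by
  refine ⟨?_, ?_, ?_, ?_⟩ <;> intro x hx <;>
    simp only [setsN, putsN, setsQ, putsQ, Bool.or_eq_false_iff] at hx <;> exact hx.1

theorem Program.sub_ite_right (b : Test) (p q : Program) : q.Sub (ite b p q) := by
  refine ⟨?_, ?_, ?_, ?_⟩ <;> intro x hx <;>
    simp only [setsN, putsN, setsQ, putsQ, Bool.or_eq_false_iff] at hx <;> exact hx.2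

theorem Program.sub_loop (b : Test) (p : Program) : p.Sub (loop b p) :=
  ⟨fun _ hx => hx, fun _ hx => hx, fun _ hx => hx, fun _ hx => hx⟩

/-- The frame rule. As `setsN` and its companions are Boolean functions of the program text, the
absence of an assignment is settled by `rfl` or `decide`, and invariants need only mention what
changes. -/
theorem Runs.agree {p : Program} {s s' : Store} {t : ℕ} (h : Runs p s t s') : Agree p s s' := by
  induction h with
  | skip | loop_false => exact .refl _ _
  | nset x e s =>
    refine ⟨fun y hy => ?_, fun _ _ => rfl, fun _ _ => rfl, fun _ _ => rfl⟩
    simp only [Program.setsN, beq_eq_false_iff_ne] at hy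
    exact update_of_ne (Ne.symm hy) _ _
  | nput a i e s =>
    refine ⟨fun _ _ => rfl, fun y hy => ?_, fun _ _ => rfl, fun _ _ => rfl⟩
    simp only [Program.putsN, beq_eq_false_iff_ne] at hy
    exact update_of_ne (Ne.symm hy) _ _
  | qset x e s =>
    refine ⟨fun _ _ => rfl, fun _ _ => rfl, fun y hy => ?_, fun _ _ => rfl⟩
    simp only [Program.setsQ, beq_eq_false_iff_ne] at hy
    exact update_of_ne (Ne.symm hy) _ _
  | qput a i e s =>
    refine ⟨fun _ _ => rfl, fun _ _ => rfl, fun _ _ => rfl, fun y hy => ?_⟩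
    simp only [Program.putsQ, beq_eq_false_iff_ne] at hy
    exact update_of_ne (Ne.symm hy) _ _
  | seq _ _ ihp ihq =>
    exact (ihp.mono (Program.sub_seq_left _ _)).trans (ihq.mono (Program.sub_seq_right _ _))
  | ite_true _ _ ih => exact ih.mono (Program.sub_ite_left _ _ _)
  | ite_false _ _ ih => exact ih.mono (Program.sub_ite_right _ _ _)
  | loop_true _ _ _ ihp ihl => exact (ihp.mono (Program.sub_loop _ _)).trans ihl

/-- Started on `s`, the program `p` halts after at most `T` steps with a memory satisfying `Q`. -/
def Within (p : Program) (s : Store) (T : ℕ) (Q : Store → Prop) : Prop :=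
  ∃ t s', Runs p s t s' ∧ t ≤ T ∧ Q s'

namespace Within

variable {p q : Program} {s : Store} {T T₁ T₂ : ℕ} {Q Q' : Store → Prop}

/-- The new postcondition may use `Agree`, so that each application brings the frame rule along. -/
theorem conseq (h : Within p s T₁ Q) (hT : T₁ ≤ T₂)
    (hQ : ∀ s', Agree p s s' → Q s' → Q' s') : Within p s T₂ Q' := by
  obtain ⟨t, s', hr, ht, hq⟩ := h
  exact ⟨t, s', hr, ht.trans hT, hQ s' hr.agree hq⟩

theorem mono (h : Within p s T₁ Q) (hT : T₁ ≤ T₂) : Within p s T₂ Q :=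
  h.conseq hT fun _ _ hq => hq

theorem skip (h : Q s) : Within .skip s 1 Q := ⟨1, s, .skip s, le_rfl, h⟩

theorem nset {x : ℕ} {e : NExpr} (h : Q { s with nvar := update s.nvar x (e.eval s) }) :
    Within (.nset x e) s (1 + e.cost) Q := ⟨_, _, .nset x e s, le_rfl, h⟩

theorem nput {a : ℕ} {i e : NExpr}
    (h : Q { s with narr := update s.narr a (update (s.narr a) (i.eval s) (e.eval s)) }) :
    Within (.nput a i e) s (1 + i.cost + e.cost) Q := ⟨_, _, .nput a i e s, le_rfl, h⟩

theorem qset {x : ℕ} {e : QExpr} (h : Q { s with qvar := update s.qvar x (e.eval s) }) :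
    Within (.qset x e) s (1 + e.cost) Q := ⟨_, _, .qset x e s, le_rfl, h⟩

theorem qput {a : ℕ} {i : NExpr} {e : QExpr}
    (h : Q { s with qarr := update s.qarr a (update (s.qarr a) (i.eval s) (e.eval s)) }) :
    Within (.qput a i e) s (1 + i.cost + e.cost) Q := ⟨_, _, .qput a i e s, le_rfl, h⟩

theorem seq (h : Within p s T₁ fun s' => Within q s' T₂ Q) :
    Within (.seq p q) s (T₁ + T₂) Q := by
  obtain ⟨t, s', hr, ht, t', s'', hr', ht', hq⟩ := h
  exact ⟨_, _, .seq hr hr', add_le_add ht ht', hq⟩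

theorem ite {b : Test} (hp : b.Holds s → Within p s T₁ Q) (hq : ¬ b.Holds s → Within q s T₂ Q) :
    Within (.ite b p q) s (b.cost + (T₁ + T₂)) Q := by
  by_cases hb : b.Holds s
  · obtain ⟨t, s', hr, ht, h⟩ := hp hb
    exact ⟨_, _, .ite_true hb hr, by omega, h⟩
  · obtain ⟨t, s', hr, ht, h⟩ := hq hb
    exact ⟨_, _, .ite_false hb hr, by omega, h⟩

/-- A loop that decreases `μ` in each round. -/
theorem loop {b : Test} (I : Store → Prop) (μ : Store → ℕ)
    (step : ∀ s', Agree p s s' → I s' → b.Holds s' →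
      Within p s' T fun s'' => I s'' ∧ μ s'' < μ s') (h : I s) :
    Within (.loop b p) s (μ s * (b.cost + T) + b.cost) fun s' => I s' ∧ ¬ b.Holds s' := by
  suffices H : ∀ (N : ℕ) (s' : Store), μ s' ≤ N → Agree p s s' → I s' →
      Within (.loop b p) s' (N * (b.cost + T) + b.cost) fun s' => I s' ∧ ¬ b.Holds s' from
    H _ s le_rfl (.refl _ _) h
  intro N
  induction N with
  | zero =>
    intro s' hN ha hI
    by_cases hb : b.Holds s'
    · obtain ⟨t, s'', -, -, -, hlt⟩ := step s' ha hI hb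
      omega
    · exact ⟨_, _, .loop_false hb, by omega, hI, hb⟩
  | succ N ih =>
    intro s' hN ha hI
    by_cases hb : b.Holds s'
    · obtain ⟨t, s'', hr, ht, hI', hlt⟩ := step s' ha hI hb
      obtain ⟨t', s₃, hr', ht', hq⟩ := ih s'' (by omega) (ha.trans hr.agree) hI'
      exact ⟨_, _, .loop_true hb hr hr', by rw [Nat.succ_mul]; omega, hq⟩
    · exact ⟨_, _, .loop_false hb, by omega, hI, hb⟩

end Within

/-- `for x in 0, …, e - 1 do p`. -/
def Program.for (x : ℕ) (e : NExpr) (p : Program) : Program :=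
  .seq (.nset x (.const 0))
    (.loop (.nle (.add (.var x) (.const 1)) e) (.seq p (.nset x (.add (.var x) (.const 1)))))

/-- A round costs at most `C * X`, and `B` bounds the number of rounds. As `B` and `X` are positive,
initialisation, tests and increments are absorbed into the constant, and nested loops yield a
constant times a product. The increment comes after the body, so `I (i + 1)` speaks of the memory
with the counter already advanced. -/
theorem Within.for {x : ℕ} {e : NExpr} {p : Program} {s : Store} {C : ℕ}
    (N B X : ℕ) (I : ℕ → Store → Prop) (hN : N ≤ B) (hB : 1 ≤ B) (hX : 1 ≤ X)
    (he : ∀ s', Agree (Program.for x e p) s s' → e.eval s' = N)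
    (hx : p.setsN x = false)
    (h₀ : I 0 { s with nvar := update s.nvar x 0 })
    (step : ∀ i < N, ∀ s', Agree (Program.for x e p) s s' → s'.nvar x = i → I i s' →
      Within p s' (C * X) fun s'' => I (i + 1) { s'' with nvar := update s''.nvar x (i + 1) }) :
    Within (Program.for x e p) s ((C + 2 * e.cost + 14) * (B * X)) fun s' => I N s' := by
  have hfor : ∀ s', Agree (Program.for x e p) { s with nvar := update s.nvar x 0 } s' →
      Agree (Program.for x e p) s s' := by
    intro s' h
    refine Agree.trans ?_ h
    exact (Runs.nset x (.const 0) s).agree.mono (Program.sub_seq_left _ _)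
  refine Within.mono (T₁ := (1 + 1) + (N * (4 + e.cost + (C * X + 4)) + (4 + e.cost))) ?_ ?_
  · refine Within.seq (Within.nset ?_)
    refine (Within.loop (T := C * X + 4)
      (fun s' => ∃ i, i ≤ N ∧ s'.nvar x = i ∧ I i s') (fun s' => N - s'.nvar x)
      ?_ ⟨0, by omega, by simp, h₀⟩).conseq ?_ ?_
    · rintro s' ha ⟨i, hi, hxi, hI⟩ hb
      have ha' : Agree (Program.for x e p) s s' :=
        hfor s' ((ha.mono (Program.sub_loop _ _)).mono (Program.sub_seq_right _ _))
      simp only [Test.Holds, NExpr.eval, he s' ha', hxi] at hb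
      refine Within.seq ((step i (by omega) s' ha' hxi hI).conseq le_rfl ?_)
      intro s'' ha'' hI''
      have : s''.nvar x = i := (ha''.nvar x hx).trans hxi
      refine Within.nset ?_
      simp only [NExpr.eval, this, hxi]
      refine ⟨⟨i + 1, by omega, by simp, hI''⟩, ?_⟩
      simp only [update_self]
      omega
    · simp only [update_self, Test.cost, NExpr.cost]
      apply le_of_eq; rw [Nat.sub_zero]
    · rintro s' ha ⟨⟨i, hi, hxi, hI⟩, hb⟩
      have ha' : Agree (Program.for x e p) s s' := hfor s' (ha.mono (Program.sub_seq_right _ _))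
      simp only [Test.Holds, NExpr.eval, he s' ha', hxi] at hb
      obtain rfl : i = N := by omega
      exact hI
  · have h1 : N * (C * X) ≤ B * (C * X) := Nat.mul_le_mul_right _ hN
    have h2 : N * (8 + e.cost) ≤ (B * X) * (8 + e.cost) :=
      Nat.mul_le_mul_right _ (hN.trans (Nat.le_mul_of_pos_right _ hX))
    have h3 : 1 * (6 + e.cost) ≤ (B * X) * (6 + e.cost) :=
      Nat.mul_le_mul_right _ (Nat.mul_pos hB hX)
    nlinarith

end RAM

/-! # Non-crossing assignments -/

namespace ChamberlinCourant

open Finset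

/-- The least cost of serving the positions `i, …, j - 1` with a nested assignment that uses
candidate `c` and at most `l` further candidates. -/
def gapCost (m : ℕ) (r : ℕ → ℕ → ℚ) (i j l c : ℕ) : ℚ :=
  if i < j then
    -- A pair `(t, l')` gives the gap `[i, t)` its own `l' + 1` candidates and leaves `l - 1 - l'`
    -- for `[t, j)`. The inner fold is `intervalCost` written out, since that depends on the present
    -- function. `attach` supplies the bounds needed for termination.
    (Ioc i j ×ˢ range l).attach.fold min (r i c + gapCost m r (i + 1) j l c) fun p =>
      (range m).fold min (gapCost m r i p.1.1 p.1.2 0) (fun c' => gapCost m r i p.1.1 p.1.2 c') +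
        gapCost m r p.1.1 j (l - 1 - p.1.2) c
  else 0
-- Only a gap that fills all of `[i, j)` fails to shorten the interval, and it has `l' < l`.
termination_by (j - i, l)
decreasing_by
  · left; omega
  all_goals
    have hp := p.2
    simp only [mem_product, mem_Ioc, mem_range] at hp
    first
    | (left; omega)
    | (rcases hp.1.2.lt_or_eq with h | h
       · left; omega
       · rw [h]; right; exact hp.2)

/-- The least cost of serving the positions `i, …, j - 1` with a nested assignment that uses at
most `l + 1` candidates. -/
def intervalCost (m : ℕ) (r : ℕ → ℕ → ℚ) (i j l : ℕ) : ℚ :=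
  -- The starting value belongs to candidate 0, which takes part in the minimum anyway if `0 < m`.
  (range m).fold min (gapCost m r i j l 0) (gapCost m r i j l)

variable {m : ℕ} {r : ℕ → ℕ → ℚ} {i j l c : ℕ}

theorem gapCost_self : gapCost m r j j l c = 0 := by
  rw [gapCost, if_neg (lt_irrefl _)]

theorem le_gapCost_iff (h : i < j) {x : ℚ} :
    x ≤ gapCost m r i j l c ↔ x ≤ r i c + gapCost m r (i + 1) j l c ∧
      ∀ t l', i < t → t ≤ j → l' < l →
        x ≤ intervalCost m r i t l' + gapCost m r t j (l - 1 - l') c := by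
  rw [gapCost, if_pos h, le_fold_min]
  refine and_congr_right fun _ => ⟨fun H t l' h1 h2 h3 => ?_, fun H p _ => ?_⟩
  · exact H ⟨(t, l'), by simp [*]⟩ (mem_attach _ _)
  · have hp := p.2
    simp only [mem_product, mem_Ioc, mem_range] at hp
    exact H _ _ hp.1.1 hp.1.2 hp.2

theorem le_intervalCost_iff (hm : 0 < m) {x : ℚ} :
    x ≤ intervalCost m r i j l ↔ ∀ c < m, x ≤ gapCost m r i j l c := by
  rw [intervalCost, le_fold_min]
  exact ⟨fun H c hc => H.2 c (mem_range.2 hc),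
    fun H => ⟨H 0 hm, fun c hc => H c (mem_range.1 hc)⟩⟩

/-- There are no positions `p₁ < p₂ < p₃ < p₄` in `[i, j)` that `w` serves by `c`, `d`, `c`, `d`
with `c ≠ d`. -/
def NonCrossing (w : ℕ → ℕ) (i j : ℕ) : Prop :=
  ∀ p₁ p₂ p₃ p₄, i ≤ p₁ → p₁ < p₂ → p₂ < p₃ → p₃ < p₄ → p₄ < j → w p₁ = w p₃ → w p₂ = w p₄ →
    w p₁ = w p₂

theorem NonCrossing.mono {w : ℕ → ℕ} {i j i' j' : ℕ} (h : NonCrossing w i j) (hi : i ≤ i')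
    (hj : j' ≤ j) : NonCrossing w i' j' :=
  fun p₁ p₂ p₃ p₄ h1 h2 h3 h4 h5 => h p₁ p₂ p₃ p₄ (hi.trans h1) h2 h3 h4 (h5.trans_le hj)

/-- Induction on the length. The extra hypothesis says that no other candidate encloses a position
served by `c`; it is what makes the candidates before and after the next use of `c` disjoint. Inside
a gap the role of `c` passes to the candidate that serves its first position. -/
theorem gapCost_le_sum (hm : 0 < m) {w : ℕ → ℕ} :
    ∀ (d i j l c : ℕ), j = i + d → (∀ p, i ≤ p → p < j → w p < m) → NonCrossing w i j →
      (∀ p t q, i ≤ p → p < t → t < q → q < j → w t = c → w p = w q → w p = c) →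
      (((Ico i j).image w).erase c).card ≤ l →
      gapCost m r i j l c ≤ ∑ p ∈ Ico i j, r p (w p) := by
  intro d
  induction d using Nat.strong_induction_on with
  | _ d ih =>
  intro i j l c hd hw hnc hc hl
  obtain rfl | hd0 := Nat.eq_zero_or_pos d
  · subst hd
    simp [gapCost_self]
  have hij : i < j := by omega
  obtain ⟨hfirst, hgap⟩ := (le_gapCost_iff (m := m) (r := r) (l := l) (c := c) hij).1 le_rfl
  by_cases hwi : w i = c
  · rw [sum_eq_sum_Ico_succ_bot hij, hwi]
    refine hfirst.trans (add_le_add_right (ih (d - 1) (by omega) (i + 1) j l c (by omega)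
      (fun p hp => hw p (by omega)) (hnc.mono (by omega) le_rfl)
      (fun p t q hp => hc p t q (by omega)) (le_trans (card_le_card ?_) hl)) _)
    exact erase_subset_erase _ (image_subset_image (Ico_subset_Ico_left (by omega)))
  · -- the next position served by `c`
    obtain ⟨t, hit, htj, htc, hct⟩ : ∃ t, i < t ∧ t ≤ j ∧ (∀ p, i ≤ p → p < t → w p ≠ c) ∧
        (t < j → w t = c) := by
      by_cases hex : ∃ t, i ≤ t ∧ t < j ∧ w t = c
      · classical
        refine ⟨Nat.find hex, ?_, (Nat.find_spec hex).2.1.le, ?_, fun _ => (Nat.find_spec hex).2.2⟩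
        · refine lt_of_le_of_ne (Nat.find_spec hex).1 fun h => hwi ?_
          have := (Nat.find_spec hex).2.2
          rwa [← h] at this
        · intro p hp hpt h
          exact Nat.find_min hex hpt ⟨hp, hpt.trans (Nat.find_spec hex).2.1, h⟩
      · push Not at hex
        exact ⟨j, hij, le_rfl, fun p hp hpj => hex p hp hpj, fun h => absurd h (lt_irrefl _)⟩
    set A := (Ico i t).image w with hA
    set B := ((Ico t j).image w).erase c with hB
    -- A candidate on both sides of `t` would enclose the position `t`, which is served by `c`.
    have hdisj : Disjoint A B := by
      rw [Finset.disjoint_left]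
      intro a haA haB
      simp only [hA, hB, mem_image, mem_erase, mem_Ico] at haA haB
      obtain ⟨p, ⟨hp1, hp2⟩, rfl⟩ := haA
      obtain ⟨hne, q, ⟨hq1, hq2⟩, hq3⟩ := haB
      have hwt := hct (by omega)
      have htq : t < q := by
        refine lt_of_le_of_ne hq1 fun h => hne ?_
        rw [← hq3, ← h, hwt]
      exact hne (hc p t q hp1 hp2 htq hq2 hwt hq3.symm)
    have hunion : ((Ico i j).image w).erase c = A ∪ B := by
      rw [← Ico_union_Ico_eq_Ico hit.le htj, image_union, erase_union_distrib, hB, ← hA,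
        erase_eq_of_notMem]
      simp only [hA, mem_image, mem_Ico, not_exists, not_and]
      exact fun p hp => htc p hp.1 hp.2
    rw [hunion, card_union_of_disjoint hdisj] at hl
    -- The gap is treated with `w i` as its paid candidate, so only the others count towards `l'`.
    have hwA : w i ∈ A := mem_image_of_mem w (by simp [hit])
    have hAc : (A.erase (w i)).card + 1 = A.card := card_erase_add_one hwA
    have h2 : gapCost m r t j (l - 1 - (A.erase (w i)).card) c ≤ ∑ p ∈ Ico t j, r p (w p) :=
      ih (j - t) (by omega) t j _ c (by omega) (fun p hp => hw p (by omega))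
        (hnc.mono (by omega) le_rfl) (fun p t' q hp => hc p t' q (by omega)) (by rw [← hB]; omega)
    have h1 : intervalCost m r i t (A.erase (w i)).card ≤ ∑ p ∈ Ico i t, r p (w p) := by
      have h3 := (le_intervalCost_iff (r := r) (i := i) (j := t)
        (l := (A.erase (w i)).card) hm).1 le_rfl (w i) (hw i le_rfl hij)
      have h4 := ((le_gapCost_iff (m := m) (r := r) (l := (A.erase (w i)).card)
        (c := w i) hit).1 le_rfl).1
      rw [sum_eq_sum_Ico_succ_bot hit]
      refine h3.trans (h4.trans (add_le_add_right (ih (t - i - 1) (by omega) (i + 1) t _ _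
        (by omega) (fun p hp hpt => hw p (by omega) (by omega)) (hnc.mono (by omega) htj) ?_ ?_) _))
      -- Otherwise `i < p < t' < q` would be a crossing of `w i` and `w p`.
      · intro p t' q hp hpt htq hq hwt hpq
        exact (hnc i p t' q le_rfl (by omega) hpt htq (by omega) hwt.symm hpq).symm
      · exact card_le_card (erase_subset_erase _ (image_subset_image
          (Ico_subset_Ico_left (by omega))))
    rw [← sum_Ico_consecutive _ hit.le htj]
    exact (hgap t _ hit htj (by omega)).trans (add_le_add h1 h2)

theorem intervalCost_le_sum {n k : ℕ} {w : ℕ → ℕ} (hn : 0 < n) (hw : ∀ p < n, w p < m)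
    (hnc : NonCrossing w 0 n) (hk : ((range n).image w).card ≤ k) :
    intervalCost m r 0 n (k - 1) ≤ ∑ p ∈ range n, r p (w p) := by
  have hm : 0 < m := (Nat.zero_le _).trans_lt (hw 0 hn)
  refine ((le_intervalCost_iff hm).1 le_rfl (w 0) (hw 0 hn)).trans ?_
  rw [range_eq_Ico] at hk ⊢
  refine gapCost_le_sum hm n 0 n _ _ (by omega) (fun p _ => hw p) hnc ?_ ?_
  · intro p t q _ hpt htq hq hwt hpq
    rcases Nat.eq_zero_or_pos p with rfl | hp
    · rfl
    · have := hnc 0 p t q le_rfl hp hpt htq hq hwt.symm hpq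
      exact this.symm
  · rw [card_erase_of_mem (mem_image_of_mem w (by simp [hn]))]
    omega

end ChamberlinCourant

/-! # Filling the tables -/

namespace ChamberlinCourant

open RAM Function

/-- Array `a` becomes `0, e, 2 * e, …, N * e`. -/
def multiples (a : ℕ) (e N : NExpr) : Program :=
  .seq (.nput a (.const 0) (.const 0))
    (.for 15 N (.nput a (.add (.var 15) (.const 1)) (.add (.get a (.var 15)) e)))

/-- The machine cannot multiply; with such arrays, addresses in tables of several dimensions are
sums of array entries. -/
theorem within_multiples {a : ℕ} {e N : NExpr} {s : Store} (b N' B : ℕ)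
    (he : ∀ s', Agree (multiples a e N) s s' → e.eval s' = b)
    (hN : ∀ s', Agree (multiples a e N) s s' → N.eval s' = N') (hB : N' ≤ B) (hB' : 1 ≤ B) :
    Within (multiples a e N) s (3 + (7 + e.cost + 2 * N.cost + 14) * (B * 1)) fun s' =>
      ∀ i ≤ N', s'.narr a i = i * b := by
  have h0 := (Runs.nput a (.const 0) (.const 0) s).agree
  refine Within.seq (Within.nput ?_)
  refine (Within.for N' B 1 (fun x s' => ∀ i ≤ x, s'.narr a i = i * b) hB hB' le_rfl
    (fun s' h => hN s' ?_) rfl ?_ ?_).mono le_rfl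
  · exact (h0.mono (Program.sub_seq_left _ _)).trans (h.mono (Program.sub_seq_right _ _))
  · intro i hi
    obtain rfl : i = 0 := by omega
    simp [NExpr.eval]
  · intro x hx s' h hxs hI
    have hes := he s' ((h0.mono (Program.sub_seq_left _ _)).trans
      (h.mono (Program.sub_seq_right _ _)))
    refine (Within.nput ?_).mono (T₁ := 1 + 3 + (1 + 2 + e.cost)) (by omega)
    intro i hi
    simp only [NExpr.eval, hxs, update_self, hes, hI x le_rfl]
    rcases Nat.lt_or_ge x i with h1 | h1
    · obtain rfl : i = x + 1 := by omega
      rw [update_self, Nat.succ_mul]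
    · rw [update_of_ne (by omega), hI i h1]

/-- The address of entry `(i, j, l, c)` of a table. -/
def addr (n m k i j l c : ℕ) : ℕ :=
  i * ((n + 1) * (k * m)) + j * (k * m) + l * m + c

theorem mul_add_inj {b q q' x x' : ℕ} (hx : x < b) (hx' : x' < b) (h : q * b + x = q' * b + x') :
    q = q' ∧ x = x' := by
  have h1 : q = q' := by
    have := congrArg (· / b) h
    simpa [Nat.mul_comm _ b, Nat.mul_add_div (Nat.zero_lt_of_lt hx), Nat.div_eq_of_lt hx,
      Nat.div_eq_of_lt hx'] using this
  subst h1
  exact ⟨rfl, by omega⟩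

/-- `addr` is the mixed radix number with digits `i, j, l, c`. The leading digit `i` needs no bound.
-/
theorem addr_inj {n m k i j l c i' j' l' c' : ℕ} (hj : j ≤ n) (hj' : j' ≤ n) (hl : l < k)
    (hl' : l' < k) (hc : c < m) (hc' : c' < m)
    (h : addr n m k i j l c = addr n m k i' j' l' c') : i = i' ∧ j = j' ∧ l = l' ∧ c = c' := by
  have e : ∀ i j l c, addr n m k i j l c = ((i * (n + 1) + j) * k + l) * m + c := by
    intro i j l c
    simp only [addr]
    ring
  rw [e, e] at h
  obtain ⟨h1, rfl⟩ := mul_add_inj hc hc' h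
  obtain ⟨h2, rfl⟩ := mul_add_inj hl hl' h1
  obtain ⟨rfl, rfl⟩ := mul_add_inj (by omega) (by omega) h2
  exact ⟨rfl, rfl, rfl, rfl⟩

/-- The address of a table entry, computed from the arrays of multiples. -/
def cellExpr (i j l c : NExpr) : NExpr := .add (.add (.add (.get 5 i) (.get 4 j)) (.get 3 l)) c

/-- The input and the arrays of multiples are in memory; `r` is the misrepresentation with the
voters replaced by their positions. -/
structure Ready (n m k : ℕ) (r : ℕ → ℕ → ℚ) (s : Store) : Prop where
  n_eq : s.nvar 0 = n
  m_eq : s.nvar 1 = m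
  k_eq : s.nvar 2 = k
  -- Indices below `n` locate the rows of the input, indices below `k` serve the table addresses,
  -- and index `k` provides `k * m`. In the same way index `n + 1` of the next array provides the
  -- stride of the third.
  mul_m : ∀ i ≤ n + k, s.narr 3 i = i * m
  mul_km : ∀ i ≤ n + 1, s.narr 4 i = i * (k * m)
  mul_nkm : ∀ i ≤ n, s.narr 5 i = i * ((n + 1) * (k * m))
  cost_eq : ∀ i < n, ∀ c < m, s.qarr 0 (s.narr 3 (s.narr 1 i) + c) = r i c

/-- `p` leaves the data of `Ready` alone. -/
abbrev KeepsReady (p : Program) : Prop :=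
  p.setsN 0 = false ∧ p.setsN 1 = false ∧ p.setsN 2 = false ∧ p.putsN 1 = false ∧
    p.putsN 3 = false ∧ p.putsN 4 = false ∧ p.putsN 5 = false ∧ p.putsQ 0 = false

variable {n m k : ℕ} {r : ℕ → ℕ → ℚ} {s s' : Store}

theorem Ready.agree (h : Ready n m k r s) {p : Program} (ha : Agree p s s') (hp : KeepsReady p) :
    Ready n m k r s' := by
  obtain ⟨p0, p1, p2, q1, q3, q4, q5, t0⟩ := hp
  constructor
  · rw [ha.nvar _ p0, h.n_eq]
  · rw [ha.nvar _ p1, h.m_eq]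
  · rw [ha.nvar _ p2, h.k_eq]
  · rw [ha.narr _ q3]; exact h.mul_m
  · rw [ha.narr _ q4]; exact h.mul_km
  · rw [ha.narr _ q5]; exact h.mul_nkm
  · rw [ha.narr _ q3, ha.narr _ q1, ha.qarr _ t0]; exact h.cost_eq

theorem Ready.cellExpr_eval (h : Ready n m k r s) {i j l c : NExpr} (hi : i.eval s ≤ n)
    (hj : j.eval s ≤ n + 1) (hl : l.eval s ≤ n + k) :
    (cellExpr i j l c).eval s = addr n m k (i.eval s) (j.eval s) (l.eval s) (c.eval s) := by
  simp only [cellExpr, NExpr.eval, h.mul_m _ hl, h.mul_km _ hj, h.mul_nkm _ hi, addr]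

/-- The value `x` for serving `[i, j)` is attained by serving `i` by `c` if `t = 0`, and by a gap
`[i, t)` with `l' + 1` candidates otherwise. -/
def IsAttained (m : ℕ) (r : ℕ → ℕ → ℚ) (i j l c t l' : ℕ) (x : ℚ) : Prop :=
  -- The code `t = 0` is free, because the end of a gap exceeds `i`.
  (t = 0 ∧ x = r i c + gapCost m r (i + 1) j l c) ∨
    (i < t ∧ t ≤ j ∧ l' < l ∧ x = intervalCost m r i t l' + gapCost m r t j (l - 1 - l') c)

theorem IsAttained.gapCost_le {i j l c t l' : ℕ} {x : ℚ} (h : IsAttained m r i j l c t l' x)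
    (hij : i < j) : gapCost m r i j l c ≤ x := by
  have H := (le_gapCost_iff (m := m) (r := r) (l := l) (c := c) hij).1 le_rfl
  rcases h with ⟨-, rfl⟩ | ⟨h1, h2, h3, rfl⟩
  · exact H.1
  · exact H.2 t l' h1 h2 h3

/-- The table entries in `D` and `E` are correct. -/
structure Tables (n m k : ℕ) (r : ℕ → ℕ → ℚ) (D : ℕ → ℕ → ℕ → ℕ → Prop) (E : ℕ → ℕ → ℕ → Prop)
    (s : Store) : Prop where
  gap : ∀ i j l c, i ≤ j → j ≤ n → l < k → c < m → D i j l c →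
    s.qarr 1 (addr n m k i j l c) = gapCost m r i j l c
  choice : ∀ i j l c, i < j → j ≤ n → l < k → c < m → D i j l c →
    IsAttained m r i j l c (s.narr 6 (addr n m k i j l c)) (s.narr 7 (addr n m k i j l c))
      (gapCost m r i j l c)
  interval : ∀ i j l, i ≤ j → j ≤ n → l < k → E i j l →
    s.qarr 2 (addr n m k i j l 0) = intervalCost m r i j l
  candidate : ∀ i j l, i ≤ j → j ≤ n → l < k → E i j l →
    s.narr 8 (addr n m k i j l 0) < m ∧
      intervalCost m r i j l = gapCost m r i j l (s.narr 8 (addr n m k i j l 0))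

theorem Tables.mono {D D' : ℕ → ℕ → ℕ → ℕ → Prop} {E E' : ℕ → ℕ → ℕ → Prop}
    (h : Tables n m k r D E s)
    (hD : ∀ i j l c, i ≤ j → j ≤ n → l < k → c < m → D' i j l c → D i j l c)
    (hE : ∀ i j l, i ≤ j → j ≤ n → l < k → E' i j l → E i j l) : Tables n m k r D' E' s where
  gap i j l c h1 h2 h3 h4 h5 := h.gap i j l c h1 h2 h3 h4 (hD i j l c h1 h2 h3 h4 h5)
  choice i j l c h1 h2 h3 h4 h5 := h.choice i j l c h1 h2 h3 h4 (hD i j l c h1.le h2 h3 h4 h5)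
  interval i j l h1 h2 h3 h4 := h.interval i j l h1 h2 h3 (hE i j l h1 h2 h3 h4)
  candidate i j l h1 h2 h3 h4 := h.candidate i j l h1 h2 h3 (hE i j l h1 h2 h3 h4)

theorem Tables.agree {D : ℕ → ℕ → ℕ → ℕ → Prop} {E : ℕ → ℕ → ℕ → Prop}
    (h : Tables n m k r D E s) {p : Program} (ha : Agree p s s') (h6 : p.putsN 6 = false)
    (h7 : p.putsN 7 = false) (h8 : p.putsN 8 = false) (q1 : p.putsQ 1 = false)
    (q2 : p.putsQ 2 = false) : Tables n m k r D E s' := by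
  constructor
  · rw [ha.qarr _ q1]; exact h.gap
  · rw [ha.narr _ h6, ha.narr _ h7]; exact h.choice
  · rw [ha.qarr _ q2]; exact h.interval
  · rw [ha.narr _ h8]; exact h.candidate

/-- The entries computed before `(i, j, l, c)`. -/
def Before (i j l c i' j' l' c' : ℕ) : Prop :=
  -- `i` decreases, and for fixed `i` the others increase lexicographically. The recursion for `(i,
  -- j, l, c)` refers to larger `i`, or to intervals `[i, t)` with `t < j`, or with `t = j` and
  -- fewer candidates; all of these come earlier.
  i < i' ∨ (i' = i ∧ (j' < j ∨ (j' = j ∧ (l' < l ∨ (l' = l ∧ c' < c)))))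

/-- The entries computed before `(i, j, l)`. -/
def BeforeInterval (i j l i' j' l' : ℕ) : Prop :=
  i < i' ∨ (i' = i ∧ (j' < j ∨ (j' = j ∧ l' < l)))

/-- Compare the best value so far with that of the gap `[i, t)` with `l' + 1` candidates. -/
def relaxGap : Program :=
  .seq (.qset 2 (.add (.get 2 (cellExpr (.var 4) (.var 9) (.var 10) (.const 0)))
    (.get 1 (cellExpr (.var 9) (.var 5) (.sub (.sub (.var 6) (.const 1)) (.var 10)) (.var 7)))))
  (.ite (.qle (.var 1) (.var 2)) .skip
    (.seq (.qset 1 (.var 2)) (.seq (.nset 11 (.var 9)) (.nset 12 (.var 10)))))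

/-- Compare the best value so far with those of all gaps. -/
def relaxGaps : Program :=
  .for 8 (.sub (.var 5) (.var 4))
    (.seq (.nset 9 (.add (.add (.var 4) (.var 8)) (.const 1))) (.for 10 (.var 6) relaxGap))

/-- The variables of the loops hold `i, j, l, c`. -/
structure At (i j l c : ℕ) (s : Store) : Prop where
  i_eq : s.nvar 4 = i
  j_eq : s.nvar 5 = j
  l_eq : s.nvar 6 = l
  c_eq : s.nvar 7 = c

theorem At.agree {i j l c : ℕ} (h : At i j l c s) {p : Program} (ha : Agree p s s')
    (hp : p.setsN 4 = false ∧ p.setsN 5 = false ∧ p.setsN 6 = false ∧ p.setsN 7 = false) :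
    At i j l c s' :=
  ⟨(ha.nvar _ hp.1).trans h.i_eq, (ha.nvar _ hp.2.1).trans h.j_eq,
    (ha.nvar _ hp.2.2.1).trans h.l_eq, (ha.nvar _ hp.2.2.2).trans h.c_eq⟩

/-- Rational variable 1 holds the least value among the first option and the gaps in `S`. -/
structure IsBest (m : ℕ) (r : ℕ → ℕ → ℚ) (i j l c : ℕ) (S : ℕ → ℕ → Prop) (s : Store) : Prop where
  first : s.qvar 1 ≤ r i c + gapCost m r (i + 1) j l c
  gaps : ∀ t l', i < t → t ≤ j → l' < l → S t l' →
    s.qvar 1 ≤ intervalCost m r i t l' + gapCost m r t j (l - 1 - l') c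
  attained : IsAttained m r i j l c (s.nvar 11) (s.nvar 12) (s.qvar 1)

/-- Natural variables 9 and 10 hold the gap under consideration, 11 and 12 the best choice so far;
rational variable 1 holds the best value and 2 the competing one. -/
theorem within_relaxGap {i j l c t l' : ℕ} (hs : Ready n m k r s)
    (hT : Tables n m k r (Before i j l c) (BeforeInterval i j l) s) (ha : At i j l c s)
    (ht : s.nvar 9 = t) (hl' : s.nvar 10 = l') (hit : i < t) (htj : t ≤ j) (hj : j ≤ n)
    (hll : l' < l) (hl : l < k) (hc : c < m) {S : ℕ → ℕ → Prop} (hb : IsBest m r i j l c S s) :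
    Within relaxGap s (60 * 1)
      (IsBest m r i j l c fun t₁ l₁ => S t₁ l₁ ∨ (t₁ = t ∧ l₁ = l')) := by
  refine Within.mono (Within.seq (Within.qset (Within.ite (fun h => Within.skip ?_)
    (fun h => Within.seq (Within.qset (Within.seq (Within.nset (Within.nset ?_)))))))) ?_
  rotate_left 2
  · decide
  all_goals
    have e1 : QExpr.eval s (.get 2 (cellExpr (.var 4) (.var 9) (.var 10) (.const 0))) =
        intervalCost m r i t l' := by
      rw [QExpr.eval, hs.cellExpr_eval (by simp only [NExpr.eval, ha.i_eq]; omega)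
        (by simp only [NExpr.eval, ht]; omega) (by simp only [NExpr.eval, hl']; omega)]
      simp only [NExpr.eval, ha.i_eq, ht, hl']
      exact hT.interval _ _ _ hit.le (by omega) (by omega) (by unfold BeforeInterval; omega)
    have e2 : QExpr.eval s (.get 1 (cellExpr (.var 9) (.var 5)
        (.sub (.sub (.var 6) (.const 1)) (.var 10)) (.var 7))) =
        gapCost m r t j (l - 1 - l') c := by
      rw [QExpr.eval, hs.cellExpr_eval (by simp only [NExpr.eval, ht]; omega)
        (by simp only [NExpr.eval, ha.j_eq]; omega)
        (by simp only [NExpr.eval, ha.l_eq, hl']; omega)]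
      simp only [NExpr.eval, ha.l_eq, ha.c_eq, ha.j_eq, ht, hl']
      exact hT.gap _ _ _ _ htj hj (by omega) hc (by unfold Before; omega)
    simp only [Test.Holds, QExpr.eval, ne_eq, not_false_eq_true, update_of_ne, update_self,
      OfNat.one_ne_ofNat] at h e1 e2 ⊢
    simp only [e1, e2, NExpr.eval] at h ⊢
  · refine ⟨by simpa using hb.first, ?_, by simpa using hb.attained⟩
    rintro t₁ l₁ h1 h2 h3 (h4 | ⟨rfl, rfl⟩)
    · simpa using hb.gaps t₁ l₁ h1 h2 h3 h4
    · simpa using h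
  · rw [not_le] at h
    refine ⟨?_, ?_, ?_⟩
    · simpa using h.le.trans hb.first
    · rintro t₁ l₁ h1 h2 h3 (h4 | ⟨rfl, rfl⟩)
      · simpa using h.le.trans (hb.gaps t₁ l₁ h1 h2 h3 h4)
      · simp
    · right
      simp [ht, hl', hit, htj, hll]

/-- Once all gaps have been seen, the best value is at most `gapCost` by `le_gapCost_iff`, and at
least `gapCost` because it is attained by one of the options. -/
theorem within_relaxGaps {i j l c : ℕ} (hs : Ready n m k r s)
    (hT : Tables n m k r (Before i j l c) (BeforeInterval i j l) s) (ha : At i j l c s)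
    (hij : i < j) (hj : j ≤ n) (hl : l < k) (hc : c < m)
    (h11 : s.nvar 11 = 0) (hq : s.qvar 1 = r i c + gapCost m r (i + 1) j l c) :
    Within relaxGaps s (102 * (n * (k * 1))) fun s' =>
      s'.qvar 1 = gapCost m r i j l c ∧
        IsAttained m r i j l c (s'.nvar 11) (s'.nvar 12) (gapCost m r i j l c) := by
  refine (Within.for (C := 82) (j - i) n (k * 1)
    (fun x s' => IsBest m r i j l c (fun t _ => t ≤ i + x) s')
    (by omega) (by omega) (by omega) (fun s' h => ?_) rfl ?_ ?_).conseq le_rfl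
      (fun s' _ hb => ?_)
  · have := ha.agree h (by decide)
    simp only [NExpr.eval, this.i_eq, this.j_eq]
  · refine ⟨?_, fun t l' h1 _ _ h2 => ?_, Or.inl ?_⟩
    · simp [hq]
    · omega
    · simpa [h11] using hq
  · intro x hx s₁ h₁ hx₁ hb₁
    refine Within.mono (Within.seq (T₂ := 76 * (k * 1)) (Within.nset ?_)) ?_
    rotate_left
    · simp only [NExpr.cost]
      omega
    have ha₁ := ha.agree h₁ (by decide)
    refine (Within.for (C := 60) l k 1
      (fun y s' => IsBest m r i j l c (fun t l' => t ≤ i + x ∨ (t = i + x + 1 ∧ l' < y)) s')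
      (by omega) (by omega) (by omega) (fun s' h => ?_) rfl ?_ ?_).conseq le_rfl
        (fun s' _ hb => ?_)
    · rw [NExpr.eval, h.nvar 6 (by decide)]
      simpa using ha₁.l_eq
    · refine ⟨by simpa using hb₁.first, fun t l' h1 h2 h3 h4 => ?_, by simpa using hb₁.attained⟩
      simpa using hb₁.gaps t l' h1 h2 h3 (by omega)
    · intro y hy s₂ h₂ hy₂ hb₂
      have h₃ := (h₁.trans ((Runs.nset 9 (.add (.add (.var 4) (.var 8)) (.const 1)) s₁).agree.mono
        ((Program.sub_seq_left _ (.for 10 (.var 6) relaxGap)).trans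
          ((Program.sub_seq_left _ (.nset 8 (.add (.var 8) (.const 1)))).trans
            ((Program.sub_loop _ _).trans (Program.sub_seq_right _ _)))))).trans
        (h₂.mono ((Program.sub_seq_right _ _).trans
          ((Program.sub_seq_left _ _).trans
            ((Program.sub_loop _ _).trans (Program.sub_seq_right _ _)))))
      have h9 : s₂.nvar 9 = i + x + 1 := by
        rw [h₂.nvar 9 (by decide)]
        simp [NExpr.eval, ha₁.i_eq, hx₁]
      refine (within_relaxGap (hs.agree h₃ (by decide))
        (hT.agree h₃ (by decide) (by decide) (by decide) (by decide) (by decide))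
        (ha.agree h₃ (by decide)) h9 hy₂ (by omega) (by omega) hj hy hl hc hb₂).conseq le_rfl
        (fun s' _ hb => ?_)
      refine ⟨hb.first, fun t l' h1 h2 h3 h4 => hb.gaps t l' h1 h2 h3 (by omega), ?_⟩
      simpa using hb.attained
    · refine ⟨hb.first, fun t l' h1 h2 h3 h4 => hb.gaps t l' h1 h2 h3 (by omega), ?_⟩
      simpa using hb.attained
  · have : s'.qvar 1 = gapCost m r i j l c :=
      le_antisymm ((le_gapCost_iff hij).2
        ⟨hb.first, fun t l' h1 h2 h3 => hb.gaps t l' h1 h2 h3 (by omega)⟩)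
        (hb.attained.gapCost_le hij)
    exact ⟨this, this ▸ hb.attained⟩

end ChamberlinCourant

/-! ### Storing the entries and looping over the tables -/

namespace ChamberlinCourant

open RAM Function

variable {n m k : ℕ} {r : ℕ → ℕ → ℚ} {s s' : Store}

/-- Among the candidates below `c`, the table entry for `[i, j)` with `l + 1` candidates is least,
and attained by the recorded candidate. -/
structure IsLeastBelow (n m k : ℕ) (r : ℕ → ℕ → ℚ) (i j l c : ℕ) (s : Store) : Prop where
  le : ∀ c' < c, s.qarr 2 (addr n m k i j l 0) ≤ gapCost m r i j l c'
  lt : s.narr 8 (addr n m k i j l 0) < c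
  eq : s.qarr 2 (addr n m k i j l 0) = gapCost m r i j l (s.narr 8 (addr n m k i j l 0))

/-- Record candidate `c` as the best one. -/
def storeCandidate : Program := .seq (.qput 2 (.var 16) (.var 1)) (.nput 8 (.var 16) (.var 7))

/-- Store the computed values at the addresses in the variables 14 and 16. -/
def writeCell : Program :=
  .seq (.qput 1 (.var 14) (.var 1)) <|
  .seq (.nput 6 (.var 14) (.var 11)) <|
  .seq (.nput 7 (.var 14) (.var 12)) <|
  .ite (.nle (.var 7) (.const 0)) storeCandidate <|
  .ite (.qle (.get 2 (.var 16)) (.var 1)) .skip storeCandidate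

/-- Store the computed values for `(i, j, l, c)`. -/
def storeCell : Program :=
  .seq (.nset 14 (cellExpr (.var 4) (.var 5) (.var 6) (.var 7))) <|
  .seq (.nset 16 (cellExpr (.var 4) (.var 5) (.var 6) (.const 0))) writeCell

/-- By `addr_inj` the writes miss all earlier entries. The interval entry at `(i, j, l, 0)` is not
yet among those claimed correct, so it may change freely while the candidates are being processed.
-/
theorem Tables.insert {i j l c : ℕ}
    (hT : Tables n m k r (Before i j l c) (BeforeInterval i j l) s)
    (hj : j ≤ n) (hl : l < k) (hc : c < m)
    (hgap : s'.qarr 1 = update (s.qarr 1) (addr n m k i j l c) (gapCost m r i j l c)) {t l' : ℕ}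
    (h6 : s'.narr 6 = update (s.narr 6) (addr n m k i j l c) t)
    (h7 : s'.narr 7 = update (s.narr 7) (addr n m k i j l c) l')
    (hchoice : i < j → IsAttained m r i j l c t l' (gapCost m r i j l c))
    (hq : ∀ x, x ≠ addr n m k i j l 0 → s'.qarr 2 x = s.qarr 2 x)
    (h8 : ∀ x, x ≠ addr n m k i j l 0 → s'.narr 8 x = s.narr 8 x) :
    Tables n m k r (Before i j l (c + 1)) (BeforeInterval i j l) s' := by
  have key : ∀ i' j' l' c', j' ≤ n → l' < k → c' < m → Before i j l (c + 1) i' j' l' c' →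
      (i' = i ∧ j' = j ∧ l' = l ∧ c' = c) ∨
        (Before i j l c i' j' l' c' ∧ addr n m k i' j' l' c' ≠ addr n m k i j l c) := by
    intro i' j' l' c' h1 h2 h3 h4
    by_cases h : i' = i ∧ j' = j ∧ l' = l ∧ c' = c
    · exact Or.inl h
    · refine Or.inr ⟨by unfold Before at *; omega, fun ha => h (addr_inj h1 hj h2 hl h3 hc ha)⟩
  have key' : ∀ i' j' l', j' ≤ n → l' < k → BeforeInterval i j l i' j' l' →
      addr n m k i' j' l' 0 ≠ addr n m k i j l 0 := by
    intro i' j' l' h1 h2 h3 ha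
    obtain ⟨rfl, rfl, rfl, -⟩ := addr_inj h1 hj h2 hl (by omega) (by omega) ha
    unfold BeforeInterval at h3
    omega
  constructor
  · intro i' j' l' c' h0 h1 h2 h3 h4
    rw [hgap]
    rcases key i' j' l' c' h1 h2 h3 h4 with ⟨rfl, rfl, rfl, rfl⟩ | ⟨h5, h6⟩
    · rw [update_self]
    · rw [update_of_ne h6, hT.gap i' j' l' c' h0 h1 h2 h3 h5]
  · intro i' j' l' c' h0 h1 h2 h3 h4
    rw [h6, h7]
    rcases key i' j' l' c' h1 h2 h3 h4 with ⟨rfl, rfl, rfl, rfl⟩ | ⟨h5, h6⟩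
    · rw [update_self, update_self]
      exact hchoice h0
    · rw [update_of_ne h6, update_of_ne h6]
      exact hT.choice i' j' l' c' h0 h1 h2 h3 h5
  · intro i' j' l' h0 h1 h2 h3
    rw [hq _ (key' i' j' l' h1 h2 h3)]
    exact hT.interval i' j' l' h0 h1 h2 h3
  · intro i' j' l' h0 h1 h2 h3
    rw [h8 _ (key' i' j' l' h1 h2 h3)]
    exact hT.candidate i' j' l' h0 h1 h2 h3

/-- The minimum over the candidates is updated along the way. At `c = 0` the old entry means nothing
and is overwritten without a comparison, so `hleast` is assumed only for `0 < c`. -/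
theorem within_writeCell {i j l c : ℕ}
    (hT : Tables n m k r (Before i j l c) (BeforeInterval i j l) s) (h7 : s.nvar 7 = c)
    (h14 : s.nvar 14 = addr n m k i j l c) (h16 : s.nvar 16 = addr n m k i j l 0)
    (hj : j ≤ n) (hl : l < k) (hc : c < m)
    (hq : s.qvar 1 = gapCost m r i j l c)
    (hchoice : i < j → IsAttained m r i j l c (s.nvar 11) (s.nvar 12) (gapCost m r i j l c))
    (hleast : 0 < c → IsLeastBelow n m k r i j l c s) :
    Within writeCell s 40 fun s' =>
      Tables n m k r (Before i j l (c + 1)) (BeforeInterval i j l) s' ∧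
        IsLeastBelow n m k r i j l (c + 1) s' := by
  refine Within.mono (T₁ := 3 + (3 + (3 + (3 + ((3 + 3) + (4 + (1 + (3 + 3)))))))) ?_ (by omega)
  refine Within.seq (Within.qput (Within.seq (Within.nput (Within.seq (Within.nput ?_)))))
  simp only [NExpr.eval, QExpr.eval, h14]
  refine Within.ite (fun h => Within.seq (Within.qput (Within.nput ?_))) fun h =>
    Within.ite (fun h' => Within.skip ?_) fun h' => Within.seq (Within.qput (Within.nput ?_))
  all_goals
    simp [Test.Holds, NExpr.eval, h7, h16] at h ⊢
    try simp [Test.Holds, QExpr.eval, NExpr.eval, h16, hq] at h'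
  · refine ⟨hT.insert hj hl hc (by simp [hq]) (by simp) (by simp) hchoice
      (by simp +contextual) (by simp +contextual), ?_⟩
    subst h
    refine ⟨?_, ?_, ?_⟩ <;> simp [hq, QExpr.eval]
  · refine ⟨hT.insert hj hl hc (by simp [hq]) (by simp) (by simp) hchoice
      (by simp) (by simp), ?_⟩
    have hlt := hleast (by omega)
    refine ⟨?_, ?_, ?_⟩
    · intro c' hc'
      rcases Nat.lt_or_ge c' c with h1 | h1
      · simpa using hlt.le c' h1
      · obtain rfl : c' = c := by omega
        simpa using h'
    · simpa using hlt.lt.trans (Nat.lt_succ_self _)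
    · simpa using hlt.eq
  · refine ⟨hT.insert hj hl hc (by simp [hq]) (by simp) (by simp) hchoice
      (by simp +contextual) (by simp +contextual), ?_⟩
    have hlt := hleast (by omega)
    refine ⟨?_, ?_, ?_⟩
    · intro c' hc'
      rcases Nat.lt_or_ge c' c with h1 | h1
      · simpa [QExpr.eval, hq] using h'.le.trans (hlt.le c' h1)
      · obtain rfl : c' = c := by omega
        simp [hq, QExpr.eval]
    · simp
    · simp [hq, QExpr.eval]

theorem within_storeCell {i j l c : ℕ} (hs : Ready n m k r s)
    (hT : Tables n m k r (Before i j l c) (BeforeInterval i j l) s) (ha : At i j l c s)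
    (hj : j ≤ n) (hij : i ≤ j) (hl : l < k) (hc : c < m)
    (hq : s.qvar 1 = gapCost m r i j l c)
    (hchoice : i < j → IsAttained m r i j l c (s.nvar 11) (s.nvar 12) (gapCost m r i j l c))
    (hleast : 0 < c → IsLeastBelow n m k r i j l c s) :
    Within storeCell s 70 fun s' =>
      Tables n m k r (Before i j l (c + 1)) (BeforeInterval i j l) s' ∧
        IsLeastBelow n m k r i j l (c + 1) s' := by
  have hs' : Ready n m k r { s with nvar := update s.nvar 14 (addr n m k i j l c) } :=
    ⟨hs.n_eq, hs.m_eq, hs.k_eq, hs.mul_m, hs.mul_km, hs.mul_nkm, hs.cost_eq⟩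
  have e1 : (cellExpr (.var 4) (.var 5) (.var 6) (.var 7)).eval s = addr n m k i j l c := by
    rw [hs.cellExpr_eval (by simp only [NExpr.eval, ha.i_eq]; omega)
      (by simp only [NExpr.eval, ha.j_eq]; omega) (by simp only [NExpr.eval, ha.l_eq]; omega)]
    simp only [NExpr.eval, ha.i_eq, ha.j_eq, ha.l_eq, ha.c_eq]
  have e2 : (cellExpr (.var 4) (.var 5) (.var 6) (.const 0)).eval
      { s with nvar := update s.nvar 14 (addr n m k i j l c) } = addr n m k i j l 0 := by
    rw [hs'.cellExpr_eval (by simp [NExpr.eval, ha.i_eq]; omega)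
      (by simp [NExpr.eval, ha.j_eq]; omega) (by simp [NExpr.eval, ha.l_eq]; omega)]
    simp [NExpr.eval, ha.i_eq, ha.j_eq, ha.l_eq]
  refine Within.mono (Within.seq (T₂ := _ + 40) (Within.nset (Within.seq (Within.nset ?_)))) ?_
  rotate_left
  · simp only [NExpr.cost, cellExpr]
    omega
  rw [e1, e2]
  exact within_writeCell ⟨hT.gap, hT.choice, hT.interval, hT.candidate⟩ (by simp [ha.c_eq])
    (by simp) (by simp) hj hl hc hq (by simpa using hchoice)
    fun h => ⟨(hleast h).le, (hleast h).lt, (hleast h).eq⟩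

/-- Compute and store the entry `(i, j, l, c)`. -/
def fillCell : Program :=
  .seq (.nset 11 (.const 0)) <|
  .seq (.ite (.nle (.add (.var 4) (.const 1)) (.var 5))
    (.seq (.qset 1 (.add (.get 0 (.add (.get 3 (.get 1 (.var 4))) (.var 7)))
      (.get 1 (cellExpr (.add (.var 4) (.const 1)) (.var 5) (.var 6) (.var 7))))) relaxGaps)
    (.qset 1 .zero)) <|
  storeCell

theorem within_fillCell {i j l c : ℕ} (hs : Ready n m k r s)
    (hT : Tables n m k r (Before i j l c) (BeforeInterval i j l) s) (ha : At i j l c s)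
    (hij : i ≤ j) (hj : j ≤ n) (hl : l < k) (hc : c < m) (hn : 1 ≤ n)
    (hleast : 0 < c → IsLeastBelow n m k r i j l c s) :
    Within fillCell s (213 * (n * (k * 1))) fun s' =>
      Tables n m k r (Before i j l (c + 1)) (BeforeInterval i j l) s' ∧
        IsLeastBelow n m k r i j l (c + 1) s' := by
  have hnk : 1 ≤ n * (k * 1) := Nat.mul_pos hn (by omega)
  refine Within.mono (T₁ := 2 + (5 + ((30 + 102 * (n * (k * 1))) + 2) + 70)) ?_ (by omega)
  have h0 : Agree fillCell s { s with nvar := update s.nvar 11 0 } :=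
    (Runs.nset 11 (.const 0) s).agree.mono (Program.sub_seq_left _ _)
  refine Within.seq (Within.nset (Within.seq ?_))
  refine Within.conseq (Q := fun s' => s'.qvar 1 = gapCost m r i j l c ∧
    (i < j → IsAttained m r i j l c (s'.nvar 11) (s'.nvar 12) (gapCost m r i j l c)))
    (Within.ite (fun h => ?_) (fun h => ?_)) le_rfl ?_
  · simp [Test.Holds, NExpr.eval, ha.i_eq, ha.j_eq] at h
    have hs' : Ready n m k r { s with nvar := update s.nvar 11 0 } :=
      ⟨hs.n_eq, hs.m_eq, hs.k_eq, hs.mul_m, hs.mul_km, hs.mul_nkm, hs.cost_eq⟩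
    refine Within.mono (Within.seq (T₂ := 102 * (n * (k * 1))) (Within.qset ?_)) ?_
    rotate_left
    · simp only [QExpr.cost, NExpr.cost, cellExpr]
      omega
    refine (within_relaxGaps ?_ ?_ ?_ h hj hl hc ?_ ?_).conseq le_rfl
      (fun s' _ H => ⟨H.1, fun _ => H.2⟩)
    · exact ⟨hs.n_eq, hs.m_eq, hs.k_eq, hs.mul_m, hs.mul_km, hs.mul_nkm, hs.cost_eq⟩
    · exact ⟨hT.gap, hT.choice, hT.interval, hT.candidate⟩
    · exact ⟨ha.i_eq, ha.j_eq, ha.l_eq, ha.c_eq⟩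
    · rfl
    · simp only [QExpr.eval, update_self]
      rw [show NExpr.eval s (.const 0) = 0 from rfl, hs'.cellExpr_eval (by simp [NExpr.eval, ha.i_eq]; omega)
        (by simp [NExpr.eval, ha.j_eq]; omega) (by simp [NExpr.eval, ha.l_eq]; omega)]
      simp [NExpr.eval, ha.i_eq, ha.j_eq, ha.l_eq, ha.c_eq]
      rw [hs.cost_eq i (by omega) c hc, hT.gap (i + 1) j l c (by omega) hj hl hc (Or.inl (by omega))]
  · simp [Test.Holds, NExpr.eval, ha.i_eq, ha.j_eq] at h
    refine Within.qset ⟨?_, fun h' => by omega⟩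
    obtain rfl : i = j := by omega
    simp [QExpr.eval, gapCost_self]
  · rintro s' hag ⟨hq, hch⟩
    have hag' : Agree fillCell s s' :=
      h0.trans (hag.mono ((Program.sub_seq_left _ _).trans (Program.sub_seq_right _ _)))
    have q1 : s'.qarr = s.qarr := by
      funext x; rw [hag.qarr x rfl]
    have n1 : s'.narr = s.narr := by
      funext x; rw [hag.narr x rfl]
    refine within_storeCell (hs.agree hag' (by decide)) ?_ (ha.agree hag' (by decide)) hj hij hl hc
      hq hch fun h => ?_
    · constructor
      · rw [q1]; exact hT.gap
      · rw [n1]; exact hT.choice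
      · rw [q1]; exact hT.interval
      · rw [n1]; exact hT.candidate
    · have := hleast h
      constructor
      · rw [q1]; exact this.le
      · rw [n1]; exact this.lt
      · rw [q1, n1]; exact this.eq

/-- Compute and store the entries for all `j`, `l`, `c`. -/
def fillRow : Program :=
  .for 13 (.sub (.add (.var 0) (.const 1)) (.var 4)) <|
    .seq (.nset 5 (.add (.var 4) (.var 13))) <| .for 6 (.var 2) <| .for 7 (.var 1) fillCell

/-- Compute and store all entries. -/
def fillTables : Program :=
  .for 3 (.add (.var 0) (.const 1)) <| .seq (.nset 4 (.sub (.var 0) (.var 3))) fillRow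

theorem within_fillCandidates {i j l : ℕ} (hs : Ready n m k r s)
    (hT : Tables n m k r (Before i j l 0) (BeforeInterval i j l) s) (h4 : s.nvar 4 = i)
    (h5 : s.nvar 5 = j) (h6 : s.nvar 6 = l)
    (hij : i ≤ j) (hj : j ≤ n) (hl : l < k) (hm : 1 ≤ m) (hn : 1 ≤ n) :
    Within (.for 7 (.var 1) fillCell) s (229 * (m * (n * (k * 1)))) fun s' =>
      Tables n m k r (Before i j (l + 1) 0) (BeforeInterval i j (l + 1)) s' := by
  refine (Within.for (C := 213) m m (n * (k * 1)) (fun c s' =>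
    Tables n m k r (Before i j l c) (BeforeInterval i j l) s' ∧
      (0 < c → IsLeastBelow n m k r i j l c s')) le_rfl hm (Nat.mul_pos hn (by omega))
      (fun s' h => ?_) rfl ?_ ?_).conseq le_rfl (fun s' _ hb => ?_)
  · rw [NExpr.eval, h.nvar 1 rfl, hs.m_eq]
  · exact ⟨⟨hT.gap, hT.choice, hT.interval, hT.candidate⟩, fun h => absurd h (lt_irrefl _)⟩
  · rintro c hc s₁ h₁ hc₁ ⟨hT₁, hL₁⟩
    refine (within_fillCell (hs.agree h₁ (by decide)) hT₁ ?_ hij hj hl hc hn hL₁).conseq le_rfl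
      (fun s' _ H => ?_)
    · exact ⟨(h₁.nvar 4 rfl).trans h4, (h₁.nvar 5 rfl).trans h5, (h₁.nvar 6 rfl).trans h6, hc₁⟩
    · obtain ⟨hT, hL⟩ := H
      exact ⟨⟨hT.gap, hT.choice, hT.interval, hT.candidate⟩, fun _ => ⟨hL.le, hL.lt, hL.eq⟩⟩
  · obtain ⟨hT, hL⟩ := hb
    have hL := hL (by omega)
    have hF : s'.qarr 2 (addr n m k i j l 0) = intervalCost m r i j l := by
      refine le_antisymm ((le_intervalCost_iff (by omega)).2 hL.le) ?_
      rw [hL.eq]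
      exact (le_intervalCost_iff (by omega)).1 le_rfl _ hL.lt
    have key : ∀ i' j' l', BeforeInterval i j (l + 1) i' j' l' →
        BeforeInterval i j l i' j' l' ∨ (i' = i ∧ j' = j ∧ l' = l) := by
      unfold BeforeInterval; omega
    constructor
    · intro i' j' l' c' h1 h2 h3 h4 h5
      exact hT.gap i' j' l' c' h1 h2 h3 h4 (by unfold Before at *; omega)
    · intro i' j' l' c' h1 h2 h3 h4 h5
      exact hT.choice i' j' l' c' h1 h2 h3 h4 (by unfold Before at *; omega)
    · intro i' j' l' h1 h2 h3 h4
      rcases key i' j' l' h4 with h5 | ⟨rfl, rfl, rfl⟩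
      · exact hT.interval i' j' l' h1 h2 h3 h5
      · exact hF
    · intro i' j' l' h1 h2 h3 h4
      rcases key i' j' l' h4 with h5 | ⟨rfl, rfl, rfl⟩
      · exact hT.candidate i' j' l' h1 h2 h3 h5
      · exact ⟨hL.lt, hF.symm.trans hL.eq⟩

/-- The ends run from `j = i`, since entries for empty intervals are looked up when a gap reaches
the end. Their number `n + 1 - i` is bounded by `2 * n` to keep the time bound a monomial. -/
theorem within_fillRow {i : ℕ} (hs : Ready n m k r s)
    (hT : Tables n m k r (Before i i 0 0) (BeforeInterval i i 0) s) (h4 : s.nvar 4 = i)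
    (hi : i ≤ n) (hm : 1 ≤ m) (hn : 1 ≤ n) (hk : 1 ≤ k) :
    Within fillRow s (273 * (2 * n * (k * (m * (n * (k * 1)))))) fun s' =>
      Tables n m k r (fun i' _ _ _ => i ≤ i') (fun i' _ _ => i ≤ i') s' := by
  have hX : 1 ≤ m * (n * (k * 1)) := Nat.mul_pos hm (Nat.mul_pos hn (by omega))
  have hX' : 1 ≤ k * (m * (n * (k * 1))) := Nat.mul_pos hk hX
  refine (Within.for (C := 249) (n + 1 - i) (2 * n) (k * (m * (n * (k * 1)))) (fun x s' =>
    Tables n m k r (Before i (i + x) 0 0) (BeforeInterval i (i + x) 0) s')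
    (by omega) (by omega) hX' (fun s' h => ?_) rfl ?_ ?_).conseq le_rfl (fun s' _ hb => ?_)
  · simp only [NExpr.eval]
    rw [h.nvar 0 rfl, h.nvar 4 rfl, hs.n_eq, h4]
  · exact ⟨hT.gap, hT.choice, hT.interval, hT.candidate⟩
  · intro x hx s₁ h₁ hx₁ hT₁
    refine Within.mono (Within.seq (T₂ := 245 * (k * (m * (n * (k * 1))))) (Within.nset ?_)) ?_
    rotate_left
    · simp only [NExpr.cost]
      omega
    have h4₁ : s₁.nvar 4 = i := (h₁.nvar 4 rfl).trans h4
    have hs₁ := hs.agree h₁ (by decide)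
    have hs₂ : Ready n m k r { s₁ with nvar := update s₁.nvar 5 (i + x) } :=
      ⟨hs₁.n_eq, hs₁.m_eq, hs₁.k_eq, hs₁.mul_m, hs₁.mul_km, hs₁.mul_nkm, hs₁.cost_eq⟩
    simp only [NExpr.eval, h4₁, hx₁]
    refine (Within.for (C := 229) k k (m * (n * (k * 1))) (fun l s' =>
      Tables n m k r (Before i (i + x) l 0) (BeforeInterval i (i + x) l) s')
      le_rfl hk hX (fun s' h => ?_) rfl ?_ ?_).conseq le_rfl (fun s' _ hb => ?_)
    · rw [NExpr.eval, h.nvar 2 rfl, hs₂.k_eq]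
    · exact ⟨hT₁.gap, hT₁.choice, hT₁.interval, hT₁.candidate⟩
    · intro l hl s₂ h₂ hl₂ hT₂
      refine (within_fillCandidates (hs₂.agree h₂ (by decide)) hT₂ ((h₂.nvar 4 rfl).trans h4₁)
        ((h₂.nvar 5 rfl).trans (by simp)) hl₂ (by omega) (by omega) hl hm hn).conseq le_rfl
        (fun s' _ hT => ⟨hT.gap, hT.choice, hT.interval, hT.candidate⟩)
    · have : Tables n m k r (Before i (i + (x + 1)) 0 0) (BeforeInterval i (i + (x + 1)) 0) s' :=
        hb.mono (by unfold Before; omega) (by unfold BeforeInterval; omega)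
      exact ⟨this.gap, this.choice, this.interval, this.candidate⟩
  · exact hb.mono (by unfold Before; omega) (by unfold BeforeInterval; omega)

theorem within_fillTables (hs : Ready n m k r s) (hm : 1 ≤ m) (hn : 1 ≤ n) (hk : 1 ≤ k) :
    Within fillTables s (297 * (2 * n * (2 * n * (k * (m * (n * (k * 1))))))) fun s' =>
      Tables n m k r (fun _ _ _ _ => True) (fun _ _ _ => True) s' := by
  have hX : 1 ≤ 2 * n * (k * (m * (n * (k * 1)))) :=
    Nat.mul_pos (by omega) (Nat.mul_pos hk (Nat.mul_pos hm (Nat.mul_pos hn (by omega))))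
  refine (Within.for (C := 277) (n + 1) (2 * n) (2 * n * (k * (m * (n * (k * 1)))))
    (fun u s' => Tables n m k r (fun i _ _ _ => n < i + u) (fun i _ _ => n < i + u) s')
    (by omega) (by omega) hX (fun s' h => ?_) rfl ?_ ?_).conseq le_rfl (fun s' _ hb => ?_)
  · simp only [NExpr.eval]
    rw [h.nvar 0 rfl, hs.n_eq]
  -- At `u = 0` the claim concerns `i > n` only and is vacuous.
  · constructor <;> intros <;> omega
  · intro u hu s₁ h₁ hu₁ hT₁
    refine Within.mono (Within.seq (T₂ := 273 * (2 * n * (k * (m * (n * (k * 1))))))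
      (Within.nset ?_)) ?_
    rotate_left
    · simp only [NExpr.cost]
      omega
    have hs₁ := hs.agree h₁ (by decide)
    have hs₂ : Ready n m k r { s₁ with nvar := update s₁.nvar 4 (n - u) } :=
      ⟨hs₁.n_eq, hs₁.m_eq, hs₁.k_eq, hs₁.mul_m, hs₁.mul_km, hs₁.mul_nkm, hs₁.cost_eq⟩
    have hT₂ : Tables n m k r (Before (n - u) (n - u) 0 0) (BeforeInterval (n - u) (n - u) 0)
        { s₁ with nvar := update s₁.nvar 4 (n - u) } := by
      have := hT₁.mono (D' := Before (n - u) (n - u) 0 0)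
        (E' := BeforeInterval (n - u) (n - u) 0)
        (by unfold Before; omega) (by unfold BeforeInterval; omega)
      exact ⟨this.gap, this.choice, this.interval, this.candidate⟩
    simp only [NExpr.eval, hu₁, hs₁.n_eq]
    refine (within_fillRow hs₂ hT₂ (by simp) (by omega) hm hn hk).conseq le_rfl
      (fun s' _ hb => ?_)
    have := hb.mono (D' := fun i _ _ _ => n < i + (u + 1)) (E' := fun i _ _ => n < i + (u + 1))
      (by omega) (by omega)
    exact ⟨this.gap, this.choice, this.interval, this.candidate⟩
  · exact hb.mono (by omega) (by omega)

end ChamberlinCourant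

/-! # Reading off a committee -/

namespace ChamberlinCourant

open RAM Function Finset

variable {n m k : ℕ} {r : ℕ → ℕ → ℚ} {s s' : Store}

/-- The cost of the intervals on the stack, of which the top one starts at `p`, and each of the
others at the end of the one above it. Entry `h` of the stack is an interval that ends at `J h` and
may use candidate `C h` and `A h` further candidates. -/
def pendingCost (m : ℕ) (r : ℕ → ℕ → ℚ) (J A C : ℕ → ℕ) : ℕ → ℕ → ℚ
  | 0, _ => 0
  | h + 1, p => gapCost m r p (J h) (A h) (C h) + pendingCost m r J A C h (J h)

/-- The intervals on the stack cover the positions from `p` to `n`. -/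
def Covers (n : ℕ) (J : ℕ → ℕ) : ℕ → ℕ → Prop
  | 0, p => p = n
  | h + 1, p => p ≤ J h ∧ Covers n J h (J h)

theorem pendingCost_congr {J A C J' A' C' : ℕ → ℕ} :
    ∀ (h p : ℕ), (∀ x < h, J x = J' x ∧ A x = A' x ∧ C x = C' x) →
      pendingCost m r J A C h p = pendingCost m r J' A' C' h p
  | 0, _, _ => rfl
  | h + 1, p, H => by
    obtain ⟨h1, h2, h3⟩ := H h (Nat.lt_succ_self h)
    rw [pendingCost, pendingCost, h1, h2, h3,
      pendingCost_congr h (J' h) fun x hx => H x (hx.trans (Nat.lt_succ_self h))]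

theorem Covers.congr {J J' : ℕ → ℕ} :
    ∀ {h p : ℕ}, Covers n J h p → (∀ x < h, J x = J' x) → Covers n J' h p
  | 0, _, H, _ => H
  | h + 1, p, H, HJ => by
    have e := HJ h (Nat.lt_succ_self h)
    rw [Covers, e] at H
    exact ⟨H.1, Covers.congr H.2 fun x hx => HJ x (hx.trans (Nat.lt_succ_self h))⟩

theorem Covers.le {J : ℕ → ℕ} : ∀ {h p : ℕ}, Covers n J h p → p ≤ n
  | 0, _, H => le_of_eq H
  | _ + 1, _, H => H.1.trans (Covers.le H.2)

/-- Splitting off a gap distributes the allowance `A h` as `A h - 1 - l'` and `l'`. The missing unit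
pays for the candidate chosen for the gap. -/
theorem sum_push {A : ℕ → ℕ} {h l' : ℕ} (hl' : l' < A h) :
    ∑ y ∈ range (h + 2), update (update A h (A h - 1 - l')) (h + 1) l' y + 1 =
      ∑ y ∈ range (h + 1), A y := by
  rw [sum_range_succ, sum_range_succ, sum_range_succ, update_self,
    update_of_ne (by omega), update_self]
  rw [sum_congr rfl (g := fun y => A y) fun y hy => ?_]
  · omega
  · have := mem_range.1 hy
    rw [update_of_ne (by omega), update_of_ne (by omega)]

/-- The positions below `p` are served by `w`, the others are covered by the `h` intervals on the
stack, the total cost is `x`, and `M` marks the candidates in use. -/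
structure IsPartial (n m k : ℕ) (r : ℕ → ℕ → ℚ) (x : ℚ) (w : ℕ → ℕ) (h p : ℕ)
    (J A C M : ℕ → ℕ) : Prop where
  covers : Covers n J h p
  cand_lt : ∀ y < h, A y < k ∧ C y < m
  w_lt : ∀ q < p, w q < m
  cost_eq : ∑ q ∈ range p, r q (w q) + pendingCost m r J A C h p = x
  card_le : ((range p).image w ∪ (range h).image C).card + ∑ y ∈ range h, A y ≤ k
  mark_iff : ∀ c, M c = 1 ↔ ∃ q < p, w q = c

variable {x : ℚ} {w : ℕ → ℕ} {h p : ℕ} {J A C M : ℕ → ℕ}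

theorem IsPartial.pop (H : IsPartial n m k r x w (h + 1) p J A C M) (hp : J h ≤ p) :
    IsPartial n m k r x w h p J A C M := by
  have hp' : J h = p := le_antisymm hp H.covers.1
  refine ⟨hp' ▸ H.covers.2, fun y hy => H.cand_lt y (by omega), H.w_lt, ?_, ?_, H.mark_iff⟩
  · have := H.cost_eq
    rwa [pendingCost, hp', gapCost_self, zero_add] at this
  · refine le_trans (add_le_add (card_le_card ?_) ?_) H.card_le
    · exact union_subset_union_right (image_subset_image (range_subset_range.2 (by omega)))
    · rw [sum_range_succ]; omega

/-- `C h` was counted when it entered the stack, so the candidate count does not grow. It is marked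
only now, when it serves a position: in the end the marks must be exactly the range of the
assignment. -/
theorem IsPartial.use (H : IsPartial n m k r x w (h + 1) p J A C M) (hp : p < J h)
    (hG : gapCost m r p (J h) (A h) (C h) = r p (C h) + gapCost m r (p + 1) (J h) (A h) (C h)) :
    IsPartial n m k r x (update w p (C h)) (h + 1) (p + 1) J A C (update M (C h) 1) := by
  have hw : ∀ q < p, update w p (C h) q = w q := fun q hq => update_of_ne hq.ne _ _
  refine ⟨⟨hp, H.covers.2⟩, H.cand_lt, ?_, ?_, ?_, ?_⟩
  · intro q hq
    rcases Nat.lt_succ_iff_lt_or_eq.1 hq with h1 | rfl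
    · rw [hw q h1]; exact H.w_lt q h1
    · rw [update_self]; exact (H.cand_lt h (by omega)).2
  · have := H.cost_eq
    rw [pendingCost, hG] at this
    rw [← this, sum_range_succ, update_self, pendingCost,
      sum_congr rfl fun q hq => by rw [hw q (mem_range.1 hq)]]
    ring
  · refine le_trans (add_le_add_left (card_le_card ?_) _) H.card_le
    rw [range_add_one, image_insert, update_self,
      image_congr (g := w) fun q hq => hw q (mem_range.1 hq)]
    intro c hc
    simp only [mem_union, mem_insert] at hc ⊢
    rcases hc with (rfl | hc) | hc
    · exact Or.inr (mem_image_of_mem C (by simp))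
    · exact Or.inl hc
    · exact Or.inr hc
  · intro c
    by_cases hc : c = C h
    · subst hc
      simp only [update_self, true_iff]
      exact ⟨p, by omega, update_self _ _ _⟩
    · rw [update_of_ne hc, H.mark_iff]
      constructor
      · rintro ⟨q, hq, rfl⟩
        exact ⟨q, by omega, hw q hq⟩
      · rintro ⟨q, hq, rfl⟩
        rcases Nat.lt_succ_iff_lt_or_eq.1 hq with h1 | rfl
        · exact ⟨q, h1, (hw q h1).symm⟩
        · exact absurd (update_self _ _ _) hc

/-- The new candidate adds at most one to the count, and `sum_push` frees one unit. It may already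
be in use elsewhere; the assignment read off need not be non-crossing. -/
theorem IsPartial.push (H : IsPartial n m k r x w (h + 1) p J A C M) {t l' c' : ℕ} (hpt : p < t)
    (htj : t ≤ J h) (hl' : l' < A h) (hc' : c' < m)
    (hG : gapCost m r p (J h) (A h) (C h) =
      gapCost m r p t l' c' + gapCost m r t (J h) (A h - 1 - l') (C h)) :
    IsPartial n m k r x w (h + 2) p (update J (h + 1) t)
      (update (update A h (A h - 1 - l')) (h + 1) l') (update C (h + 1) c') M := by
  have hA := (H.cand_lt h (by omega)).1
  refine ⟨⟨?_, ?_, ?_⟩, ?_, H.w_lt, ?_, ?_, H.mark_iff⟩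
  · simpa using hpt.le
  · simpa using htj
  · simp only [ne_eq, Nat.left_eq_add, one_ne_zero, not_false_eq_true, update_of_ne]
    exact H.covers.2.congr fun y hy => by rw [update_of_ne (by omega)]
  · intro y hy
    obtain rfl | rfl | hy' : y = h + 1 ∨ y = h ∨ y < h := by omega
    · simp only [update_self]; exact ⟨by omega, hc'⟩
    · simp only [ne_eq, Nat.left_eq_add, one_ne_zero, not_false_eq_true, update_of_ne, update_self]
      exact ⟨by omega, (H.cand_lt _ (by omega)).2⟩
    · rw [update_of_ne (by omega), update_of_ne (by omega), update_of_ne (by omega)]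
      exact H.cand_lt y (by omega)
  · rw [← H.cost_eq, pendingCost, pendingCost, pendingCost, hG]
    simp only [update_self, ne_eq, Nat.left_eq_add, one_ne_zero, not_false_eq_true, update_of_ne]
    rw [pendingCost_congr (J' := J) (A' := A) (C' := C) h (J h)]
    · ring
    · intro y hy
      rw [update_of_ne (by omega), update_of_ne (by omega), update_of_ne (by omega),
        update_of_ne (by omega)]
      exact ⟨rfl, rfl, rfl⟩
  · have e1 : (range (h + 2)).image (update C (h + 1) c') =
        insert c' ((range (h + 1)).image C) := by
      rw [range_add_one, image_insert, update_self, image_congr (g := C)]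
      intro y hy
      have := mem_range.1 hy
      exact update_of_ne (by omega) _ _
    have e2 := sum_push hl'
    have := H.card_le
    rw [e1, union_insert]
    have := card_insert_le c' ((range p).image w ∪ (range (h + 1)).image C)
    omega

/-- The top interval on the stack. -/
def top : NExpr := .sub (.var 17) (.const 1)

/-- Split the top interval at the end of a gap. -/
def pushGap : Program :=
  .seq (.nset 10 (.get 7 (.var 14))) <|
  .seq (.nset 16 (cellExpr (.var 4) (.var 9) (.var 10) (.const 0))) <|
  .seq (.nput 10 top (.sub (.sub (.var 6) (.const 1)) (.var 10))) <|
  .seq (.nput 9 (.var 17) (.var 9)) <|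
  .seq (.nput 10 (.var 17) (.var 10)) <|
  .seq (.nput 11 (.var 17) (.get 8 (.var 16))) <|
  .nset 17 (.add (.var 17) (.const 1))

/-- Serve the first position of the top interval, or split the interval. -/
def processTop : Program :=
  .seq (.nset 14 (cellExpr (.var 4) (.var 5) (.var 6) (.var 7))) <|
  .seq (.nset 9 (.get 6 (.var 14))) <|
  .ite (.nle (.var 9) (.const 0))
    (.seq (.nput 2 (.var 7) (.const 1)) (.nset 4 (.add (.var 4) (.const 1))))
    pushGap

/-- Treat the top of the stack. -/
def stackStep : Program :=
  .seq (.nset 5 (.get 9 top)) <|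
  .seq (.nset 6 (.get 10 top)) <|
  .seq (.nset 7 (.get 11 top)) <|
  .ite (.nle (.var 5) (.var 4)) (.nset 17 top) processTop

/-- The memory holds the stack and the marks of a partial solution. -/
def HasPartial (n m k : ℕ) (r : ℕ → ℕ → ℚ) (x : ℚ) (s : Store) : Prop :=
  ∃ w, IsPartial n m k r x w (s.nvar 17) (s.nvar 4) (s.narr 9) (s.narr 10) (s.narr 11) (s.narr 2)

/-- A bound for the number of remaining steps. -/
def stackMeasure (n : ℕ) (s : Store) : ℕ :=
  -- Serving a position lowers the first term and a pop lowers the height. A push raises the height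
  -- by one and lowers the sum by one, hence the factor 2.
  (n - s.nvar 4) + 2 * ∑ y ∈ range (s.nvar 17), s.narr 10 y + s.nvar 17

theorem within_pushGap {t l' : ℕ} (hs : Ready n m k r s)
    (hT : Tables n m k r (fun _ _ _ _ => True) (fun _ _ _ => True) s)
    (H : IsPartial n m k r x w (h + 1) p (s.narr 9) (s.narr 10) (s.narr 11) (s.narr 2))
    (h17 : s.nvar 17 = h + 1) (h4 : s.nvar 4 = p) (h6 : s.nvar 6 = s.narr 10 h)
    (h9 : s.nvar 9 = t) (h7 : s.narr 7 (s.nvar 14) = l') (hpt : p < t)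
    (htj : t ≤ s.narr 9 h) (hl' : l' < s.narr 10 h)
    (hG : gapCost m r p (s.narr 9 h) (s.narr 10 h) (s.narr 11 h) = intervalCost m r p t l' +
      gapCost m r t (s.narr 9 h) (s.narr 10 h - 1 - l') (s.narr 11 h)) :
    Within pushGap s 60 fun s' => HasPartial n m k r x s' ∧ stackMeasure n s' < stackMeasure n s := by
  have htn : t ≤ n := htj.trans H.covers.2.le
  have hlk : l' < k := hl'.trans (H.cand_lt h (by omega)).1
  obtain ⟨hc1, hc2⟩ := hT.candidate p t l' hpt.le htn hlk trivial
  rw [hc2] at hG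
  have H' := H.push hpt htj hl' hc1 hG
  have hsum := sum_push hl'
  have hs' : Ready n m k r { s with nvar := update s.nvar 10 l' } :=
    ⟨hs.n_eq, hs.m_eq, hs.k_eq, hs.mul_m, hs.mul_km, hs.mul_nkm, hs.cost_eq⟩
  have e1 : (cellExpr (.var 4) (.var 9) (.var 10) (.const 0)).eval
      { s with nvar := update s.nvar 10 l' } = addr n m k p t l' 0 := by
    rw [hs'.cellExpr_eval (by simp [NExpr.eval, h4]; omega) (by simp [NExpr.eval, h9]; omega)
      (by simp [NExpr.eval]; omega)]
    simp [NExpr.eval, h4, h9]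
  refine Within.mono (Within.seq (T₂ := 50) (Within.nset ?_)) (by decide)
  rw [show NExpr.eval s (.get 7 (.var 14)) = l' from h7]
  refine Within.mono (Within.seq (T₂ := 30) (Within.nset ?_)) (by decide)
  rw [e1]
  refine Within.mono (Within.seq (Within.nput (Within.seq (Within.nput
    (Within.seq (Within.nput (Within.seq (Within.nput (Within.nset ?_)))))))))
    (?_ : _ ≤ 30)
  rotate_left
  · decide
  simp [NExpr.eval, h4, h9, h6, h17, top, HasPartial, stackMeasure]
  refine ⟨⟨w, ?_⟩, ?_⟩
  · exact H'
  · change _ + 2 * ∑ y ∈ range (h + 2), _ + _ < _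
    omega

theorem within_processTop {i j l c : ℕ} (hs : Ready n m k r s)
    (hT : Tables n m k r (fun _ _ _ _ => True) (fun _ _ _ => True) s)
    (H : IsPartial n m k r x w (h + 1) i (s.narr 9) (s.narr 10) (s.narr 11) (s.narr 2))
    (h17 : s.nvar 17 = h + 1) (ha : At i j l c s) (hj : s.narr 9 h = j) (hl : s.narr 10 h = l)
    (hc : s.narr 11 h = c) (hij : i < j) :
    Within processTop s 100 fun s' =>
      HasPartial n m k r x s' ∧ stackMeasure n s' < stackMeasure n s := by
  have hjn : j ≤ n := hj ▸ H.covers.2.le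
  have hlk : l < k := hl ▸ (H.cand_lt h (by omega)).1
  have hcm : c < m := hc ▸ (H.cand_lt h (by omega)).2
  have hch := hT.choice i j l c hij hjn hlk hcm trivial
  have e1 : (cellExpr (.var 4) (.var 5) (.var 6) (.var 7)).eval s = addr n m k i j l c := by
    rw [hs.cellExpr_eval (by simp only [NExpr.eval, ha.i_eq]; omega)
      (by simp only [NExpr.eval, ha.j_eq]; omega) (by simp only [NExpr.eval, ha.l_eq]; omega)]
    simp only [NExpr.eval, ha.i_eq, ha.j_eq, ha.l_eq, ha.c_eq]
  refine Within.mono (Within.seq (Within.nset (Within.seq (Within.nset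
    (Within.ite (T₂ := 60) (fun hb => Within.seq (Within.nput (Within.nset ?_))) fun hb => ?_)))))
    (?_ : _ ≤ 100)
  rotate_left 2
  · simp only [NExpr.cost, cellExpr, Test.cost]
    omega
  · rw [e1] at hb ⊢
    simp [Test.Holds, NExpr.eval] at hb
    simp [NExpr.eval, HasPartial, stackMeasure, ha.c_eq, ha.i_eq, h17]
    refine ⟨⟨update w i c, ?_⟩, by omega⟩
    have := H.use (by omega) ?_
    · rwa [hc] at this
    · rw [hj, hl, hc]
      rcases hch with ⟨-, h2⟩ | ⟨h1, -⟩
      · exact h2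
      · omega
  · rw [e1] at hb ⊢
    simp [Test.Holds, NExpr.eval] at hb
    rcases hch with ⟨h1, -⟩ | ⟨h1, h2, h3, h4⟩
    · omega
    subst hj hl hc
    refine Within.conseq (within_pushGap (t := s.narr 6 (addr n m k i (s.narr 9 h) (s.narr 10 h) (s.narr 11 h)))
      (l' := s.narr 7 (addr n m k i (s.narr 9 h) (s.narr 10 h) (s.narr 11 h))) (h := h) (p := i) (w := w) (x := x) (n := n) (m := m) (k := k) (r := r)
      ⟨hs.n_eq, hs.m_eq, hs.k_eq, hs.mul_m, hs.mul_km, hs.mul_nkm, hs.cost_eq⟩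
      ⟨hT.gap, hT.choice, hT.interval, hT.candidate⟩ H (by simp [h17]) (by simp [ha.i_eq])
      (by simp [ha.l_eq]) (by simp [NExpr.eval]) (by simp [NExpr.eval]) h1 h2 h3 h4) le_rfl ?_
    rintro s' - ⟨h5, h6⟩
    exact ⟨h5, by simpa [stackMeasure] using h6⟩

theorem within_stackStep (hs : Ready n m k r s)
    (hT : Tables n m k r (fun _ _ _ _ => True) (fun _ _ _ => True) s)
    (H : HasPartial n m k r x s) (hb : 1 ≤ s.nvar 17) :
    Within stackStep s 150 fun s' =>
      HasPartial n m k r x s' ∧ stackMeasure n s' < stackMeasure n s := by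
  obtain ⟨h, h17⟩ : ∃ h, s.nvar 17 = h + 1 := ⟨s.nvar 17 - 1, by omega⟩
  obtain ⟨w, H⟩ := H
  rw [h17] at H
  refine Within.mono (Within.seq (Within.nset (Within.seq (Within.nset (Within.seq (Within.nset
    (Within.ite (T₂ := 100) (fun hb => Within.nset ?_) fun hb => ?_)))))))
    (?_ : _ ≤ 150)
  rotate_left 2
  · decide
  · simp [Test.Holds, NExpr.eval, top, h17] at hb
    simp [NExpr.eval, top, HasPartial, stackMeasure, h17, sum_range_succ]
    exact ⟨⟨w, H.pop hb⟩, by omega⟩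
  · simp [Test.Holds, NExpr.eval, top, h17] at hb ⊢
    refine Within.conseq (within_processTop (j := s.narr 9 h) (l := s.narr 10 h) (c := s.narr 11 h) (h := h) (i := s.nvar 4) (w := w) (x := x) (n := n) (m := m) (k := k)
      (r := r) ⟨hs.n_eq, hs.m_eq, hs.k_eq, hs.mul_m, hs.mul_km, hs.mul_nkm, hs.cost_eq⟩
      ⟨hT.gap, hT.choice, hT.interval, hT.candidate⟩ H (by simp [h17])
      (by constructor <;> simp) rfl rfl rfl hb) le_rfl ?_
    rintro s' - ⟨h5, h6⟩
    exact ⟨h5, by simpa [stackMeasure] using h6⟩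

/-- Read off the optimal value and the committee from the tables. -/
def readOff : Program :=
  .seq (.nset 16 (cellExpr (.const 0) (.var 0) (.sub (.var 2) (.const 1)) (.const 0))) <|
  .seq (.qset 0 (.get 2 (.var 16))) <|
  .seq (.nput 9 (.const 0) (.var 0)) <|
  .seq (.nput 10 (.const 0) (.sub (.var 2) (.const 1))) <|
  .seq (.nput 11 (.const 0) (.get 8 (.var 16))) <|
  .seq (.nset 17 (.const 1)) <|
  .seq (.nset 4 (.const 0)) <|
  .loop (.nle (.const 1) (.var 17)) stackStep

/-- The converse of `intervalCost_le_sum`: the value of the recursion is attained by an assignment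
with at most `k` candidates. -/
theorem within_readOff (hs : Ready n m k r s)
    (hT : Tables n m k r (fun _ _ _ _ => True) (fun _ _ _ => True) s) (hk : 1 ≤ k)
    (h2 : s.narr 2 = fun _ => 0) :
    Within readOff s (50 + 153 * (n + 2 * k)) fun s' =>
      s'.qvar 0 = intervalCost m r 0 n (k - 1) ∧ ∃ w : ℕ → ℕ, (∀ q < n, w q < m) ∧
        ∑ q ∈ range n, r q (w q) = intervalCost m r 0 n (k - 1) ∧
        ((range n).image w).card ≤ k ∧ ∀ c, s'.narr 2 c = 1 ↔ ∃ q < n, w q = c := by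
  obtain ⟨hc1, hc2⟩ := hT.candidate 0 n (k - 1) (Nat.zero_le _) le_rfl (by omega) trivial
  have hi := hT.interval 0 n (k - 1) (Nat.zero_le _) le_rfl (by omega) trivial
  have e1 : (cellExpr (.const 0) (.var 0) (.sub (.var 2) (.const 1)) (.const 0)).eval s =
      addr n m k 0 n (k - 1) 0 := by
    rw [hs.cellExpr_eval (by simp [NExpr.eval]) (by simp [NExpr.eval, hs.n_eq])
      (by simp [NExpr.eval, hs.k_eq]; omega)]
    simp [NExpr.eval, hs.n_eq, hs.k_eq]
  refine Within.mono (Within.seq (Within.nset (Within.seq (Within.qset (Within.seq (Within.nput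
    (Within.seq (Within.nput (Within.seq (Within.nput (Within.seq (Within.nset (Within.seq
    -- The initial stack has one entry with allowance `k - 1`, so its measure is `n + 2 * (k - 1) +
    -- 1`. A round takes 150 steps and 3 for the test.
    (T₂ := (n + 2 * (k - 1) + 1) * 153 + 3) (Within.nset ?_)))))))))))))) ?_
  rotate_left
  · simp only [NExpr.cost, cellExpr, QExpr.cost]
    omega
  rw [e1]
  simp [NExpr.eval, QExpr.eval, hs.n_eq, hs.k_eq]
  refine ((Within.loop (T := 150) (HasPartial n m k r (intervalCost m r 0 n (k - 1)))
    (stackMeasure n) (fun s' hag H hb => ?_) ⟨id, ?_⟩)).conseq ?_ ?_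
  · refine within_stackStep (Ready.agree ?_ hag (by decide))
      (Tables.agree ?_ hag rfl rfl rfl rfl rfl) H (by simpa [Test.Holds, NExpr.eval] using hb)
    · exact ⟨hs.n_eq, hs.m_eq, hs.k_eq, hs.mul_m, hs.mul_km, hs.mul_nkm, hs.cost_eq⟩
    · exact ⟨hT.gap, hT.choice, hT.interval, hT.candidate⟩
  · refine ⟨?_, ?_, ?_, ?_, ?_, ?_⟩
    · simp [Covers]
    · simp [hc1]; omega
    · simp
    · simp [pendingCost, hc2]
    · simp; omega
    · simp [h2]
  · simp [stackMeasure, Test.cost, NExpr.cost]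
  · rintro s' hag ⟨⟨w, H⟩, hb⟩
    have h0 : s'.nvar 17 = 0 := by simpa [Test.Holds, NExpr.eval] using hb
    rw [h0] at H
    have hn : s'.nvar 4 = n := H.covers
    rw [hn] at H
    refine ⟨?_, w, H.w_lt, ?_, ?_, H.mark_iff⟩
    · rw [hag.qvar 0 rfl]
      simp [hi]
    · simpa [pendingCost] using H.cost_eq
    · simpa using H.card_le

end ChamberlinCourant

/-! # Profiles listed in a two-crossing order -/

namespace Profile

variable {n m : ℕ} {P : Profile n m}

theorem asymm (P : Profile n m) {v : Fin n} {c c' : Fin m} (h : P.prefers v c c') :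
    ¬ P.prefers v c' c :=
  fun h' => P.irrefl v c (P.trans v c c' c h h')

theorem rank_lt_rank {v : Fin n} {c c' : Fin m} (h : P.prefers v c c') :
    P.rank v c < P.rank v c' := by
  refine Set.ncard_lt_ncard ⟨fun a ha => P.trans v a c c' ha h, fun hs => ?_⟩ (Set.toFinite _)
  exact P.irrefl v c (hs h)

theorem rank_lt_iff {v : Fin n} {c c' : Fin m} :
    P.rank v c < P.rank v c' ↔ P.prefers v c c' := by
  refine ⟨fun h => ?_, rank_lt_rank⟩
  rcases eq_or_ne c c' with rfl | hne
  · exact absurd h (lt_irrefl _)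
  · exact (P.total v c c' hne).resolve_right fun h' => h.asymm (rank_lt_rank h')

/-- No four voters, listed in the order `σ`, alternate between two candidates. -/
def NoAlternation (P : Profile n m) (σ : Equiv.Perm (Fin n)) : Prop :=
  ∀ (c c' : Fin m) (p₁ p₂ p₃ p₄ : Fin n), p₁ < p₂ → p₂ < p₃ → p₃ < p₄ →
    P.prefers (σ p₁) c c' → P.prefers (σ p₂) c' c → P.prefers (σ p₃) c c' →
    ¬ P.prefers (σ p₄) c' c

theorem exists_mem_crossings {σ : Equiv.Perm (Fin n)} {c c' : Fin m} {p q : Fin n} (hpq : p < q)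
    (h : ¬ (P.prefers (σ p) c c' ↔ P.prefers (σ q) c c')) :
    ∃ i ∈ P.crossings σ c c', p ≤ i ∧ i < q := by
  by_contra! H
  have key : ∀ (d : ℕ) (hd : p.val + d ≤ q.val),
      (P.prefers (σ p) c c' ↔ P.prefers (σ ⟨p.val + d, by omega⟩) c c') := by
    intro d
    induction d with
    | zero => intro; rfl
    | succ d ih =>
      intro hd
      rw [ih (by omega)]
      by_contra hne
      have := H ⟨p.val + d, by omega⟩ ⟨by simp only; omega, hne⟩ (by simp [Fin.le_def])
      rw [Fin.le_def] at this
      simp only at this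
      omega
  have hlt : p.val < q.val := hpq
  refine h ((key (q.val - p.val) (by omega)).trans ?_)
  have : (⟨p.val + (q.val - p.val), by omega⟩ : Fin n) = q := Fin.ext (by simp only; omega)
  rw [this]

/-- Each of the three changes in an alternation has a crossing of its own, in disjoint stretches of
the order. -/
theorem IsCrossingWrt.noAlternation {σ : Equiv.Perm (Fin n)} (h : P.IsCrossingWrt 2 σ) :
    P.NoAlternation σ := by
  intro c c' p₁ p₂ p₃ p₄ h12 h23 h34 h1 h2 h3 h4
  have hne : c ≠ c' := by rintro rfl; exact P.irrefl _ _ h1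
  obtain ⟨a, ha, ha1, ha2⟩ := exists_mem_crossings (P := P) (σ := σ) (c := c) (c' := c') h12
    (fun H => P.asymm h2 (H.1 h1))
  obtain ⟨b, hb, hb1, hb2⟩ := exists_mem_crossings (P := P) (σ := σ) (c := c) (c' := c') h23
    (fun H => P.asymm h2 (H.2 h3))
  obtain ⟨d, hd, hd1, hd2⟩ := exists_mem_crossings (P := P) (σ := σ) (c := c) (c' := c') h34
    (fun H => P.asymm h4 (H.1 h3))
  have hab : a < b := ha2.trans_le hb1
  have hbd : b < d := hb2.trans_le hd1
  have h3 : ({a, b, d} : Set (Fin n)).ncard = 3 :=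
    Set.ncard_eq_three.2 ⟨a, b, d, hab.ne, (hab.trans hbd).ne, hbd.ne, rfl⟩
  have hsub : ({a, b, d} : Set (Fin n)) ⊆ P.crossings σ c c' := by
    rintro y (rfl | rfl | rfl) <;> assumption
  have := Set.ncard_le_ncard hsub (Set.toFinite _)
  have := h c c' hne
  omega

theorem exists_favourite (P : Profile n m) (v : Fin n) {S : Set (Fin m)} (hS : S.Nonempty) :
    ∃ a ∈ S, ∀ b ∈ S, b ≠ a → P.prefers v a b := by
  obtain ⟨a, ha, hmin⟩ := Set.exists_min_image S (P.rank v) (Set.toFinite S) hS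
  refine ⟨a, ha, fun b hb hne => (P.total v b a hne).resolve_left fun h => ?_⟩
  exact absurd (rank_lt_rank h) (not_lt.2 (hmin b hb))

end Profile

/-! ### Optimality of the computed assignment, and the algorithm for a given order -/

namespace ChamberlinCourant

open RAM Function Finset

variable {n m k : ℕ}

theorem table_apply {α : Type} [Zero α] (f : Fin n → Fin m → α) (v : Fin n) (c : Fin m) :
    table f (v * m + c) = f v c := by
  have hm : 0 < m := c.pos
  have h : v.val * m + c.val < n * m :=
    calc v.val * m + c.val < v.val * m + m := by omega
      _ = (v.val + 1) * m := by ring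
      _ ≤ n * m := Nat.mul_le_mul_right _ v.isLt
  rw [table, dif_pos h]
  congr 1
  · ext
    simp only [Fin.coe_divNat]
    rw [mul_comm, Nat.mul_add_div hm, Nat.div_eq_of_lt c.isLt, add_zero]
  · ext
    simp only [Fin.coe_modNat]
    rw [mul_comm, Nat.mul_add_mod, Nat.mod_eq_of_lt c.isLt]

/-- The dissatisfaction with a candidate at each position. -/
def positionCost (ρ : Fin n → Fin m → ℚ) (σ : Equiv.Perm (Fin n)) (i c : ℕ) : ℚ :=
  if h : i < n ∧ c < m then ρ (σ ⟨i, h.1⟩) ⟨c, h.2⟩ else 0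

/-- Let every voter switch to the favourite member `f v` of the committee. By consistency nobody is
worse off. A crossing of two favourites would be four voters alternating between them, as each
prefers the own favourite to the other one; so `intervalCost_le_sum` applies. -/
theorem intervalCost_le_dissatisfaction {P : Profile n m} {ρ : Fin n → Fin m → ℚ}
    {σ : Equiv.Perm (Fin n)} (hn : 0 < n) (hρ : P.Consistent ρ) (hP : P.NoAlternation σ)
    {w : Fin n → Fin m} (hw : IsAssignment k w) :
    intervalCost m (positionCost ρ σ) 0 n (k - 1) ≤ dissatisfaction ρ w := by
  have hne : (Set.range w).Nonempty := ⟨w ⟨0, hn⟩, Set.mem_range_self _⟩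
  choose f hf hfav using fun v => P.exists_favourite v hne
  set g : ℕ → ℕ := fun p => if h : p < n then (f (σ ⟨p, h⟩)).val else 0 with hg
  have hgp : ∀ p (h : p < n), g p = (f (σ ⟨p, h⟩)).val := fun p h => dif_pos h
  have hnc : NonCrossing g 0 n := by
    intro p₁ p₂ p₃ p₄ _ h12 h23 h34 h4 e13 e24
    rw [hgp p₁ (by omega), hgp p₂ (by omega)]
    rw [hgp p₁ (by omega), hgp p₃ (by omega)] at e13
    rw [hgp p₂ (by omega), hgp p₄ h4] at e24
    have e13 := Fin.ext e13
    have e24 := Fin.ext e24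
    by_contra hne
    have hne : f (σ ⟨p₁, by omega⟩) ≠ f (σ ⟨p₂, by omega⟩) := fun h => hne (congrArg _ h)
    refine hP (f (σ ⟨p₁, by omega⟩)) (f (σ ⟨p₂, by omega⟩)) ⟨p₁, by omega⟩ ⟨p₂, by omega⟩
      ⟨p₃, by omega⟩ ⟨p₄, h4⟩ h12 h23 h34 ?_ ?_ ?_ ?_
    · exact hfav _ _ (hf _) hne.symm
    · exact hfav _ _ (hf _) hne
    · rw [e13] at hne ⊢
      exact hfav _ _ (hf _) hne.symm
    · rw [e24] at hne ⊢
      exact hfav _ _ (hf _) hne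
  have hcard : ((range n).image g).card ≤ k := by
    refine le_trans ?_ hw
    rw [← Set.ncard_image_of_injective (Set.range w) Fin.val_injective, ← Set.ncard_coe_finset]
    refine Set.ncard_le_ncard ?_ (Set.toFinite _)
    intro y hy
    simp only [coe_image, Set.mem_image, coe_range, Set.mem_Iio] at hy
    obtain ⟨p, hp, rfl⟩ := hy
    exact ⟨_, hf (σ ⟨p, hp⟩), (hgp p hp).symm⟩
  refine (intervalCost_le_sum hn (fun p hp => ?_) hnc hcard).trans ?_
  · rw [hgp p hp]; exact Fin.isLt _
  · rw [← Fin.sum_univ_eq_sum_range (fun p => positionCost ρ σ p (g p)), dissatisfaction,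
      ← Equiv.sum_comp σ fun v => ρ v (w v)]
    refine sum_le_sum fun i _ => ?_
    rw [hgp i i.isLt, positionCost, dif_pos ⟨i.isLt, Fin.isLt _⟩]
    simp only [Fin.eta]
    rcases eq_or_ne (w (σ i)) (f (σ i)) with h | h
    · rw [h]
    · exact hρ _ _ _ (hfav (σ i) _ (Set.mem_range_self _) h)

/-- The assignment costs as much as the lower bound for all `k`-assignments, so it is optimal, and
the marked candidates are its range. -/
theorem solved_of_positions {P : Profile n m} {ρ : Fin n → Fin m → ℚ}
    {σ : Equiv.Perm (Fin n)} (hn : 0 < n) (hρ : P.Consistent ρ) (hP : P.NoAlternation σ)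
    {s : Store} (hq : s.qvar 0 = intervalCost m (positionCost ρ σ) 0 n (k - 1))
    {w : ℕ → ℕ} (hw : ∀ q < n, w q < m)
    (hsum : ∑ q ∈ range n, positionCost ρ σ q (w q) =
      intervalCost m (positionCost ρ σ) 0 n (k - 1))
    (hcard : ((range n).image w).card ≤ k) (hmark : ∀ c, s.narr 2 c = 1 ↔ ∃ q < n, w q = c) :
    Solved ρ k s := by
  set w' : Fin n → Fin m := fun v => ⟨w (σ.symm v), hw _ (Fin.isLt _)⟩ with hw'
  have hdis : dissatisfaction ρ w' = s.qvar 0 := by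
    rw [hq, ← hsum, ← Fin.sum_univ_eq_sum_range (fun p => positionCost ρ σ p (w p)),
      dissatisfaction, ← Equiv.sum_comp σ fun v => ρ v (w' v)]
    refine sum_congr rfl fun i _ => ?_
    rw [positionCost, dif_pos ⟨i.isLt, hw _ i.isLt⟩]
    simp [hw']
  have hass : IsAssignment k w' := by
    refine le_trans ?_ hcard
    rw [← Set.ncard_image_of_injective (Set.range w') Fin.val_injective, ← Set.ncard_coe_finset]
    refine Set.ncard_le_ncard ?_ (Set.toFinite _)
    rintro y ⟨_, ⟨v, rfl⟩, rfl⟩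
    simp only [coe_image, Set.mem_image, coe_range, Set.mem_Iio]
    exact ⟨_, (σ.symm v).isLt, rfl⟩
  have hopt : ∀ w₁ : Fin n → Fin m, IsAssignment k w₁ → s.qvar 0 ≤ dissatisfaction ρ w₁ :=
    fun w₁ h₁ => hq ▸ intervalCost_le_dissatisfaction hn hρ hP h₁
  refine ⟨⟨⟨w', hass, hdis.symm⟩, ?_⟩, w', ⟨hass, fun w₁ h₁ => hdis ▸ hopt w₁ h₁⟩, ?_⟩
  · rintro y ⟨w₁, h₁, rfl⟩
    exact hopt w₁ h₁
  · ext c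
    simp only [Set.mem_ofPred_eq, hmark, Set.mem_range]
    constructor
    · rintro ⟨q, hq, hc⟩
      exact ⟨σ ⟨q, hq⟩, Fin.ext (by simp [hw', hc])⟩
    · rintro ⟨v, rfl⟩
      exact ⟨_, (σ.symm v).isLt, rfl⟩

/-- Compute the arrays of multiples. -/
def prepare : Program :=
  .seq (multiples 3 (.var 1) (.add (.var 0) (.var 2))) <|
  .seq (multiples 4 (.get 3 (.var 2)) (.add (.var 0) (.const 1))) <|
  multiples 5 (.get 4 (.add (.var 0) (.const 1))) (.var 0)

theorem within_prepare {r : ℕ → ℕ → ℚ} {s : Store} (hn : 1 ≤ n) (h0 : s.nvar 0 = n)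
    (h1 : s.nvar 1 = m) (h2 : s.nvar 2 = k) (hσ : ∀ i < n, s.narr 1 i < n)
    (hr : ∀ i < n, ∀ c < m, s.qarr 0 (s.narr 1 i * m + c) = r i c) :
    Within prepare s (9 + 28 * (n + k) + 29 * (n + 1) + 27 * n) fun s' =>
      Ready n m k r s' ∧ s'.narr 2 = s.narr 2 := by
  refine Within.mono (T₁ := (3 + 28 * ((n + k) * 1)) +
    ((3 + 29 * ((n + 1) * 1)) + (3 + 27 * (n * 1)))) ?_ (by omega)
  refine Within.seq ((within_multiples m (n + k) (n + k) (fun s' h => ?_)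
    (fun s' h => ?_) le_rfl (by omega)).conseq le_rfl fun s₁ ag₁ H₁ => ?_)
  · rw [NExpr.eval, h.nvar 1 rfl, h1]
  · rw [NExpr.eval, NExpr.eval, NExpr.eval, h.nvar 0 rfl, h.nvar 2 rfl, h0, h2]
  refine Within.seq ((within_multiples (k * m) (n + 1) (n + 1) (fun s' h => ?_)
    (fun s' h => ?_) le_rfl (by omega)).conseq le_rfl fun s₂ ag₂ H₂ => ?_)
  · rw [NExpr.eval, NExpr.eval, h.nvar 2 rfl, h.narr 3 rfl, ag₁.nvar 2 rfl, h2,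
      H₁ k (by omega)]
  · rw [NExpr.eval, NExpr.eval, NExpr.eval, h.nvar 0 rfl, ag₁.nvar 0 rfl, h0]
  refine (within_multiples ((n + 1) * (k * m)) n n (fun s' h => ?_)
    (fun s' h => ?_) le_rfl (by omega)).conseq le_rfl fun s₃ ag₃ H₃ => ?_
  · rw [NExpr.eval, NExpr.eval, NExpr.eval, NExpr.eval, h.nvar 0 rfl, h.narr 4 rfl,
      ag₂.nvar 0 rfl, ag₁.nvar 0 rfl, h0, H₂ (n + 1) le_rfl]
  · rw [NExpr.eval, h.nvar 0 rfl, ag₂.nvar 0 rfl, ag₁.nvar 0 rfl, h0]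
  have e3 : s₃.narr 3 = s₁.narr 3 := by rw [ag₃.narr 3 rfl, ag₂.narr 3 rfl]
  refine ⟨⟨?_, ?_, ?_, ?_, ?_, H₃, ?_⟩, ?_⟩
  · rw [ag₃.nvar 0 rfl, ag₂.nvar 0 rfl, ag₁.nvar 0 rfl, h0]
  · rw [ag₃.nvar 1 rfl, ag₂.nvar 1 rfl, ag₁.nvar 1 rfl, h1]
  · rw [ag₃.nvar 2 rfl, ag₂.nvar 2 rfl, ag₁.nvar 2 rfl, h2]
  · rw [e3]; exact H₁
  · rw [ag₃.narr 4 rfl]; exact H₂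
  · intro i hi c hc
    rw [e3, ag₃.narr 1 rfl, ag₂.narr 1 rfl, ag₁.narr 1 rfl, ag₃.qarr 0 rfl, ag₂.qarr 0 rfl,
      ag₁.qarr 0 rfl, H₁ _ ((hσ i hi).le.trans (Nat.le_add_right _ _))]
    exact hr i hi c hc
  · rw [ag₃.narr 2 rfl, ag₂.narr 2 rfl, ag₁.narr 2 rfl]

/-- Find an optimal committee, given a suitable order of the voters in array 1. -/
def solveOrdered : Program := .seq prepare (.seq fillTables readOff)

/-- Of the order only `NoAlternation` is needed, so this also applies to an order computed by the
machine. The tables take `297 * 4 * (n ^ 3 * k ^ 2 * m)` steps; all else is linear in `n` and `k`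
and fits into the constant 2000. -/
theorem within_solveOrdered {P : Profile n m} {ρ : Fin n → Fin m → ℚ}
    {σ : Equiv.Perm (Fin n)} {s : Store} (hn : 1 ≤ n) (hk : 1 ≤ k) (hkm : k ≤ m)
    (hρ : P.Consistent ρ) (hP : P.NoAlternation σ) (h0 : s.nvar 0 = n)
    (h1 : s.nvar 1 = m) (h2 : s.nvar 2 = k) (hσ : ∀ i : Fin n, s.narr 1 i = σ i)
    (hr : s.qarr 0 = table ρ) (hM : s.narr 2 = fun _ => 0) :
    Within solveOrdered s (2000 * (n ^ 3 * k ^ 2 * m)) (Solved ρ k) := by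
  have hm : 1 ≤ m := hk.trans hkm
  refine Within.mono (T₁ := (9 + 28 * (n + k) + 29 * (n + 1) + 27 * n) +
    (297 * (2 * n * (2 * n * (k * (m * (n * (k * 1)))))) + (50 + 153 * (n + 2 * k)))) ?_ ?_
  · refine Within.seq ((within_prepare (r := positionCost ρ σ) hn h0 h1 h2 (fun i hi => ?_)
      fun i hi c hc => ?_).conseq le_rfl ?_)
    · rw [hσ ⟨i, hi⟩]; exact Fin.isLt _
    · rw [hr, hσ ⟨i, hi⟩, table_apply ρ _ ⟨c, hc⟩, positionCost, dif_pos ⟨hi, hc⟩]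
    rintro s₁ - ⟨hs₁, hM₁⟩
    refine Within.seq ((within_fillTables hs₁ hm hn hk).conseq le_rfl ?_)
    intro s₂ ag₂ hT
    refine (within_readOff (hs₁.agree ag₂ (by decide)) hT hk ?_).conseq le_rfl ?_
    · rw [ag₂.narr 2 rfl, hM₁, hM]
    · rintro s' - ⟨hq, w, hw, hsum, hcard, hmark⟩
      exact solved_of_positions hn hρ hP hq hw hsum hcard hmark
  · set X := n ^ 3 * k ^ 2 * m with hX
    have e : 2 * n * (2 * n * (k * (m * (n * (k * 1))))) = 4 * X := by rw [hX]; ring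
    have hnX : n ≤ X := by
      calc n ≤ n * (n ^ 2 * k ^ 2 * m) := Nat.le_mul_of_pos_right _ (by positivity)
        _ = X := by rw [hX]; ring
    have hkX : k ≤ X := by
      calc k ≤ k * (n ^ 3 * k * m) := Nat.le_mul_of_pos_right _ (by positivity)
        _ = X := by rw [hX]; ring
    rw [e]
    omega

end ChamberlinCourant

/-! # Consecutive orders

A family of sets of voters is consecutive in an order if no element outside of a set lies between
two elements of it. An order is found by refining a ranking with ties. -/

namespace ConsecutiveOrder

open Finset

/-- No element outside of a set of the family `F` is ranked between two elements of the set that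
are ranked differently, or on a par with one of them. -/
def Stable (F : Set (Set ℕ)) (n : ℕ) (L : ℕ → ℕ) : Prop :=
  ∀ S ∈ F, ∀ x < n, ∀ y < n, ∀ z < n, x ∈ S → y ∉ S → z ∈ S → L x < L z → L y < L x ∨ L z < L y

/-- The ranking `L'` extends `L`. -/
def Refines (n : ℕ) (L L' : ℕ → ℕ) : Prop := ∀ u < n, ∀ v < n, L u < L v → L' u < L' v

/-- The pairs of elements of equal rank. -/
def ties (n : ℕ) (L : ℕ → ℕ) : Finset (ℕ × ℕ) := {p ∈ range n ×ˢ range n | L p.1 = L p.2}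

open Classical in
/-- Raise the elements of rank above `b`, and those of rank `b` that satisfy `T`. -/
noncomputable def shift (n : ℕ) (M : ℕ → ℕ) (b : ℕ) (T : ℕ → Prop) (v : ℕ) : ℕ :=
  if v < n ∧ (b < M v ∨ (b = M v ∧ T v)) then M v + 1 else M v

/-- `M'` is obtained from `M` by a forced splitting of a tie. -/
inductive Step (F : Set (Set ℕ)) (n : ℕ) (M : ℕ → ℕ) : (ℕ → ℕ) → Prop
  | lower {S : Set ℕ} {x y z : ℕ} (hS : S ∈ F) (hx : x < n) (hy : y < n) (hz : z < n)
      (hxS : x ∈ S) (hyS : y ∉ S) (hzS : z ∈ S) (hxz : M x < M z) (hxy : M y = M x) :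
      Step F n M (shift n M (M x) (· ∈ S))
  | upper {S : Set ℕ} {x y z : ℕ} (hS : S ∈ F) (hx : x < n) (hy : y < n) (hz : z < n)
      (hxS : x ∈ S) (hyS : y ∉ S) (hzS : z ∈ S) (hxz : M x < M z) (hzy : M y = M z) :
      Step F n M (shift n M (M z) (· ∉ S))

/-- Some element outside of a set is ranked strictly between two elements of it. -/
def Stuck (F : Set (Set ℕ)) (n : ℕ) (M : ℕ → ℕ) : Prop :=
  ∃ S ∈ F, ∃ x < n, ∃ y < n, ∃ z < n, x ∈ S ∧ y ∉ S ∧ z ∈ S ∧ M x < M y ∧ M y < M z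

/-- `B` is a strict linear order in which the sets of `F` are consecutive. -/
structure IsOrder (F : Set (Set ℕ)) (n : ℕ) (B : ℕ → ℕ → Prop) : Prop where
  total : ∀ u < n, ∀ v < n, u ≠ v → B u v ∨ B v u
  convex : ∀ S ∈ F, ∀ x < n, ∀ y < n, ∀ z < n, x ∈ S → y ∉ S → z ∈ S → ¬ (B x y ∧ B y z)

/-- `B` breaks the ties of `M`. -/
def Compatible (n : ℕ) (M : ℕ → ℕ) (B : ℕ → ℕ → Prop) : Prop :=
  ∀ u < n, ∀ v < n, M u < M v → B u v

variable {F : Set (Set ℕ)} {n : ℕ} {L M M' : ℕ → ℕ} {B : ℕ → ℕ → Prop}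

theorem Refines.refl (n : ℕ) (L : ℕ → ℕ) : Refines n L L := fun _ _ _ _ h => h

theorem Refines.trans (h : Refines n L M) (h' : Refines n M M') : Refines n L M' :=
  fun u hu v hv huv => h' u hu v hv (h u hu v hv huv)

theorem Refines.eq_of_eq (h : Refines n L M) {u v : ℕ} (hu : u < n) (hv : v < n)
    (huv : M u = M v) : L u = L v := by
  rcases lt_trichotomy (L u) (L v) with h1 | h1 | h1
  · exact absurd huv (h u hu v hv h1).ne
  · exact h1
  · exact absurd huv (h v hv u hu h1).ne'

theorem mem_ties {p : ℕ × ℕ} : p ∈ ties n L ↔ (p.1 < n ∧ p.2 < n) ∧ L p.1 = L p.2 := by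
  simp [ties]

theorem Refines.ties_subset (h : Refines n L M) : ties n M ⊆ ties n L := by
  intro p hp
  rw [mem_ties] at hp ⊢
  exact ⟨hp.1, h.eq_of_eq hp.1.1 hp.1.2 hp.2⟩

theorem Refines.card_ties_le (h : Refines n L M) : (ties n M).card ≤ (ties n L).card :=
  card_le_card h.ties_subset

theorem Refines.card_ties_lt (h : Refines n L M) {u v : ℕ} (hu : u < n) (hv : v < n)
    (huv : L u = L v) (hne : M u ≠ M v) : (ties n M).card < (ties n L).card := by
  refine card_lt_card ⟨h.ties_subset, fun hs => hne ?_⟩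
  have : (u, v) ∈ ties n M := hs (mem_ties.2 ⟨⟨hu, hv⟩, huv⟩)
  exact (mem_ties.1 this).2

theorem card_ties_le (n : ℕ) (L : ℕ → ℕ) : (ties n L).card ≤ n * n :=
  (card_filter_le _ _).trans (by simp)

theorem card_ties_pos (hn : 1 ≤ n) : 0 < (ties n L).card :=
  card_pos.2 ⟨(0, 0), mem_ties.2 ⟨⟨hn, hn⟩, rfl⟩⟩

theorem shift_of_lt {b : ℕ} {T : ℕ → Prop} {v : ℕ} (h : M v < b) : shift n M b T v = M v :=
  if_neg fun h' => by omega

theorem shift_of_gt {b : ℕ} {T : ℕ → Prop} {v : ℕ} (hv : v < n) (h : b < M v) :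
    shift n M b T v = M v + 1 := if_pos ⟨hv, Or.inl h⟩

theorem shift_of_mem {b : ℕ} {T : ℕ → Prop} {v : ℕ} (hv : v < n) (h : b = M v) (hT : T v) :
    shift n M b T v = M v + 1 := if_pos ⟨hv, Or.inr ⟨h, hT⟩⟩

theorem shift_of_notMem {b : ℕ} {T : ℕ → Prop} {v : ℕ} (h : b = M v) (hT : ¬ T v) :
    shift n M b T v = M v := if_neg fun h' => by
      rcases h'.2 with h1 | h1
      · omega
      · exact hT h1.2

theorem le_shift {b : ℕ} {T : ℕ → Prop} {v : ℕ} : M v ≤ shift n M b T v := by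
  unfold shift; split_ifs <;> omega

theorem shift_le {b : ℕ} {T : ℕ → Prop} {v : ℕ} : shift n M b T v ≤ M v + 1 := by
  unfold shift; split_ifs <;> omega

theorem refines_shift {b : ℕ} {T : ℕ → Prop} : Refines n M (shift n M b T) := by
  intro u hu v hv huv
  rcases Nat.lt_or_ge b (M v) with h | h
  · rw [shift_of_gt hv h]
    exact (shift_le.trans_lt (by omega))
  · rw [shift_of_lt (v := u) (by omega)]
    exact huv.trans_le le_shift

theorem compatible_shift {b : ℕ} {T : ℕ → Prop} (h : Compatible n M B)
    (hb : ∀ u < n, ∀ v < n, M u = b → M v = b → ¬ T u → T v → B u v) :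
    Compatible n (shift n M b T) B := by
  intro u hu v hv huv
  rcases lt_trichotomy (M u) (M v) with h1 | h1 | h1
  · exact h u hu v hv h1
  · rcases lt_trichotomy b (M v) with h2 | h2 | h2
    · rw [shift_of_gt hu (by omega), shift_of_gt hv h2] at huv
      omega
    · by_cases hTu : T u
      · rw [shift_of_mem hu (by omega) hTu] at huv
        have := shift_le (n := n) (M := M) (b := b) (T := T) (v := v)
        omega
      · by_cases hTv : T v
        · exact hb u hu v hv (by omega) h2.symm hTu hTv
        · rw [shift_of_notMem (by omega) hTu, shift_of_notMem h2 hTv] at huv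
          omega
    · rw [shift_of_lt (by omega), shift_of_lt h2] at huv
      omega
  · exact absurd (refines_shift v hv u hu h1) (not_lt.2 huv.le)

theorem Step.refines (h : Step F n M M') : Refines n M M' := by
  cases h <;> exact refines_shift

theorem Step.card_ties_lt (h : Step F n M M') : (ties n M').card < (ties n M).card := by
  have hr := h.refines
  cases h with
  | lower hS hx hy hz hxS hyS hzS hxz hxy =>
    refine hr.card_ties_lt hx hy hxy.symm ?_
    rw [shift_of_mem hx rfl hxS, shift_of_notMem hxy.symm hyS]
    omega
  | upper hS hx hy hz hxS hyS hzS hxz hzy =>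
    refine hr.card_ties_lt hz hy hzy.symm ?_
    rw [shift_of_mem hy hzy.symm hyS, shift_of_notMem rfl (not_not.2 hzS)]
    omega

/-- The split is forced. If an element of `S` is ranked above the tie, an element of the tie outside
`S` must precede all elements of `S` in the tie, or it would lie between two elements of `S`. The
upper case is symmetric. -/
theorem Step.compatible (h : Step F n M M') (hB : IsOrder F n B) (hM : Compatible n M B) :
    Compatible n M' B := by
  cases h with
  | @lower S x y z hS hx hy hz hxS hyS hzS hxz hxy =>
    refine compatible_shift hM fun u hu v hv h1 h2 huS hvS => ?_
    refine (hB.total u hu v hv fun h => huS (h ▸ hvS)).resolve_right fun h => ?_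
    exact hB.convex S hS v hv u hu z hz hvS huS hzS ⟨h, hM u hu z hz (by omega)⟩
  | @upper S x y z hS hx hy hz hxS hyS hzS hxz hzy =>
    refine compatible_shift hM fun u hu v hv h1 h2 huS hvS => ?_
    refine (hB.total u hu v hv fun h => huS (h ▸ hvS)).resolve_right fun h => ?_
    exact hB.convex S hS x hx v hv u hu hxS hvS (not_not.1 huS) ⟨hM x hx v hv (by omega), h⟩

/-- `M'` is obtained from `M` by forced splittings of ties. -/
def Reaches (F : Set (Set ℕ)) (n : ℕ) : (ℕ → ℕ) → (ℕ → ℕ) → Prop :=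
  Relation.ReflTransGen (Step F n)

theorem Reaches.refines (h : Reaches F n M M') : Refines n M M' := by
  induction h with
  | refl => exact .refl _ _
  | tail _ hs ih => exact ih.trans hs.refines

theorem Reaches.compatible (h : Reaches F n M M') (hB : IsOrder F n B)
    (hM : Compatible n M B) : Compatible n M' B := by
  induction h with
  | refl => exact hM
  | tail _ hs ih => exact hs.compatible hB ih

theorem Stuck.mono (h : Stuck F n M) (hr : Refines n M M') : Stuck F n M' := by
  obtain ⟨S, hS, x, hx, y, hy, z, hz, hxS, hyS, hzS, h1, h2⟩ := h
  exact ⟨S, hS, x, hx, y, hy, z, hz, hxS, hyS, hzS, hr x hx y hy h1, hr y hy z hz h2⟩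

theorem Stuck.not_compatible (h : Stuck F n M) (hB : IsOrder F n B) : ¬ Compatible n M B := by
  obtain ⟨S, hS, x, hx, y, hy, z, hz, hxS, hyS, hzS, h1, h2⟩ := h
  exact fun hM => hB.convex S hS x hx y hy z hz hxS hyS hzS ⟨hM x hx y hy h1, hM y hy z hz h2⟩

/-- A search through part of the triples of elements, ending with the flag `ok'` and the ranking
`M'`, either found that the ranking `M` satisfies `C`, or it lowered the flag. -/
def Search (F : Set (Set ℕ)) (n : ℕ) (C : (ℕ → ℕ) → Prop) (ok : ℕ) (M : ℕ → ℕ) (ok' : ℕ)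
    (M' : ℕ → ℕ) : Prop :=
  Reaches F n M M' ∧ ((ok' = ok ∧ M' = M ∧ C M) ∨
    (ok' = 0 ∧ ((ties n M').card < (ties n M).card ∨ Stuck F n M')))

/-- Further refinement undoes neither the loss of a tie nor being stuck, so a lowered flag keeps its
meaning. -/
theorem Search.trans {C D : (ℕ → ℕ) → Prop} {ok ok' ok'' : ℕ} {M'' : ℕ → ℕ}
    (h : Search F n C ok M ok' M') (h' : Search F n D ok' M' ok'' M'') :
    Search F n (fun M => C M ∧ D M) ok M ok'' M'' := by
  obtain ⟨hr, h⟩ := h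
  obtain ⟨hr', h'⟩ := h'
  refine ⟨Relation.ReflTransGen.trans hr hr', ?_⟩
  rcases h' with ⟨rfl, rfl, hD⟩ | ⟨rfl, h'⟩
  · rcases h with ⟨rfl, rfl, hC⟩ | h
    · exact Or.inl ⟨rfl, rfl, hC, hD⟩
    · exact Or.inr h
  · right
    refine ⟨rfl, ?_⟩
    rcases h with ⟨rfl, rfl, hC⟩ | ⟨-, h | h⟩
    · exact h'
    · exact Or.inl (hr'.refines.card_ties_le.trans_lt h)
    · exact Or.inr (h.mono hr'.refines)

theorem Search.imp {C D : (ℕ → ℕ) → Prop} {ok ok' : ℕ} (h : Search F n C ok M ok' M')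
    (hCD : ∀ M, C M → D M) : Search F n D ok M ok' M' :=
  ⟨h.1, h.2.imp_left fun h => ⟨h.1, h.2.1, hCD _ h.2.2⟩⟩

theorem stable_congr (h : ∀ v < n, L v = M v) (hL : Stable F n L) : Stable F n M := by
  intro S hS x hx y hy z hz hxS hyS hzS hxz
  rw [← h x hx, ← h z hz] at *
  rw [← h y hy]
  exact hL S hS x hx y hy z hz hxS hyS hzS hxz

theorem refines_congr (h : ∀ v < n, L v = M v) : Refines n L M := by
  intro u hu v hv huv
  rwa [← h u hu, ← h v hv]

/-- Breaking the ties of a stable ranking by an order gives an order. -/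
theorem Stable.isOrder_lex {τ : ℕ → ℕ} (hL : Stable F n L) (hτ : Stable F n τ)
    (hinj : Set.InjOn τ (Set.Iio n)) :
    IsOrder F n fun u v => L u < L v ∨ (L u = L v ∧ τ u < τ v) := by
  constructor
  · intro u hu v hv hne
    have : τ u ≠ τ v := fun h => hne (hinj hu hv h)
    omega
  · rintro S hS x hx y hy z hz hxS hyS hzS ⟨h1, h2⟩
    -- For different ranks stability even excludes that `y` is level with `x` or `z`. Otherwise all
    -- three have the same rank, and `τ` decides.
    by_cases hxz : L x < L z
    · have := hL S hS x hx y hy z hz hxS hyS hzS hxz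
      omega
    · have := hτ S hS x hx y hy z hz hxS hyS hzS (by omega)
      omega

/-- `a` is the first one of several elements of the same rank. -/
def IsFirst (n : ℕ) (L τ : ℕ → ℕ) (a : ℕ) : Prop :=
  a < n ∧ (∃ u < n, u ≠ a ∧ L u = L a) ∧ ∀ u < n, L u = L a → u ≠ a → τ a < τ u

theorem exists_isFirst {τ : ℕ → ℕ} (hinj : Set.InjOn τ (Set.Iio n))
    (hL : ¬ Set.InjOn L (Set.Iio n)) : ∃ a, IsFirst n L τ a := by
  obtain ⟨u, hu, v, hv, huv, hne⟩ : ∃ u < n, ∃ v < n, L u = L v ∧ u ≠ v := by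
    simp only [Set.InjOn, Set.mem_Iio] at hL
    push Not at hL
    obtain ⟨u, hu, v, hv, h⟩ := hL
    exact ⟨u, hu, v, hv, h⟩
  obtain ⟨a, ha, hmin⟩ := exists_min_image {w ∈ range n | L w = L u} τ
    ⟨u, by simp [hu]⟩
  simp only [mem_filter, mem_range] at ha hmin
  refine ⟨a, ha.1, ?_, fun w hw hwa hne => ?_⟩
  · by_cases h : u = a
    · exact ⟨v, hv, fun h' => hne (h.trans h'.symm), by rw [ha.2, huv]⟩
    · exact ⟨u, hu, h, ha.2.symm⟩
  · refine lt_of_le_of_ne (hmin w ⟨hw, hwa.trans ha.2⟩) fun h => hne (hinj ha.1 hw h).symm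

/-- A refinement with no fewer ties has the same ties. -/
theorem IsFirst.congr {τ : ℕ → ℕ} {a : ℕ} (h : IsFirst n L τ a) (hLM : Refines n L M)
    (hc : (ties n L).card ≤ (ties n M).card) : IsFirst n M τ a := by
  have e : ties n M = ties n L := eq_of_subset_of_card_le hLM.ties_subset hc
  have e' : ∀ u < n, (M u = M a ↔ L u = L a) := by
    intro u hu
    have := Finset.ext_iff.1 e (u, a)
    simp only [mem_ties, hu, h.1, true_and] at this
    simpa using this
  obtain ⟨ha, ⟨u, hu, hne, hua⟩, hmin⟩ := h
  exact ⟨ha, ⟨u, hu, hne, (e' u hu).2 hua⟩, fun u hu hua => hmin u hu ((e' u hu).1 hua)⟩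

/-- The first element of a tie can be separated from the others. -/
theorem IsFirst.compatible {τ : ℕ → ℕ} {a : ℕ} (h : IsFirst n L τ a) :
    Compatible n (shift n L (L a) (· ≠ a))
      fun u v => L u < L v ∨ (L u = L v ∧ τ u < τ v) := by
  refine compatible_shift (fun u _ v _ huv => Or.inl huv) fun u hu v hv h1 h2 h3 h4 => ?_
  obtain rfl : u = a := not_not.1 h3
  exact Or.inr ⟨h2.symm, h.2.2 v hv h2 h4⟩

theorem IsFirst.card_ties_lt {τ : ℕ → ℕ} {a : ℕ} (h : IsFirst n L τ a) :
    (ties n (shift n L (L a) (· ≠ a))).card < (ties n L).card := by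
  obtain ⟨ha, ⟨u, hu, hne, hua⟩, -⟩ := h
  refine refines_shift.card_ties_lt hu ha hua ?_
  rw [shift_of_mem hu hua.symm hne, shift_of_notMem rfl (not_not.2 rfl)]
  omega

end ConsecutiveOrder

/-! ### Two-crossing orders as consecutive orders of the sets of dissenters -/

namespace Profile

variable {n m : ℕ}

/-- The voters who disagree with voter 0, who ranks `c` above `c'`. -/
def dissenters (rk : ℕ → ℕ → ℕ) (c c' : ℕ) : Set ℕ := {v | rk 0 c < rk 0 c' ∧ rk v c' < rk v c}

/-- The sets of voters who disagree with voter 0 on a pair of candidates. -/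
def dissent (m : ℕ) (rk : ℕ → ℕ → ℕ) : Set (Set ℕ) :=
  {S | ∃ c < m, ∃ c' < m, S = dissenters rk c c'}

/-- On a circle the dissenters for a pair of candidates form an arc that avoids voter 0. Cutting the
circle at voter 0 turns all these arcs into intervals. -/
theorem NoAlternation.exists_stable {P : Profile n m} {σ : Equiv.Perm (Fin n)}
    (hP : P.NoAlternation σ) {rk : ℕ → ℕ → ℕ} (hrk : ∀ (v : Fin n) (c : Fin m), rk v c = P.rank v c)
    (hn : 1 ≤ n) : ∃ τ : ℕ → ℕ, ConsecutiveOrder.Stable (dissent m rk) n τ ∧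
      Set.InjOn τ (Set.Iio n) := by
  set pos : ℕ → ℕ := fun v => if h : v < n then (σ.symm ⟨v, h⟩).val else 0 with hpos
  have hp : ∀ v (h : v < n), pos v = (σ.symm ⟨v, h⟩).val := fun v h => dif_pos h
  have hpn : ∀ v < n, pos v < n := fun v h => by rw [hp v h]; exact Fin.isLt _
  have hinj : ∀ u < n, ∀ v < n, pos u = pos v → u = v := by
    intro u hu v hv h
    rw [hp u hu, hp v hv] at h
    simpa using σ.symm.injective (Fin.ext h)
  -- The position counted cyclically, starting from voter 0.
  refine ⟨fun v => if pos 0 ≤ pos v then pos v else pos v + n, ?_, ?_⟩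
  · rintro S ⟨c, hc, c', hc', rfl⟩ x hx y hy z hz ⟨h0, hxS⟩ hyS ⟨-, hzS⟩ hxz
    have hyS : ¬ rk y c' < rk y c := fun h => hyS ⟨h0, h⟩
    have hpref : ∀ (v : ℕ) (hv : v < n) (a b : ℕ) (ha : a < m) (hb : b < m), rk v a < rk v b →
        P.prefers ⟨v, hv⟩ ⟨a, ha⟩ ⟨b, hb⟩ := by
      intro v hv a b ha hb h
      rw [hrk ⟨v, hv⟩ ⟨a, ha⟩, hrk ⟨v, hv⟩ ⟨b, hb⟩] at h
      exact rank_lt_iff.1 h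
    have p0 := hpref 0 hn c c' hc hc' h0
    have px := hpref x hx c' c hc' hc hxS
    have pz := hpref z hz c' c hc' hc hzS
    have hcc : (⟨c, hc⟩ : Fin m) ≠ ⟨c', hc'⟩ := fun h => P.irrefl _ _ (h ▸ p0)
    have py : P.prefers ⟨y, hy⟩ ⟨c, hc⟩ ⟨c', hc'⟩ := by
      refine (P.total _ _ _ hcc).resolve_right fun h => hyS ?_
      rw [hrk ⟨y, hy⟩ ⟨c, hc⟩, hrk ⟨y, hy⟩ ⟨c', hc'⟩]
      exact rank_lt_rank h
    have hne : ∀ u v, u < n → v < n → rk u c < rk u c' → rk v c' < rk v c → pos u ≠ pos v := by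
      intro u v hu hv h1 h2 h
      rw [hinj u hu v hv h] at h1
      omega
    have hyS' : rk y c < rk y c' := by
      rw [hrk ⟨y, hy⟩ ⟨c, hc⟩, hrk ⟨y, hy⟩ ⟨c', hc'⟩]
      exact rank_lt_rank py
    have n1 := hne 0 x hn hx h0 hxS
    have n2 := hne 0 z hn hz h0 hzS
    have n3 := hne y x hy hx hyS' hxS
    have n4 := hne y z hy hz hyS' hzS
    have alt : ∀ (a b : Fin m) (v₁ v₂ v₃ v₄ : ℕ) (h₁ : v₁ < n) (h₂ : v₂ < n) (h₃ : v₃ < n)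
        (h₄ : v₄ < n), P.prefers ⟨v₁, h₁⟩ a b → P.prefers ⟨v₂, h₂⟩ b a →
        P.prefers ⟨v₃, h₃⟩ a b → P.prefers ⟨v₄, h₄⟩ b a →
        ¬ (pos v₁ < pos v₂ ∧ pos v₂ < pos v₃ ∧ pos v₃ < pos v₄) := by
      rintro a b v₁ v₂ v₃ v₄ h₁ h₂ h₃ h₄ q₁ q₂ q₃ q₄ ⟨l₁, l₂, l₃⟩
      rw [hp _ h₁, hp _ h₂] at l₁
      rw [hp _ h₂, hp _ h₃] at l₂
      rw [hp _ h₃, hp _ h₄] at l₃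
      refine hP a b _ _ _ _ l₁ l₂ l₃ ?_ ?_ ?_ ?_ <;> simpa
    -- If `y` came between `x` and `z`, one of the four rotations of `0, x, y, z` would be an
    -- alternation in the original order.
    have a1 := alt _ _ 0 x y z hn hx hy hz p0 px py pz
    have a2 := alt _ _ x y z 0 hx hy hz hn px py pz p0
    have a3 := alt _ _ y z 0 x hy hz hn hx py pz p0 px
    have a4 := alt _ _ z 0 x y hz hn hx hy pz p0 px py
    have b0 := hpn 0 hn
    have bx := hpn x hx
    have by' := hpn y hy
    have bz := hpn z hz
    simp only at hxz ⊢
    split_ifs at hxz ⊢ <;> omega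
  · intro u hu v hv h
    have bu := hpn u hu
    have bv := hpn v hv
    refine hinj u hu v hv ?_
    simp only at h
    split_ifs at h <;> omega

/-- Among four alternating voters, the two who disagree with voter 0 enclose one who agrees: the
voters at `p₂, p₃, p₄` or those at `p₁, p₂, p₃`, according to the opinion of voter 0. -/
theorem noAlternation_of_stable {P : Profile n m} {rk : ℕ → ℕ → ℕ}
    (hrk : ∀ (v : Fin n) (c : Fin m), rk v c = P.rank v c) {L : ℕ → ℕ}
    (hL : ConsecutiveOrder.Stable (dissent m rk) n L) {σ : Equiv.Perm (Fin n)}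
    (hσ : ∀ p q : Fin n, p < q → L (σ p) < L (σ q)) : P.NoAlternation σ := by
  intro c c' p₁ p₂ p₃ p₄ h12 h23 h34 h1 h2 h3 h4
  have hn : 0 < n := p₁.pos
  have hne : c ≠ c' := by rintro rfl; exact P.irrefl _ _ h1
  have key : ∀ (a b : Fin m) (u v w : Fin n), P.prefers ⟨0, hn⟩ a b → P.prefers u b a →
      P.prefers v a b → P.prefers w b a → L u < L v → L v < L w → False := by
    intro a b u v w h0 hu hv hw huv hvw
    have h0' : rk 0 a < rk 0 b := by
      have := rank_lt_rank h0
      rwa [← hrk, ← hrk] at this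
    have := hL _ ⟨a, a.isLt, b, b.isLt, rfl⟩ u u.isLt v v.isLt w w.isLt ⟨h0', ?_⟩ ?_ ⟨h0', ?_⟩
      (huv.trans hvw)
    · omega
    · rw [hrk, hrk]; exact rank_lt_rank hu
    · rintro ⟨-, h⟩
      rw [hrk, hrk] at h
      exact P.asymm hv (rank_lt_iff.1 h)
    · rw [hrk, hrk]; exact rank_lt_rank hw
  rcases P.total ⟨0, hn⟩ c c' hne with h0 | h0
  · exact key c c' _ _ _ h0 h2 h3 h4 (hσ _ _ h23) (hσ _ _ h34)
  · exact key c' c _ _ _ h0 h1 h2 h3 (hσ _ _ h12) (hσ _ _ h23)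

end Profile

/-! # Finding a two-crossing order -/

namespace RAM

/-- Run `p` if all tests succeed. -/
def Program.guard : List Test → Program → Program
  | [], p => p
  | b :: bs, p => .ite b (Program.guard bs p) .skip

theorem Within.guard {p : Program} {s : Store} {T : ℕ} {Q : Store → Prop} :
    ∀ {bs : List Test}, ((∀ b ∈ bs, b.Holds s) → Within p s T Q) →
      (∀ b ∈ bs, ¬ b.Holds s → Q s) →
      Within (Program.guard bs p) s ((bs.map fun b => b.cost + 1).sum + T) Q
  | [], h, _ => (h (by simp)).mono (by simp)
  | b :: bs, h, h' => by
    refine (Within.ite (fun hb => Within.guard (bs := bs) (fun H => h ?_)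
      fun b' hb' => h' b' (List.mem_cons_of_mem _ hb')) fun hb =>
        Within.skip (h' b List.mem_cons_self hb)).mono ?_
    · simpa [hb] using H
    · simp only [List.map_cons, List.sum_cons]
      omega

end RAM

/-! ### Carrying out the forced splittings -/

namespace ConsecutiveOrder

open RAM Function Finset

variable {F : Set (Set ℕ)} {n m : ℕ} {s s' : Store}

/-- Raise the rank of element `var 29` in array 13. -/
def raise : Program := .nput 13 (.var 29) (.add (.get 13 (.var 29)) (.const 1))

/-- Raise the elements of rank above `var 30`, and those of this rank whose mark is `var 31`. -/
def shiftAll : Program :=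
  .for 29 (.var 0) <|
    .ite (.nle (.add (.var 30) (.const 1)) (.get 13 (.var 29))) raise <|
    .guard [.nle (.var 30) (.get 13 (.var 29)), .nle (.get 14 (.var 29)) (.var 31),
      .nle (.var 31) (.get 14 (.var 29))] raise

theorem shift_succ {M : ℕ → ℕ} {b : ℕ} {T : ℕ → Prop} {i : ℕ}
    (h : b < M i ∨ (b = M i ∧ T i)) :
    shift (i + 1) M b T = update (shift i M b T) i (M i + 1) := by
  funext v
  rcases eq_or_ne v i with rfl | hv
  · rw [update_self, shift, if_pos ⟨by omega, h⟩]
  · rw [update_of_ne hv, shift, shift]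
    split_ifs with h1 h2 h2
    · rfl
    · exact absurd ⟨by omega, h1.2⟩ h2
    · exact absurd ⟨by omega, h2.2⟩ h1
    · rfl

theorem shift_succ_of_not {M : ℕ → ℕ} {b : ℕ} {T : ℕ → Prop} {i : ℕ}
    (h : ¬ (b < M i ∨ (b = M i ∧ T i))) : shift (i + 1) M b T = shift i M b T := by
  funext v
  rcases eq_or_ne v i with rfl | hv
  · rw [shift, shift, if_neg fun h' => h h'.2, if_neg fun h' => h h'.2]
  · rw [shift, shift]
    split_ifs with h1 h2 h2
    · rfl
    · exact absurd ⟨by omega, h1.2⟩ h2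
    · exact absurd ⟨by omega, h2.2⟩ h1
    · rfl

/-- After `i` rounds the ranking is `shift i`, with only the elements below `i` treated; so the rank
of element `i` is still the old one when it is read. -/
theorem within_shiftAll {b q : ℕ} {T : ℕ → Prop} (hn : 1 ≤ n) (h0 : s.nvar 0 = n)
    (h30 : s.nvar 30 = b) (h31 : s.nvar 31 = q) (hT : ∀ v < n, s.narr 14 v = q ↔ T v) :
    Within shiftAll s (56 * (n * 1)) fun s' => s'.narr 13 = shift n (s.narr 13) b T := by
  refine Within.for (C := 40) n n 1 (fun i s' => s'.narr 13 = shift i (s.narr 13) b T) le_rfl hn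
    le_rfl (fun s' h => ?_) rfl ?_ ?_
  · rw [NExpr.eval, h.nvar 0 rfl, h0]
  · funext v
    simp [shift]
  · intro i hi s₁ h₁ hi₁ hI
    have e0 : s₁.narr 13 i = s.narr 13 i := by rw [hI]; simp [shift]
    have e30 : s₁.nvar 30 = b := (h₁.nvar 30 rfl).trans h30
    have e31 : s₁.nvar 31 = q := (h₁.nvar 31 rfl).trans h31
    have e14 := hT i hi
    rw [← h₁.narr 14 rfl] at e14
    have hraise : b < s.narr 13 i ∨ (b = s.narr 13 i ∧ T i) → Within raise s₁ 6 fun s'' =>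
        s''.narr 13 = shift (i + 1) (s.narr 13) b T := by
      intro h
      refine Within.nput ?_
      simp only [NExpr.eval, hi₁, e0, update_self]
      rw [shift_succ h, hI]
    refine Within.mono (Within.ite (fun h => hraise (Or.inl ?_)) fun h =>
      Within.guard (T := 6) (fun H => hraise (Or.inr ?_)) ?_) (by decide)
    · simp only [Test.Holds, NExpr.eval, hi₁, e0, e30] at h
      omega
    · simp only [Test.Holds, NExpr.eval, hi₁, e0, e30] at h
      simp [Test.Holds, NExpr.eval, hi₁, e0, e30, e31] at H
      exact ⟨by omega, e14.1 (by omega)⟩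
    · intro b' hb' hne
      change s₁.narr 13 = _
      rw [hI, shift_succ_of_not]
      rintro h1
      simp only [Test.Holds, NExpr.eval, hi₁, e0, e30] at h
      rcases h1 with h1 | ⟨h1, h2⟩
      · omega
      have := e14.2 h2
      simp only [List.mem_cons, List.not_mem_nil, or_false] at hb'
      rcases hb' with rfl | rfl | rfl <;>
        simp only [Test.Holds, NExpr.eval, hi₁, e0, e30, e31] at hne <;> omega

/-- A loop whose rounds search parts of the triples. -/
theorem within_for_search {x : ℕ} {e : NExpr} {p : Program} {K : ℕ} (N B X : ℕ)
    (C : ℕ → (ℕ → ℕ) → Prop) (hN : N ≤ B) (hB : 1 ≤ B) (hX : 1 ≤ X)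
    (he : ∀ s', Agree (Program.for x e p) s s' → e.eval s' = N) (hx : p.setsN x = false)
    (hx' : 32 ≠ x)
    (step : ∀ i < N, ∀ s', Agree (Program.for x e p) s s' → s'.nvar x = i →
      Within p s' (K * X) fun s'' =>
        Search F n (C i) (s'.nvar 32) (s'.narr 13) (s''.nvar 32) (s''.narr 13)) :
    Within (Program.for x e p) s ((K + 2 * e.cost + 14) * (B * X)) fun s' =>
      Search F n (fun M => ∀ i < N, C i M) (s.nvar 32) (s.narr 13) (s'.nvar 32) (s'.narr 13) := by
  refine Within.for N B X (fun i s' => Search F n (fun M => ∀ j < i, C j M) (s.nvar 32) (s.narr 13)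
    (s'.nvar 32) (s'.narr 13)) hN hB hX he hx ?_ ?_
  · refine ⟨.refl, Or.inl ⟨?_, rfl, fun j hj => absurd hj (Nat.not_lt_zero j)⟩⟩
    exact update_of_ne hx' _ _
  · intro i hi s₁ h₁ hi₁ hI
    refine (step i hi s₁ h₁ hi₁).conseq le_rfl fun s₂ _ h₂ => ?_
    simp only [update_of_ne hx']
    refine (hI.trans h₂).imp fun M hM j hj => ?_
    rcases Nat.lt_succ_iff_lt_or_eq.1 hj with h | rfl
    · exact hM.1 j h
    · exact hM.2

/-- Array 14 marks the elements of `S`. -/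
def Marks (n : ℕ) (S : Set ℕ) (s : Store) : Prop :=
  ∀ v < n, (v ∈ S ∧ s.narr 14 v = 1) ∨ (v ∉ S ∧ s.narr 14 v = 0)

/-- The condition of `Stable` for a set and three elements. -/
def Clean (S : Set ℕ) (x y z : ℕ) (M : ℕ → ℕ) : Prop :=
  x ∈ S → y ∉ S → z ∈ S → M x < M z → M y < M x ∨ M z < M y

/-- The rank of the element in a variable. -/
def rankOf (x : ℕ) : NExpr := .get 13 (.var x)

/-- Check the elements in the variables 26, 27, 28, and split a tie if need be. -/
def searchTriple : Program :=
  .guard [.nle (.const 1) (.get 14 (.var 26)), .nle (.get 14 (.var 27)) (.const 0),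
    .nle (.const 1) (.get 14 (.var 28)), .nle (.add (rankOf 26) (.const 1)) (rankOf 28),
    .nle (rankOf 26) (rankOf 27), .nle (rankOf 27) (rankOf 28)] <|
  .seq (.nset 32 (.const 0)) <|
  .ite (.nle (rankOf 27) (rankOf 26))
    (.seq (.nset 30 (rankOf 26)) (.seq (.nset 31 (.const 1)) shiftAll)) <|
  .guard [.nle (rankOf 28) (rankOf 27)]
    (.seq (.nset 30 (rankOf 28)) (.seq (.nset 31 (.const 0)) shiftAll))

/-- If `Clean` fails, the rank of `y` lies in the closed interval from the rank of `x` to that of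
`z`. At either end a `Step` is forced; strictly inside, the ranking is `Stuck`. The flag is lowered
in all three cases. -/
theorem within_searchTriple {S : Set ℕ} {x y z : ℕ} (hn : 1 ≤ n) (h0 : s.nvar 0 = n) (hS : S ∈ F)
    (hm : Marks n S s) (hx : x < n) (hy : y < n) (hz : z < n) (h26 : s.nvar 26 = x)
    (h27 : s.nvar 27 = y) (h28 : s.nvar 28 = z) :
    Within searchTriple s (180 * (n * 1)) fun s' =>
      Search F n (Clean S x y z) (s.nvar 32) (s.narr 13) (s'.nvar 32) (s'.narr 13) := by
  refine Within.mono (Within.guard (T := 2 + (5 + ((5 + 56 * (n * 1)) + (12 + 56 * (n * 1)))))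
    (fun H => ?_) fun b hb hne => ?_) ?_
  rotate_left 2
  · simp only [List.map_cons, List.map_nil, List.sum_cons, List.sum_nil, Test.cost, NExpr.cost,
      rankOf]
    omega
  · simp only [List.forall_mem_cons, Test.Holds, NExpr.eval, rankOf, h26, h27, h28] at H
    obtain ⟨H1, H2, H3, H4, H5, H6, -⟩ := H
    have hxS : x ∈ S := (hm x hx).elim (fun h => h.1) fun h => by omega
    have hyS : y ∉ S := (hm y hy).elim (fun h => by omega) fun h => h.1
    have hzS : z ∈ S := (hm z hz).elim (fun h => h.1) fun h => by omega
    have hstep : ∀ M', Step F n (s.narr 13) M' →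
        Search F n (Clean S x y z) (s.nvar 32) (s.narr 13) 0 M' := fun M' h =>
      ⟨.single h, Or.inr ⟨rfl, Or.inl h.card_ties_lt⟩⟩
    refine Within.seq (Within.nset (Within.ite (fun h => ?_) fun h => ?_))
    · simp [Test.Holds, NExpr.eval, rankOf, h26, h27] at h
      refine Within.mono (Within.seq (Within.nset (Within.seq (Within.nset ?_))))
        (T₁ := 3 + (2 + 56 * (n * 1))) (by omega)
      refine (within_shiftAll (T := (· ∈ S)) hn (by simpa using h0) rfl rfl ?_).conseq le_rfl ?_
      · intro v hv
        rcases hm v hv with ⟨h1, h2⟩ | ⟨h1, h2⟩ <;> simp [NExpr.eval, h1, h2]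
      · intro s' hag hs'
        rw [hag.nvar 32 rfl, hs']
        simp [NExpr.eval, rankOf, h26]
        exact hstep _ (.lower hS hx hy hz hxS hyS hzS (by omega) (by omega))
    · simp [Test.Holds, NExpr.eval, rankOf, h26, h27] at h
      refine Within.mono (Within.guard (T := 3 + (2 + 56 * (n * 1)))
        (fun h' => Within.seq (Within.nset (Within.seq (Within.nset ?_)))) fun b' hb' hne => ?_)
        (T₂ := 12 + 56 * (n * 1)) ?_
      rotate_left 2
      · simp only [List.map_cons, List.map_nil, List.sum_cons, List.sum_nil, Test.cost, NExpr.cost,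
          rankOf]
        omega
      · simp [Test.Holds, NExpr.eval, rankOf, h28, h27] at h'
        refine (within_shiftAll (T := (· ∉ S)) hn (by simpa using h0) rfl rfl ?_).conseq le_rfl ?_
        · intro v hv
          rcases hm v hv with ⟨h1, h2⟩ | ⟨h1, h2⟩ <;> simp [NExpr.eval, h1, h2]
        · intro s' hag hs'
          rw [hag.nvar 32 rfl, hs']
          simp [NExpr.eval, rankOf, h28]
          exact hstep _ (.upper hS hx hy hz hxS hyS hzS (by omega) (by omega))
      · simp only [List.mem_singleton] at hb'
        subst hb'
        simp [Test.Holds, NExpr.eval, rankOf, h28, h27] at hne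
        simp [NExpr.eval]
        exact ⟨.refl, Or.inr ⟨rfl, Or.inr
          ⟨S, hS, x, hx, y, hy, z, hz, hxS, hyS, hzS, h, hne⟩⟩⟩
  · refine ⟨.refl, Or.inl ⟨rfl, rfl, fun hxS hyS hzS hxz => ?_⟩⟩
    have e1 := (hm x hx).resolve_right fun h => h.1 hxS
    have e2 := (hm y hy).resolve_left fun h => hyS h.1
    have e3 := (hm z hz).resolve_right fun h => h.1 hzS
    simp only [List.mem_cons, List.not_mem_nil, or_false] at hb
    rcases hb with rfl | rfl | rfl | rfl | rfl | rfl <;>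
      simp only [Test.Holds, NExpr.eval, rankOf, h26, h27, h28] at hne <;> omega

/-- Check all triples of elements. -/
def searchTriples : Program := .for 26 (.var 0) <| .for 27 (.var 0) <| .for 28 (.var 0) searchTriple

theorem within_searchTriples {S : Set ℕ} (hn : 1 ≤ n) (h0 : s.nvar 0 = n) (hS : S ∈ F)
    (hm : Marks n S s) :
    Within searchTriples s (228 * (n * (n * (n * (n * 1))))) fun s' =>
      Search F n (fun M => ∀ x < n, ∀ y < n, ∀ z < n, Clean S x y z M)
        (s.nvar 32) (s.narr 13) (s'.nvar 32) (s'.narr 13) := by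
  have p1 : 1 ≤ n * 1 := by omega
  have p2 : 1 ≤ n * (n * 1) := Nat.mul_pos hn p1
  have p3 : 1 ≤ n * (n * (n * 1)) := Nat.mul_pos hn p2
  refine within_for_search (K := 212) n n _ _ le_rfl hn p3 (fun s' h => ?_) rfl (by decide) ?_
  · rw [NExpr.eval, h.nvar 0 rfl, h0]
  intro x hx s₁ g₁ hx₁
  refine within_for_search (K := 196) n n _ _ le_rfl hn p2 (fun s' h => ?_) rfl (by decide) ?_
  · rw [NExpr.eval, h.nvar 0 rfl, g₁.nvar 0 rfl, h0]
  intro y hy s₂ g₂ hy₂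
  refine within_for_search (K := 180) n n _ _ le_rfl hn p1 (fun s' h => ?_) rfl (by decide) ?_
  · rw [NExpr.eval, h.nvar 0 rfl, g₂.nvar 0 rfl, g₁.nvar 0 rfl, h0]
  intro z hz s₃ g₃ hz₃
  refine within_searchTriple hn ?_ hS ?_ hx hy hz ?_ ?_ hz₃
  · rw [g₃.nvar 0 rfl, g₂.nvar 0 rfl, g₁.nvar 0 rfl, h0]
  · intro v hv
    rw [g₃.narr 14 rfl, g₂.narr 14 rfl, g₁.narr 14 rfl]
    exact hm v hv
  · rw [g₃.nvar 26 rfl, g₂.nvar 26 rfl, hx₁]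
  · rw [g₃.nvar 27 rfl, hy₂]

/-- The input and the multiples of `m` are in memory. -/
structure HasRanks (n m : ℕ) (rk : ℕ → ℕ → ℕ) (s : Store) : Prop where
  n_eq : s.nvar 0 = n
  m_eq : s.nvar 1 = m
  sq_eq : s.nvar 20 = n * n
  mul_m : ∀ v ≤ n, s.narr 3 v = v * m
  rank_eq : ∀ v c, s.narr 0 (v * m + c) = rk v c

/-- `p` leaves the data of `HasRanks` alone. -/
abbrev KeepsRanks (p : Program) : Prop :=
  p.setsN 0 = false ∧ p.setsN 1 = false ∧ p.setsN 20 = false ∧ p.putsN 0 = false ∧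
    p.putsN 3 = false

theorem HasRanks.agree {rk : ℕ → ℕ → ℕ} (h : HasRanks n m rk s) {p : Program} (ha : Agree p s s')
    (hp : KeepsRanks p) : HasRanks n m rk s' := by
  obtain ⟨p0, p1, p20, q0, q3⟩ := hp
  constructor
  · rw [ha.nvar _ p0, h.n_eq]
  · rw [ha.nvar _ p1, h.m_eq]
  · rw [ha.nvar _ p20, h.sq_eq]
  · rw [ha.narr _ q3]; exact h.mul_m
  · rw [ha.narr _ q0]; exact h.rank_eq

/-- Mark the dissenters for the candidates in the variables 24 and 25. -/
def markDissenters : Program :=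
  .for 33 (.var 0) <|
    .ite (.nle (.add (.get 0 (.var 24)) (.const 1)) (.get 0 (.var 25)))
      (.ite (.nle (.add (.get 0 (.add (.get 3 (.var 33)) (.var 25))) (.const 1))
          (.get 0 (.add (.get 3 (.var 33)) (.var 24))))
        (.nput 14 (.var 33) (.const 1)) (.nput 14 (.var 33) (.const 0)))
      (.nput 14 (.var 33) (.const 0))

theorem within_markDissenters {rk : ℕ → ℕ → ℕ} {c c' : ℕ} (hn : 1 ≤ n) (hs : HasRanks n m rk s)
    (hc : s.nvar 24 = c) (hc' : s.nvar 25 = c') :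
    Within markDissenters s (56 * (n * 1)) (Marks n (Profile.dissenters rk c c')) := by
  refine Within.for (C := 40) n n 1 (fun i s' => Marks i (Profile.dissenters rk c c') s')
    le_rfl hn le_rfl (fun s' h => ?_) rfl (fun v hv => absurd hv (Nat.not_lt_zero v)) ?_
  · rw [NExpr.eval, h.nvar 0 rfl, hs.n_eq]
  intro i hi s₁ h₁ hi₁ hI
  have hs₁ := hs.agree h₁ (by decide)
  have hc₁ := (h₁.nvar 24 rfl).trans hc
  have hc₁' := (h₁.nvar 25 rfl).trans hc'
  have r0 : ∀ c, s₁.narr 0 c = rk 0 c := fun c => by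
    rw [← hs₁.rank_eq 0 c, zero_mul, zero_add]
  have put : ∀ q, (i ∈ Profile.dissenters rk c c' ∧ q = 1) ∨
      (i ∉ Profile.dissenters rk c c' ∧ q = 0) →
      Within (.nput 14 (.var 33) (.const q)) s₁ 3 fun s'' =>
        Marks (i + 1) (Profile.dissenters rk c c')
          { s'' with nvar := update s''.nvar 33 (i + 1) } := by
    intro q hq
    refine Within.nput fun v hv => ?_
    simp only [NExpr.eval, hi₁, update_self]
    rcases Nat.lt_succ_iff_lt_or_eq.1 hv with h | rfl
    · rw [update_of_ne h.ne]
      exact hI v h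
    · rw [update_self]
      exact hq
  refine Within.mono (Within.ite (fun h => Within.ite (fun h' => put 1 (Or.inl ⟨?_, rfl⟩))
    fun h' => put 0 (Or.inr ⟨?_, rfl⟩)) fun h => put 0 (Or.inr ⟨?_, rfl⟩)) (by decide)
  all_goals
    simp only [Test.Holds, NExpr.eval, hc₁, hc₁', r0] at h
    try simp only [Test.Holds, NExpr.eval, hc₁, hc₁', hi₁, hs₁.mul_m i hi.le, hs₁.rank_eq] at h'
    simp only [Profile.dissenters, Set.mem_ofPred_eq]
    omega

/-- Check all triples of elements for all sets of dissenters. -/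
def searchAll : Program :=
  .for 24 (.var 1) <| .for 25 (.var 1) <| .seq markDissenters searchTriples

/-- A pair that voter 0 ranks the other way gives the empty set, so the loops may run over all
ordered pairs. -/
theorem within_searchAll {rk : ℕ → ℕ → ℕ} (hn : 1 ≤ n) (hm : 1 ≤ m) (hs : HasRanks n m rk s) :
    Within searchAll s (316 * (m * (m * (n * (n * (n * (n * 1))))))) fun s' =>
      Search (Profile.dissent m rk) n (Stable (Profile.dissent m rk) n)
        (s.nvar 32) (s.narr 13) (s'.nvar 32) (s'.narr 13) := by
  have p1 : 1 ≤ n * (n * (n * 1)) := Nat.mul_pos hn (Nat.mul_pos hn (by omega))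
  have p2 : 1 ≤ n * (n * (n * (n * 1))) := Nat.mul_pos hn p1
  have p3 : 1 ≤ m * (n * (n * (n * (n * 1)))) := Nat.mul_pos hm p2
  refine (within_for_search (K := 300) m m (m * (n * (n * (n * (n * 1)))))
    (fun c M => ∀ c' < m, ∀ x < n, ∀ y < n, ∀ z < n, Clean (Profile.dissenters rk c c') x y z M)
    le_rfl hm p3 (fun s' h => ?_) rfl (by decide) ?_).conseq le_rfl fun s' _ h => h.imp ?_
  · rw [NExpr.eval, h.nvar 1 rfl, hs.m_eq]
  · intro c hc s₁ g₁ hc₁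
    refine within_for_search (K := 284) m m _ _ le_rfl hm p2 (fun s' h => ?_) rfl (by decide) ?_
    · rw [NExpr.eval, h.nvar 1 rfl, g₁.nvar 1 rfl, hs.m_eq]
    intro c' hc' s₂ g₂ hc₂
    have hs₂ := (hs.agree g₁ (by decide)).agree g₂ (by decide)
    refine (Within.seq ((within_markDissenters hn hs₂ (by rw [g₂.nvar 24 rfl, hc₁]) hc₂).conseq
      le_rfl fun s₃ g₃ hM => ?_)).mono (T₁ := 56 * (n * 1) + 228 * (n * (n * (n * (n * 1))))) ?_
    · rw [← g₃.nvar 32 rfl, ← g₃.narr 13 rfl]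
      exact within_searchTriples hn ((g₃.nvar 0 rfl).trans hs₂.n_eq) ⟨c, hc, c', hc', rfl⟩ hM
    · have : n * 1 ≤ n * (n * (n * (n * 1))) := Nat.mul_le_mul_left _ p1
      omega
  · rintro M hM S ⟨c, hc, c', hc', rfl⟩
    exact hM c hc c' hc'

/-- Split ties as long as some split is forced. -/
def splitTies : Program :=
  .seq (.nset 32 (.const 0)) <|
    .for 23 (.var 20) <| .guard [.nle (.var 32) (.const 0)] <|
      .seq (.nset 32 (.const 1)) searchAll

/-- A pass that lowers the flag loses a tie or is stuck. There are at most `n * n` ties and, as the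
pairs `(v, v)` count, always at least one; so after `n * n` passes the flag is up and the ranking
stable, or it is stuck. -/
theorem within_splitTies {rk : ℕ → ℕ → ℕ} (hn : 1 ≤ n) (hm : 1 ≤ m) (hs : HasRanks n m rk s) :
    Within splitTies s (340 * (n * n * (m * (m * (n * (n * (n * (n * 1)))))))) fun s' =>
      Reaches (Profile.dissent m rk) n (s.narr 13) (s'.narr 13) ∧
        ((s'.nvar 32 = 1 ∧ Stable (Profile.dissent m rk) n (s'.narr 13)) ∨
          (s'.nvar 32 = 0 ∧ Stuck (Profile.dissent m rk) n (s'.narr 13))) := by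
  have p1 : 1 ≤ m * (m * (n * (n * (n * (n * 1))))) :=
    Nat.mul_pos hm (Nat.mul_pos hm (Nat.mul_pos hn (Nat.mul_pos hn (Nat.mul_pos hn (by omega)))))
  have p2 : 1 ≤ n * n := Nat.mul_pos hn hn
  have p3 := Nat.mul_pos p2 p1
  refine (Within.seq (Within.nset ?_)).mono
    (T₁ := 2 + 338 * (n * n * (m * (m * (n * (n * (n * (n * 1)))))))) (by omega)
  refine (Within.for (C := 322) (n * n) (n * n) (m * (m * (n * (n * (n * (n * 1))))))
    (fun i s' => Reaches (Profile.dissent m rk) n (s.narr 13) (s'.narr 13) ∧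
      ((s'.nvar 32 = 1 ∧ Stable (Profile.dissent m rk) n (s'.narr 13)) ∨
        (s'.nvar 32 = 0 ∧ ((ties n (s'.narr 13)).card + i ≤ n * n ∨
          Stuck (Profile.dissent m rk) n (s'.narr 13)))))
    le_rfl p2 p1 (fun s' h => ?_) rfl ?_ ?_).conseq le_rfl fun s' _ h => ?_
  · rw [NExpr.eval, h.nvar 20 rfl]
    simpa using hs.sq_eq
  · exact ⟨.refl, Or.inr ⟨by simp [NExpr.eval], Or.inl (card_ties_le n _)⟩⟩
  · rintro i hi s₁ g₁ hi₁ ⟨hr, hI⟩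
    have hs₁ : HasRanks n m rk s₁ :=
      HasRanks.agree (s := { s with nvar := update s.nvar 32 0 })
        ⟨hs.n_eq, hs.m_eq, hs.sq_eq, hs.mul_m, hs.rank_eq⟩ g₁ (by decide)
    refine Within.mono (Within.guard (T := 2 + 316 * (m * (m * (n * (n * (n * (n * 1)))))))
      (fun H => Within.seq (Within.nset ?_)) fun b hb hne => ?_) ?_
    rotate_left 2
    · simp only [List.map_cons, List.map_nil, List.sum_cons, List.sum_nil, Test.cost, NExpr.cost]
      omega
    · have h32 : s₁.nvar 32 = 0 := by simpa [Test.Holds, NExpr.eval] using H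
      refine (within_searchAll (s := { s₁ with nvar := update s₁.nvar 32 1 }) hn hm (HasRanks.mk hs₁.n_eq hs₁.m_eq hs₁.sq_eq hs₁.mul_m
        hs₁.rank_eq)).conseq le_rfl fun s₂ _ h₂ => ?_
      simp at h₂ ⊢
      obtain ⟨hr₂, h₂⟩ := h₂
      refine ⟨Relation.ReflTransGen.trans hr hr₂, ?_⟩
      rcases h₂ with ⟨e1, e2, h3⟩ | ⟨e1, h3⟩
      · left
        exact ⟨e1, e2 ▸ h3⟩
      · right
        refine ⟨e1, ?_⟩
        rcases hI with ⟨e3, -⟩ | ⟨-, h4⟩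
        · omega
        · rcases h3 with h3 | h3
          · rcases h4 with h4 | h4
            · left; omega
            · exact Or.inr (h4.mono hr₂.refines)
          · exact Or.inr h3
    · simp only [List.mem_singleton] at hb
      subst hb
      simp [Test.Holds, NExpr.eval] at hne
      simp
      exact ⟨hr, Or.inl (hI.resolve_right fun h => hne h.1)⟩
  · refine ⟨h.1, h.2.imp_right fun h => ⟨h.1, h.2.resolve_left fun h' => ?_⟩⟩
    have := card_ties_pos (L := s'.narr 13) hn
    omega

end ConsecutiveOrder

/-! ### Breaking all ties and listing the voters -/

namespace ConsecutiveOrder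

open RAM Function Finset

variable {n m : ℕ} {s s' : Store}

/-- Copy the ranks from array `a` to array `b`. -/
def copyRanks (a b : ℕ) : Program := .for 33 (.var 0) (.nput b (.var 33) (.get a (.var 33)))

theorem within_copyRanks {a b : ℕ} (hab : a ≠ b) (hn : 1 ≤ n) (h0 : s.nvar 0 = n) :
    Within (copyRanks a b) s (26 * (n * 1)) fun s' => ∀ v < n, s'.narr b v = s.narr a v := by
  refine Within.for (C := 10) n n 1 (fun i s' => ∀ v < i, s'.narr b v = s.narr a v) le_rfl hn
    le_rfl (fun s' h => ?_) rfl (fun v hv => absurd hv (Nat.not_lt_zero v)) ?_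
  · rw [NExpr.eval, h.nvar 0 rfl, h0]
  intro i hi s₁ h₁ hi₁ hI
  refine Within.mono (Within.nput fun v hv => ?_) (T₁ := 4) (by omega)
  have ha : s₁.narr a = s.narr a := h₁.narr a (by
    simp only [Program.for, Program.putsN, Bool.or_false, Bool.false_or, beq_eq_false_iff_ne]
    exact hab.symm)
  simp only [NExpr.eval, hi₁, update_self, ha]
  rcases Nat.lt_succ_iff_lt_or_eq.1 hv with h | rfl
  · rw [update_of_ne h.ne, hI v h]
  · rw [update_self]

/-- Mark all elements. -/
def markAll : Program := .for 33 (.var 0) (.nput 14 (.var 33) (.const 1))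

theorem within_markAll (hn : 1 ≤ n) (h0 : s.nvar 0 = n) :
    Within markAll s (26 * (n * 1)) fun s' => ∀ v < n, s'.narr 14 v = 1 := by
  refine Within.for (C := 10) n n 1 (fun i s' => ∀ v < i, s'.narr 14 v = 1) le_rfl hn
    le_rfl (fun s' h => ?_) rfl (fun v hv => absurd hv (Nat.not_lt_zero v)) ?_
  · rw [NExpr.eval, h.nvar 0 rfl, h0]
  intro i hi s₁ h₁ hi₁ hI
  refine Within.mono (Within.nput fun v hv => ?_) (T₁ := 3) (by omega)
  simp only [NExpr.eval, hi₁, update_self]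
  rcases Nat.lt_succ_iff_lt_or_eq.1 hv with h | rfl
  · rw [update_of_ne h.ne, hI v h]
  · rw [update_self]

/-- Separate the element `var 22` from those of the same rank in array 13. -/
def separate : Program :=
  .seq markAll <|
  .seq (.nput 14 (.var 22) (.const 0)) <|
  .seq (.nset 30 (.get 13 (.var 22))) <|
  .seq (.nset 31 (.const 1)) shiftAll

theorem within_separate {a : ℕ} (hn : 1 ≤ n) (h0 : s.nvar 0 = n) (h22 : s.nvar 22 = a) :
    Within separate s (8 + 82 * n) fun s' =>
      s'.narr 13 = shift n (s.narr 13) (s.narr 13 a) (· ≠ a) := by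
  refine Within.mono (Within.seq ((within_markAll hn h0).conseq le_rfl fun s₁ g₁ h₁ =>
    Within.seq (T₁ := 3) (T₂ := 3 + (2 + 56 * (n * 1)))
      (Within.nput (Within.seq (Within.nset (Within.seq (Within.nset ?_))))))) (by omega)
  have e22 : s₁.nvar 22 = a := (g₁.nvar 22 rfl).trans h22
  refine Within.conseq (within_shiftAll (T := (· ≠ a)) hn
    (by simpa using (g₁.nvar 0 rfl).trans h0) rfl rfl ?_) le_rfl ?_
  · intro v hv
    rcases eq_or_ne v a with rfl | hva
    · simp [NExpr.eval, e22]
    · simp [NExpr.eval, e22, hva, h₁ v hv]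
  · intro s' _ hs'
    rw [hs']
    simp [NExpr.eval, e22, g₁.narr 13 rfl]

/-- Try to extend the ranking in array 12 by separating element `var 22` from its ties. -/
def tryElement : Program :=
  .seq (copyRanks 12 13) <| .seq separate <| .seq splitTies <|
    .guard [.nle (.const 1) (.var 32)] (copyRanks 13 12)

/-- The trial runs on a copy in array 13 and is adopted only if it ends stable. It cannot fail for
the first element of a tie: the order by rank and then by `τ` is compatible with the separation,
hence with all forced splits, whereas no such order is compatible with a stuck ranking. The program
does not know `τ`; it serves the proof only. -/
theorem within_tryElement {rk : ℕ → ℕ → ℕ} {a : ℕ} {τ : ℕ → ℕ} (hn : 1 ≤ n) (hm : 1 ≤ m)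
    (hs : HasRanks n m rk s) (h22 : s.nvar 22 = a) (hτ : Stable (Profile.dissent m rk) n τ)
    (hinj : Set.InjOn τ (Set.Iio n)) (hL : Stable (Profile.dissent m rk) n (s.narr 12)) :
    Within tryElement s (490 * (n * n * (m * (m * (n * (n * (n * (n * 1)))))))) fun s' =>
      Stable (Profile.dissent m rk) n (s'.narr 12) ∧ Refines n (s.narr 12) (s'.narr 12) ∧
        (IsFirst n (s.narr 12) τ a →
          (ties n (s'.narr 12)).card < (ties n (s.narr 12)).card) := by
  set Y := n * n * (m * (m * (n * (n * (n * (n * 1)))))) with hY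
  have hnY : n ≤ Y := by
    have : 1 ≤ n * (m * (m * (n * (n * (n * (n * 1)))))) := by
      repeat' apply Nat.mul_pos
      all_goals omega
    calc n ≤ n * (n * (m * (m * (n * (n * (n * (n * 1))))))) := Nat.le_mul_of_pos_right _ this
      _ = Y := by rw [hY]; ring
  refine Within.mono (T₁ := 26 * (n * 1) + ((8 + 82 * n) + (340 * Y + (4 + 26 * (n * 1))))) ?_
    (by omega)
  refine Within.seq ((within_copyRanks (by decide) hn hs.n_eq).conseq le_rfl fun s₁ g₁ h₁ => ?_)
  refine Within.seq ((within_separate hn ((g₁.nvar 0 rfl).trans hs.n_eq)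
    ((g₁.nvar 22 rfl).trans h22)).conseq le_rfl fun s₂ g₂ h₂ => ?_)
  have hs₂ := (hs.agree g₁ (by decide)).agree g₂ (by decide)
  refine Within.seq ((within_splitTies hn hm hs₂).conseq le_rfl fun s₃ g₃ ⟨hr, h₃⟩ => ?_)
  have e12 : s₃.narr 12 = s.narr 12 := by rw [g₃.narr 12 rfl, g₂.narr 12 rfl, g₁.narr 12 rfl]
  have hLM : Refines n (s.narr 12) (s₁.narr 13) := refines_congr fun v hv => (h₁ v hv).symm
  have hML : Refines n (s₁.narr 13) (s.narr 12) := refines_congr h₁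
  have hL₁ : Stable (Profile.dissent m rk) n (s₁.narr 13) :=
    stable_congr (fun v hv => (h₁ v hv).symm) hL
  have hr' : Refines n (s₁.narr 13) (s₃.narr 13) := by
    refine Refines.trans ?_ hr.refines
    rw [h₂]
    exact refines_shift
  refine (Within.guard (T := 26 * (n * 1)) (fun H => ?_) fun b hb hne => ?_).mono (by
    simp only [List.map_cons, List.map_nil, List.sum_cons, List.sum_nil, Test.cost, NExpr.cost]
    omega)
  · have h32 : 1 ≤ s₃.nvar 32 := by simpa [Test.Holds, NExpr.eval] using H
    have hst := (h₃.resolve_right fun h => by omega).2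
    refine (within_copyRanks (by decide) hn ((g₃.nvar 0 rfl).trans hs₂.n_eq)).conseq le_rfl
      fun s' _ h' => ?_
    have h13 : Refines n (s₃.narr 13) (s'.narr 12) := refines_congr fun v hv => (h' v hv).symm
    refine ⟨stable_congr (fun v hv => (h' v hv).symm) hst, (hLM.trans hr').trans h13, fun hf => ?_⟩
    have hf₁ : IsFirst n (s₁.narr 13) τ a := hf.congr hLM hML.card_ties_le
    have hlt := hf₁.card_ties_lt
    rw [← h₂] at hlt
    exact ((hr.refines.trans h13).card_ties_le.trans_lt hlt).trans_le hLM.card_ties_le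
  · simp only [List.mem_singleton] at hb
    subst hb
    have h32 : s₃.nvar 32 = 0 := by simpa [Test.Holds, NExpr.eval] using hne
    have hst := (h₃.resolve_left fun h => by omega).2
    rw [e12]
    refine ⟨hL, .refl _ _, fun hf => ?_⟩
    have hf₁ : IsFirst n (s₁.narr 13) τ a := hf.congr hLM hML.card_ties_le
    have hB := hL₁.isOrder_lex hτ hinj
    refine absurd (hr.compatible hB ?_) (hst.not_compatible hB)
    rw [h₂]
    exact hf₁.compatible

/-- Find a ranking without ties in which all sets of dissenters are consecutive. -/
def findRanking : Program := .for 21 (.var 20) <| .for 22 (.var 0) tryElement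

/-- As long as ties remain, each outer round meets an element that is first in its tie, unless a tie
was already lost in that round. So every outer round loses a tie, and `n * n` rounds suffice. -/
theorem within_findRanking {rk : ℕ → ℕ → ℕ} {τ : ℕ → ℕ} (hn : 1 ≤ n) (hm : 1 ≤ m)
    (hs : HasRanks n m rk s) (hτ : Stable (Profile.dissent m rk) n τ)
    (hinj : Set.InjOn τ (Set.Iio n)) (hL : s.narr 12 = fun _ => 0) :
    Within findRanking s
      (522 * (n * n * (n * (n * n * (m * (m * (n * (n * (n * (n * 1)))))))))) fun s' =>
      Stable (Profile.dissent m rk) n (s'.narr 12) ∧ Set.InjOn (s'.narr 12) (Set.Iio n) := by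
  set Y := n * n * (m * (m * (n * (n * (n * (n * 1)))))) with hY
  have hY1 : 1 ≤ Y := by
    rw [hY]
    repeat' apply Nat.mul_pos
    all_goals omega
  have p2 : 1 ≤ n * n := Nat.mul_pos hn hn
  refine (Within.for (C := 506) (n * n) (n * n) (n * Y) (fun i s' =>
    Stable (Profile.dissent m rk) n (s'.narr 12) ∧
      ((ties n (s'.narr 12)).card + i ≤ n * n ∨ Set.InjOn (s'.narr 12) (Set.Iio n)))
    le_rfl p2 (Nat.mul_pos hn hY1) (fun s' h => ?_) rfl ?_ ?_).conseq le_rfl fun s' _ h => ?_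
  · rw [NExpr.eval, h.nvar 20 rfl, hs.sq_eq]
  · refine ⟨?_, Or.inl (card_ties_le n _)⟩
    change Stable _ _ (s.narr 12)
    rw [hL]
    exact fun S hS x _ y _ z _ _ _ _ h => absurd h (lt_irrefl _)
  · rintro i hi s₁ g₁ - ⟨hS₁, h₁⟩
    have hs₁ := hs.agree g₁ (by decide)
    refine (Within.for (C := 490) n n Y (fun j s' =>
      Stable (Profile.dissent m rk) n (s'.narr 12) ∧ Refines n (s₁.narr 12) (s'.narr 12) ∧
        ((ties n (s'.narr 12)).card < (ties n (s₁.narr 12)).card ∨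
          ∀ a < j, ¬ IsFirst n (s₁.narr 12) τ a))
      le_rfl hn hY1 (fun s' h => ?_) rfl ?_ ?_).conseq le_rfl fun s' _ h => ?_
    · rw [NExpr.eval, h.nvar 0 rfl, hs₁.n_eq]
    · exact ⟨hS₁, .refl _ _, Or.inr fun a ha => absurd ha (Nat.not_lt_zero a)⟩
    · rintro a ha s₂ g₂ h22 ⟨hS₂, hr₂, h₂⟩
      refine (within_tryElement hn hm (hs₁.agree g₂ (by decide)) h22 hτ hinj hS₂).conseq le_rfl ?_
      rintro s₃ - ⟨hS₃, hr₃, h₃⟩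
      refine ⟨hS₃, hr₂.trans hr₃, ?_⟩
      rcases h₂ with h₂ | h₂
      · exact Or.inl (hr₃.card_ties_le.trans_lt h₂)
      · by_cases hlt : (ties n (s₂.narr 12)).card < (ties n (s₁.narr 12)).card
        · exact Or.inl (hr₃.card_ties_le.trans_lt hlt)
        by_cases hf : IsFirst n (s₁.narr 12) τ a
        · exact Or.inl ((h₃ (hf.congr hr₂ (not_lt.1 hlt))).trans_le hr₂.card_ties_le)
        · refine Or.inr fun a' ha' => ?_
          rcases Nat.lt_succ_iff_lt_or_eq.1 ha' with h | rfl
          · exact h₂ a' h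
          · exact hf
    · obtain ⟨hS', hr', h'⟩ := h
      refine ⟨hS', ?_⟩
      by_cases hi₁ : Set.InjOn (s₁.narr 12) (Set.Iio n)
      · exact Or.inr fun u hu v hv huv => hi₁ hu hv (hr'.eq_of_eq hu hv huv)
      · left
        obtain ⟨a, ha⟩ := exists_isFirst hinj hi₁
        have h' := h'.resolve_right fun h => h a ha.1 ha
        have := h₁.resolve_right hi₁
        change (ties n (s'.narr 12)).card + _ ≤ _
        omega
  · refine ⟨h.1, h.2.resolve_left fun h' => ?_⟩
    have := card_ties_pos (L := s'.narr 12) hn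
    omega

/-- The number of elements of lower rank. -/
def place (n : ℕ) (L : ℕ → ℕ) (v : ℕ) : ℕ := #{u ∈ range n | L u < L v}

theorem place_lt {L : ℕ → ℕ} {v : ℕ} (hv : v < n) : place n L v < n := by
  refine lt_of_lt_of_eq (card_lt_card ?_) (card_range n)
  refine ⟨filter_subset _ _, fun h => ?_⟩
  have := h (mem_range.2 hv)
  simp at this

theorem place_lt_place {L : ℕ → ℕ} {u v : ℕ} (hu : u < n) (h : L u < L v) :
    place n L u < place n L v := by
  refine card_lt_card ⟨fun w hw => ?_, fun hs => ?_⟩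
  · simp only [mem_filter] at hw ⊢
    exact ⟨hw.1, hw.2.trans h⟩
  · have : u ∈ ({w ∈ range n | L w < L u} : Finset ℕ) := hs (by simp [hu, h])
    simp at this

theorem place_inj {L : ℕ → ℕ} (hL : Set.InjOn L (Set.Iio n)) {u v : ℕ} (hu : u < n) (hv : v < n)
    (h : place n L u = place n L v) : u = v := by
  refine hL hu hv ?_
  rcases lt_trichotomy (L u) (L v) with h1 | h1 | h1
  · exact absurd h (place_lt_place hu h1).ne
  · exact h1
  · exact absurd h (place_lt_place hv h1).ne'

/-- List the elements in array 1 by increasing rank. -/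
def listByRank : Program :=
  .for 33 (.var 0) <|
  .seq (.nset 34 (.const 0)) <|
  .seq (.for 35 (.var 0) (.guard [.nle (.add (.get 12 (.var 35)) (.const 1)) (.get 12 (.var 33))]
    (.nset 34 (.add (.var 34) (.const 1))))) <|
  .nput 1 (.var 34) (.var 33)

theorem within_listByRank (hn : 1 ≤ n) (h0 : s.nvar 0 = n)
    (hL : Set.InjOn (s.narr 12) (Set.Iio n)) :
    Within listByRank s (60 * (n * (n * 1))) fun s' =>
      ∀ v < n, s'.narr 1 (place n (s.narr 12) v) = v := by
  refine (Within.for (C := 44) n n (n * 1)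
    (fun i s' => ∀ v < i, s'.narr 1 (place n (s.narr 12) v) = v)
    le_rfl hn (by omega) (fun s' h => ?_) rfl (fun v hv => absurd hv (Nat.not_lt_zero v)) ?_)
  · rw [NExpr.eval, h.nvar 0 rfl, h0]
  intro i hi s₁ g₁ hi₁ hI
  have e12 : s₁.narr 12 = s.narr 12 := g₁.narr 12 rfl
  refine Within.mono (T₁ := 2 + (36 * (n * 1) + 3)) (Within.seq (Within.nset (Within.seq
    ((Within.for (C := 20) n n 1 (fun j s' => s'.nvar 34 = #{u ∈ range j | s.narr 12 u < s.narr 12 i})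
      le_rfl hn le_rfl (fun s' h => ?_) rfl ?_ ?_).conseq le_rfl fun s₂ g₂ h₂ =>
        Within.nput fun v hv => ?_)))) (by omega)
  · rw [NExpr.eval, h.nvar 0 rfl]
    simpa using (g₁.nvar 0 rfl).trans h0
  · simp [NExpr.eval]
  · intro j hj s₂ g₂ hj₂ h₂
    have e33 : s₂.nvar 33 = i := (g₂.nvar 33 rfl).trans (by simpa using hi₁)
    have e12' : s₂.narr 12 = s.narr 12 := (g₂.narr 12 rfl).trans e12
    refine (Within.guard (T := 4) (fun H => Within.nset ?_) fun b hb hne => ?_).mono (by decide)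
    · have H : s.narr 12 j < s.narr 12 i := by
        simpa [Test.Holds, NExpr.eval, e33, hj₂, e12'] using H
      simp [NExpr.eval, h₂, range_add_one, filter_insert, H]
    · simp only [List.mem_singleton] at hb
      subst hb
      have H : ¬ s.narr 12 j < s.narr 12 i := by
        simpa [Test.Holds, NExpr.eval, e33, hj₂, e12'] using hne
      simp [h₂, range_add_one, filter_insert, H]
  · have e33 : s₂.nvar 33 = i := (g₂.nvar 33 rfl).trans (by simpa using hi₁)
    have e1 : s₂.narr 1 = s₁.narr 1 := g₂.narr 1 rfl
    simp only [NExpr.eval, e33, update_self, h₂]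
    change update _ (place n (s.narr 12) i) _ _ = _
    rcases Nat.lt_succ_iff_lt_or_eq.1 hv with h | rfl
    · rw [update_of_ne fun h' => h.ne (place_inj hL (by omega) hi h'), e1, hI v h]
    · rw [update_self]

/-- Compute the data of `HasRanks`. -/
def prepareRanks : Program :=
  .seq (ChamberlinCourant.multiples 3 (.var 1) (.var 0)) <|
  .seq (.nset 20 (.const 0)) <| .for 33 (.var 0) (.nset 20 (.add (.var 20) (.var 0)))

theorem within_prepareRanks {rk : ℕ → ℕ → ℕ} (hn : 1 ≤ n) (h0 : s.nvar 0 = n)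
    (h1 : s.nvar 1 = m) (hrk : ∀ v c, s.narr 0 (v * m + c) = rk v c) :
    Within prepareRanks s (5 + 50 * n) (HasRanks n m rk) := by
  refine Within.mono (T₁ := (3 + 24 * (n * 1)) + (2 + 26 * (n * 1))) (Within.seq
    ((ChamberlinCourant.within_multiples m n n (fun s' h => ?_) (fun s' h => ?_) le_rfl hn).conseq
      le_rfl fun s₁ g₁ h₁ => Within.seq (Within.nset ((Within.for (C := 10) n n 1
        (fun i s' => s'.nvar 20 = i * n) le_rfl hn le_rfl (fun s' h => ?_) rfl ?_ ?_).conseq le_rfl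
          fun s₂ g₂ h₂ => ?_)))) (by omega)
  · rw [NExpr.eval, h.nvar 1 rfl, h1]
  · rw [NExpr.eval, h.nvar 0 rfl, h0]
  · rw [NExpr.eval, h.nvar 0 rfl]
    simpa using (g₁.nvar 0 rfl).trans h0
  · simp [NExpr.eval]
  · intro i hi s₂ g₂ hi₂ h₂
    have e0 : s₂.nvar 0 = n := (g₂.nvar 0 rfl).trans (by simpa using (g₁.nvar 0 rfl).trans h0)
    refine Within.mono (Within.nset ?_) (T₁ := 4) (by omega)
    simp [NExpr.eval, h₂, e0, Nat.succ_mul]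
  · refine ⟨?_, ?_, h₂, ?_, ?_⟩
    · exact (g₂.nvar 0 rfl).trans (by simpa using (g₁.nvar 0 rfl).trans h0)
    · exact (g₂.nvar 1 rfl).trans (by simpa using (g₁.nvar 1 rfl).trans h1)
    · rw [g₂.narr 3 rfl]; exact h₁
    · rw [g₂.narr 0 rfl]
      simpa [g₁.narr 0 rfl] using hrk

/-- Find a suitable order of the voters. -/
def findOrder : Program := .seq prepareRanks (.seq findRanking listByRank)

/-- The bound is of order `n ^ 9 * m ^ 2`: `n ^ 2` rounds, `n` elements to try, `n ^ 2` passes, `m ^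
2` pairs of candidates, `n ^ 3` triples, and `n` for a shift. -/
theorem within_findOrder {P : Profile n m} {σ₀ : Equiv.Perm (Fin n)} (hn : 1 ≤ n) (hm : 1 ≤ m)
    (hP : P.NoAlternation σ₀) (h0 : s.nvar 0 = n) (h1 : s.nvar 1 = m)
    (hrk : s.narr 0 = ChamberlinCourant.table P.rank) (hL : s.narr 12 = fun _ => 0) :
    Within findOrder s
      (650 * (n * n * (n * (n * n * (m * (m * (n * (n * (n * (n * 1)))))))))) fun s' =>
      ∃ σ : Equiv.Perm (Fin n), P.NoAlternation σ ∧ ∀ i : Fin n, s'.narr 1 i = σ i := by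
  set rk : ℕ → ℕ → ℕ := fun v c => s.narr 0 (v * m + c) with hrk'
  have hrank : ∀ (v : Fin n) (c : Fin m), rk v c = P.rank v c := fun v c => by
    simp only [hrk', hrk, ChamberlinCourant.table_apply]
  obtain ⟨τ, hτ, hinj⟩ := hP.exists_stable hrank hn
  set Y := n * n * (n * (n * n * (m * (m * (n * (n * (n * (n * 1)))))))) with hY
  have hnY : n * (n * 1) ≤ Y := by
    have : 1 ≤ n * (n * n * (m * (m * (n * (n * (n * (n * 1))))))) := by
      repeat' apply Nat.mul_pos
      all_goals omega
    calc n * (n * 1) = n * n * 1 := by ring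
      _ ≤ Y := Nat.mul_le_mul_left _ this
  have hn2 : n * 1 ≤ n * (n * 1) := Nat.mul_le_mul_left _ (by omega)
  refine Within.mono (T₁ := (5 + 50 * n) + (522 * Y + 60 * (n * (n * 1)))) (Within.seq
    ((within_prepareRanks (rk := rk) hn h0 h1 fun _ _ => rfl).conseq le_rfl fun s₁ g₁ hs₁ =>
      Within.seq ((within_findRanking hn hm hs₁ hτ hinj ?_).conseq le_rfl
        fun s₂ g₂ ⟨hS₂, hinj₂⟩ => (within_listByRank hn ?_ hinj₂).conseq le_rfl
          fun s₃ _ h₃ => ?_))) (by omega)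
  · rw [g₁.narr 12 rfl, hL]
  · rw [g₂.nvar 0 rfl, hs₁.n_eq]
  set L := s₂.narr 12 with hL₂
  have hbij : Bijective fun v : Fin n => (⟨place n L v, place_lt v.isLt⟩ : Fin n) := by
    refine Finite.injective_iff_bijective.1 fun u v h => Fin.ext ?_
    exact place_inj hinj₂ u.isLt v.isLt (Fin.mk.inj_iff.1 h)
  set π := Equiv.ofBijective _ hbij with hπ
  have hπv : ∀ v : Fin n, (π v).val = place n L v := fun v => rfl
  refine ⟨π.symm, ?_, fun i => ?_⟩
  · refine Profile.noAlternation_of_stable hrank hS₂ fun p q hpq => ?_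
    by_contra h
    rw [not_lt] at h
    rcases h.lt_or_eq with h | h
    · have := place_lt_place (Fin.isLt _) h
      rw [← hπv, ← hπv, Equiv.apply_symm_apply, Equiv.apply_symm_apply] at this
      exact absurd hpq (not_lt.2 (Fin.le_def.2 this.le))
    · have := hinj₂ (Fin.isLt _) (Fin.isLt _) h
      exact hpq.ne' (π.symm.injective (Fin.ext this))
  · have := h₃ (π.symm i) (Fin.isLt _)
    rwa [← hπv, Equiv.apply_symm_apply] at this

end ConsecutiveOrder

/-! ### The theorem -/

open ChamberlinCourant in
theorem mainTheorem5 :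
    -- polynomial time on all two-crossing profiles, no ordering of the voters being given
    (∃ (prog : RAM.Program) (K d : ℕ),
      ∀ (n m k : ℕ) (P : Profile n m) (ρ : Fin n → Fin m → ℚ),
        1 ≤ n → 1 ≤ k → k ≤ m → P.Consistent ρ → P.IsCrossing 2 →
        ∃ (t : ℕ) (s : RAM.Store),
          RAM.Runs prog (ChamberlinCourant.input P ρ k) t s ∧
          t ≤ K * (n * m) ^ d ∧ ChamberlinCourant.Solved ρ k s) ∧
    -- time O(n³k²m) if the voters are given in a two-crossing order
    (∃ (prog : RAM.Program) (K : ℕ),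
      ∀ (n m k : ℕ) (P : Profile n m) (ρ : Fin n → Fin m → ℚ) (σ : Equiv.Perm (Fin n)),
        1 ≤ n → 1 ≤ k → k ≤ m → P.Consistent ρ → P.IsCrossingWrt 2 σ →
        ∃ (t : ℕ) (s : RAM.Store),
          RAM.Runs prog (ChamberlinCourant.inputWithOrder P ρ k σ) t s ∧
          t ≤ K * (n ^ 3 * k ^ 2 * m) ∧ ChamberlinCourant.Solved ρ k s) := by
  -- `2650 = 650 + 2000` adds the constants for finding an order and for solving. The exponent 9
  -- covers both `n ^ 9 * m ^ 2` and, since `k ≤ m`, the bound `n ^ 3 * k ^ 2 * m ≤ (n * m) ^ 3`.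
  refine ⟨⟨.seq ConsecutiveOrder.findOrder solveOrdered, 2650, 9, ?_⟩, solveOrdered, 2000, ?_⟩
  · intro n m k P ρ hn hk hkm hρ ⟨σ₀, hσ₀⟩
    have hm : 1 ≤ m := hk.trans hkm
    refine RAM.Within.mono (RAM.Within.seq ((ConsecutiveOrder.within_findOrder hn hm
      hσ₀.noAlternation rfl rfl rfl rfl).conseq le_rfl fun s₁ g₁ ⟨σ, hP, hσ⟩ =>
        within_solveOrdered hn hk hkm hρ hP ?_ ?_ ?_ hσ ?_ ?_)) ?_
    · rw [g₁.nvar 0 rfl]; rfl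
    · rw [g₁.nvar 1 rfl]; rfl
    · rw [g₁.nvar 2 rfl]; rfl
    · rw [g₁.qarr 0 rfl]; rfl
    · rw [g₁.narr 2 rfl]; rfl
    · have h1 : n * n * (n * (n * n * (m * (m * (n * (n * (n * (n * 1)))))))) ≤ (n * m) ^ 9 :=
        calc _ = n ^ 9 * m ^ 2 := by ring
          _ ≤ n ^ 9 * m ^ 9 := Nat.mul_le_mul_left _ (Nat.pow_le_pow_right hm (by norm_num))
          _ = (n * m) ^ 9 := by ring
      have h2 : n ^ 3 * k ^ 2 * m ≤ (n * m) ^ 9 :=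
        calc n ^ 3 * k ^ 2 * m ≤ n ^ 3 * m ^ 2 * m :=
              Nat.mul_le_mul_right _ (Nat.mul_le_mul_left _ (Nat.pow_le_pow_left hkm 2))
          _ = (n * m) ^ 3 := by ring
          _ ≤ (n * m) ^ 9 := Nat.pow_le_pow_right (Nat.mul_pos hn hm) (by norm_num)
      omega
  · intro n m k P ρ σ hn hk hkm hρ hP
    refine within_solveOrdered hn hk hkm hρ hP.noAlternation rfl rfl rfl (fun i => ?_) rfl rfl
    simp [inputWithOrder]
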